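/- Setting. Let $\Omega_1,\Omega_2,\Omega_3>0$ and $$\varphi(x_1,x_2,x_3)=\prod_{j=1}^3\frac{\sin(\Omega_jx_j)}{\pi x_j}$$ (the $j$-th factor being $\Omega_j/\pi$ at $x_j=0$). For $n=(n_1,n_2,n_3)\in\mathbb N^3$ let $\tau_j=\tau_{j,n_j}>0$ be sampling periods with $n_j\tau_j\to\overline\tau_j\in(0,\infty)$ as $n_j\to\infty$, $j=1,2,3$. One observes $$y_{i}=f(i_1\tau_1,i_2\tau_2,i_3\tau_3)+\varepsilon_{i},\qquad i=(i_1,i_2,i_3),\ 1\le i_j\le n_j .$$ Given a reference signal $f_0$, put $$\mathcal F_n(s,t,r_2,r_3)=\sqrt{\tau_1\tau_2\tau_3}\sum_{l_1=1}^{\lfloor n_1s\rfloor}\sum_{l_2=1}^{n_2}\sum_{l_3=1}^{n_3}\bigl[y_{l_1,l_2,l_3}-f_0(l_1\tau_1,l_2\tau_2,l_3\tau_3)\bigr]\,\varphi(t-l_1\tau_1,r_2-l_2\tau_2,r_3-l_3\tau_3).$$ For $s_0\in(0,1)$, $n_0=\lfloor n_1s_0\rfloor$ and control limits $c_L,c_M>0$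 define the local and the global maximum norm detector $$\mathcal L_n=\min\Bigl\{n_0\le k\le n_1:\max_{r_2\in[0,\overline\tau_2],\,r_3\in[0,\overline\tau_3]}\bigl|\mathcal F_n(\tfrac k{n_1},\tfrac{\overline\tau_1k}{n_1},r_2,r_3)\bigr|>c_L\Bigr\},$$ $$\mathcal M_n=\min\Bigl\{n_0\le k\le n_1:\max_{0\le t\le\overline\tau_1k/n_1}\ \max_{r_2\in[0,\overline\tau_2],\,r_3\in[0,\overline\tau_3]}\bigl|\mathcal F_n(\tfrac k{n_1},t,r_2,r_3)\bigr|>c_M\Bigr\},$$ with $\min\emptyset=+\infty$. Assumptions. (i) $\{\varepsilon_i\}_{i\in\mathbb Z^3}$ is a weakly stationary random field with mean zero, and for some $\sigma\in(0,\infty)$ $$(n_1n_2n_3)^{-1/2}\sum_{i_1=1}^{\lfloor n_1v_1\rfloor}\sum_{i_2=1}^{\lfloor n_2v_2\rfloor}\sum_{i_3=1}^{\lfloor n_3v_3\rfloor}\varepsilon_{i_1,i_2,i_3}\ \Rightarrow\ \sigma B(v_1,v_2,v_3)$$ weakly in the Skorohod space $D[0,1]^3$ as $\min_jn_j\to\infty$.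 Here $B$ is a standard Brownian motion on $[0,1]^3$: almost surely continuous and zero on the faces $\{v_j=0\}$, with increments around pairwise disjoint blocks $\prod_j(a_j,b_j]$ that are independent and centered normal with the volumes of the blocks as variances. (ii) The null hypothesis holds: $f=f_0$ on $[0,\overline\tau_1]\times[0,\overline\tau_2]\times[0,\overline\tau_3]$ and at all sampling points $(i_1\tau_1,i_2\tau_2,i_3\tau_3)$, $1\le i_j\le n_j$. (iii) The learning-sample condition holds: $f(t,r_2,r_3)=f_0(t,r_2,r_3)$ for $0\le t\le s_0\overline\tau_1$, $r_2\in[0,\overline\tau_2]$, $r_3\in[0,\overline\tau_3]$. Let $$\mathcal F(s,t,r_2,r_3)=\sqrt{\overline\tau_1\overline\tau_2\overline\tau_3}\;\sigma\int_0^s\!\int_0^1\!\int_0^1\varphi(t-\overline\tau_1z_1,r_2-\overline\tau_2z_2,r_3-\overline\tau_3z_3)\,\mathrm dB(z_1,z_2,z_3),$$ a pathwise multivariate Riemann–Stieltjes integral defined by integration by parts: for $[a,b]\subset\mathbb R^q$, $g$ smooth and $h$ continuous, $$\int_a^bg\,\mathrm dh:=\sum_{v\subseteq\{1,\dots,q\}}(-1)^{|v|}\int_{a_v}^{b_v}\bigl[h\,\mathrm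 dg\bigr]_{a_{-v}}^{b_{-v}},$$ where $[\,\cdot\,]_{a_{-v}}^{b_{-v}}$ is the alternating sum over the endpoints of the coordinates outside $v$; the summand for $v=\emptyset$ is $[hg]_a^b$. Claim. As $\min_{1\le j\le3}n_j\to\infty$, the following weak convergences hold for random variables with values in the extended real line, where $\inf\emptyset=+\infty$: $$\frac{\mathcal L_n}{n_1}\Rightarrow\mathcal L:=\inf\Bigl\{s\in[s_0,1]:\sup_{r_2\in[0,\overline\tau_2],\,r_3\in[0,\overline\tau_3]}|\mathcal F(s,s\overline\tau_1,r_2,r_3)|>c_L\Bigr\},$$ $$\frac{\mathcal M_n}{n_1}\Rightarrow\mathcal M:=\inf\Bigl\{s\in[s_0,1]:\sup_{0\le t\le s\overline\tau_1}\ \sup_{r_2\in[0,\overline\tau_2],\,r_3\in[0,\overline\tau_3]}|\mathcal F(s,t,r_2,r_3)|>c_M\Bigr\}.$$ -/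

import Mathlib

open MeasureTheory ProbabilityTheory Filter Set
open scoped Topology

noncomputable section

/-! ### Alternating sums, ladders and multivariate Riemann–Stieltjes integrals -/

/-- The alternating sum `Δ(f; a, b) = ∑_v (-1)^|v| f(a_v : b_{-v})` of `f` over the
hyperrectangle `[a, b]`; the point `a_v : b_{-v}` is `v.piecewise a b`. -/
def altSum {ι : Type*} [Fintype ι] [DecidableEq ι] (f : (ι → ℝ) → ℝ) (a b : ι → ℝ) : ℝ :=
  ∑ v : Finset ι, (-1 : ℝ) ^ v.card * f (v.piecewise a b)

/-- A ladder on `[a, b]`: a finite set that contains `a` and otherwise only points of `(a, b)`. -/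
def IsLadder (a b : ℝ) (Y : Finset ℝ) : Prop :=
  a ∈ Y ∧ ∀ y ∈ Y, y = a ∨ (a < y ∧ y < b)

/-- The successor of `y` in a ladder `Y` on `[a, b]`: the next larger element of `Y`, and `b` if
there is none (all elements of the ladder other than `a` are smaller than `b`). -/
def ladderSucc (b : ℝ) (Y : Finset ℝ) (y : ℝ) : ℝ :=
  (insert b (Y.filter (fun z => y < z))).min' (Finset.insert_nonempty _ _)

/-- `∫_a^b h df = I` as a multivariate Riemann–Stieltjes integral: the sums
`∑_{y ∈ 𝒴} h(ỹ) Δ(f; y, y⁺)` over product ladders `𝒴 = ∏ Y_j` on `[a, b]`, with arbitrary tags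
`ỹ ∈ [y, y⁺]`, converge to `I` as the mesh tends to `0`. If `ι` is empty, the integral is the
product of the values of `h` and `f` at the only point. -/
def HasRSIntegral {ι : Type*} [Fintype ι] [DecidableEq ι] (h f : (ι → ℝ) → ℝ) (a b : ι → ℝ)
    (I : ℝ) : Prop :=
  ∀ e > (0 : ℝ), ∃ d > (0 : ℝ), ∀ Y : ι → Finset ℝ,
    (∀ j, IsLadder (a j) (b j) (Y j)) →
    (∀ j, ∀ y ∈ Y j, ladderSucc (b j) (Y j) y - y < d) →
    ∀ tag : (ι → ℝ) → (ι → ℝ),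
      (∀ y ∈ Fintype.piFinset Y, tag y ∈ Icc y (fun j => ladderSucc (b j) (Y j) (y j))) →
      |∑ y ∈ Fintype.piFinset Y,
          h (tag y) * altSum f y (fun j => ladderSucc (b j) (Y j) (y j)) - I| < e

open Classical in
/-- The value of the Riemann–Stieltjes integral `∫_a^b h df` (`0` if it does not exist). -/
def rsIntegral {ι : Type*} [Fintype ι] [DecidableEq ι] (h f : (ι → ℝ) → ℝ) (a b : ι → ℝ) : ℝ :=
  if H : ∃ I, HasRSIntegral h f a b I then H.choose else 0

/-- The point `x_v : z_{-v}`. -/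
def glue {ι : Type*} [DecidableEq ι] (v : Finset ι) (x : v → ℝ) (z : ι → ℝ) : ι → ℝ :=
  fun j => if hj : j ∈ v then x ⟨j, hj⟩ else z j

/-- The Riemann–Stieltjes integral `∫_a^b f dh` with respect to an integrator `h` that may be of
unbounded variation, defined by integration by parts:
`∫_a^b f dh = ∑_v (-1)^|v| ∫_{a_v}^{b_v} [h df]_{a_{-v}}^{b_{-v}}`, with
`[g]_{a_{-v}}^{b_{-v}} = ∑_{w ⊆ -v} (-1)^|w| g(x_v : a_w : b_{-v-w})`. The summand of `v = ∅` is
the boundary term `[h f]_a^b` and that of `v = univ` is `(-1)^q ∫_a^b h df`. -/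
def stieltjesByParts {ι : Type*} [Fintype ι] [DecidableEq ι] (f h : (ι → ℝ) → ℝ)
    (a b : ι → ℝ) : ℝ :=
  ∑ v : Finset ι, (-1 : ℝ) ^ v.card * ∑ w ∈ vᶜ.powerset, (-1 : ℝ) ^ w.card *
    rsIntegral (fun x : v → ℝ => h (glue v x (w.piecewise a b)))
      (fun x : v → ℝ => f (glue v x (w.piecewise a b))) (fun j => a j) (fun j => b j)

/-! ### Brownian motion on the unit cube -/

/-- `B` is a standard Brownian motion on `[0,1]^q` (only the values of `B` at points of the cube
matter): the paths are almost surely continuous and vanish on the lower faces of the cube, and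
increments around pairwise disjoint blocks `∏ (s_j, t_j]` are independent, centered normal with
the volumes of the blocks as variances. -/
structure IsBrownianMotion {Ω : Type*} [MeasurableSpace Ω] {q : ℕ} (B : (Fin q → ℝ) → Ω → ℝ)
    (P : Measure Ω) : Prop where
  continuous_paths : ∀ᵐ ω ∂P, ContinuousOn (fun x => B x ω) (Icc 0 1)
  zero_faces : ∀ᵐ ω ∂P, ∀ x ∈ Icc (0 : Fin q → ℝ) 1, (∃ j, x j = 0) → B x ω = 0
  indep : ∀ (m : ℕ) (s t : Fin m → Fin q → ℝ), (∀ i, 0 ≤ s i ∧ s i ≤ t i ∧ t i ≤ 1) →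
    Pairwise (fun i k => Disjoint (univ.pi fun j => Ioc (s i j) (t i j))
      (univ.pi fun j => Ioc (s k j) (t k j))) →
    iIndepFun (fun i ω => altSum (fun x => B x ω) (s i) (t i)) P
  law : ∀ s t : Fin q → ℝ, 0 ≤ s → s ≤ t → t ≤ 1 →
    HasLaw (fun ω => altSum (fun x => B x ω) s t)
      (gaussianReal 0 (volume (univ.pi fun j => Ioc (s j) (t j))).toNNReal) P

/-! ### The Skorohod space `D[0,1]^q` -/

/-- The quadrant `{s : s_p R_p t_p for all p}` at `t`, where `R_p` is `≥` if `R p = true` and `<` if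
`R p = false`. -/
def quadrant {q : ℕ} (R : Fin q → Bool) (t : Fin q → unitInterval) : Set (Fin q → unitInterval) :=
  {s | ∀ p, if R p = true then t p ≤ s p else s p < t p}

/-- `f` is continuous from above with limits from below: the limits in all `2^q` quadrants exist
at each point, and the one in the quadrant `Q_{≥,…,≥}` is the value of `f`. -/
def IsCadlag {q : ℕ} (f : (Fin q → unitInterval) → ℝ) : Prop :=
  ∀ t, (∀ R, ∃ l, Tendsto f (𝓝[quadrant R t] t) (𝓝 l)) ∧
    Tendsto f (𝓝[quadrant (fun _ => true) t] t) (𝓝 (f t))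

/-- The space `D[0,1]^q`. -/
def SkorohodSpace (q : ℕ) : Type := {f : (Fin q → unitInterval) → ℝ // IsCadlag f}

/-- The relation whose sections are the balls of radius `e` of the Skorohod distance: there is a
time change `λ = (λ_1, …, λ_q)`, made of increasing bijections of `[0,1]`, such that `|λ t - t| < e`
and `|x t - y (λ t)| < e` for all `t`. -/
def SkorohodClose {q : ℕ} (e : ℝ) (x y : SkorohodSpace q) : Prop :=
  ∃ lam : Fin q → (unitInterval ≃o unitInterval),
    (∀ p u, |((lam p u : unitInterval) : ℝ) - (u : ℝ)| < e) ∧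
    ∀ t, |x.1 t - y.1 (fun p => lam p (t p))| < e

/-- The Skorohod topology on `D[0,1]^q`. -/
instance SkorohodSpace.instTopologicalSpace (q : ℕ) : TopologicalSpace (SkorohodSpace q) where
  IsOpen U := ∀ x ∈ U, ∃ e > (0 : ℝ), ∀ y, SkorohodClose e x y → y ∈ U
  isOpen_univ := fun _ _ => ⟨1, one_pos, fun _ _ => mem_univ _⟩
  isOpen_inter := by
    rintro U V hU hV x ⟨hxU, hxV⟩
    obtain ⟨e, he, hU'⟩ := hU x hxU
    obtain ⟨e', he', hV'⟩ := hV x hxV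
    refine ⟨min e e', lt_min he he', ?_⟩
    rintro y ⟨lam, h1, h2⟩
    exact ⟨hU' y ⟨lam, fun p u => (h1 p u).trans_le (min_le_left _ _),
        fun t => (h2 t).trans_le (min_le_left _ _)⟩,
      hV' y ⟨lam, fun p u => (h1 p u).trans_le (min_le_right _ _),
        fun t => (h2 t).trans_le (min_le_right _ _)⟩⟩
  isOpen_sUnion := by
    rintro S hS x ⟨U, hU, hxU⟩
    obtain ⟨e, he, h⟩ := hS U hU x hxU
    exact ⟨e, he, fun y hy => ⟨U, hU, h y hy⟩⟩

instance SkorohodSpace.instMeasurableSpace (q : ℕ) : MeasurableSpace (SkorohodSpace q) :=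
  borel _

instance SkorohodSpace.instBorelSpace (q : ℕ) : BorelSpace (SkorohodSpace q) :=
  ⟨rfl⟩

theorem isCadlag_of_continuous {q : ℕ} {f : (Fin q → unitInterval) → ℝ} (hf : Continuous f) :
    IsCadlag f :=
  fun t => ⟨fun _ => ⟨f t, hf.continuousAt.tendsto.mono_left nhdsWithin_le_nhds⟩,
    hf.continuousAt.tendsto.mono_left nhdsWithin_le_nhds⟩

open Classical in
/-- A function as an element of `D[0,1]^q`. It is used for processes whose paths lie in
`D[0,1]^q` almost surely; the exceptional paths are replaced by `0`. -/
def SkorohodSpace.ofFun {q : ℕ} (f : (Fin q → unitInterval) → ℝ) : SkorohodSpace q :=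
  if h : IsCadlag f then ⟨f, h⟩ else ⟨fun _ => 0, isCadlag_of_continuous continuous_const⟩

/-! ### The noise field -/

/-- A weakly stationary random field on `ℤ³` with mean zero. -/
structure IsWeaklyStationary {Ω : Type*} [MeasurableSpace Ω] (ε : (Fin 3 → ℤ) → Ω → ℝ)
    (P : Measure Ω) : Prop where
  memLp : ∀ i, MemLp (ε i) 2 P
  mean_zero : ∀ i, ∫ ω, ε i ω ∂P = 0
  cov_shift : ∀ i j k, cov[ε (i + k), ε (j + k); P] = cov[ε i, ε j; P]

/-- The partial sums `(n₁n₂n₃)^{-1/2} ∑_{i₁ ≤ ⌊n₁v₁⌋} ∑_{i₂ ≤ ⌊n₂v₂⌋} ∑_{i₃ ≤ ⌊n₃v₃⌋} e_{i₁,i₂,i₃}`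
of a real array `e`, as a function on `[0,1]³`. -/
def partialSumFun (e : (Fin 3 → ℤ) → ℝ) (n : Fin 3 → ℕ) (v : Fin 3 → unitInterval) : ℝ :=
  (∏ j, (n j : ℝ)) ^ (-(1 / 2) : ℝ) *
    ∑ i ∈ Finset.Icc (1 : Fin 3 → ℕ) (fun j => ⌊(n j : ℝ) * (v j : ℝ)⌋₊), e (fun j => (i j : ℤ))

theorem eventually_floor_const (m : ℕ) (b : Bool) (u : unitInterval) :
    ∃ k : ℕ, ∀ᶠ x : unitInterval in 𝓝 u, (if b = true then u ≤ x else x < u) →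
      ⌊(m : ℝ) * (x : ℝ)⌋₊ = k := by
  have hc : Continuous (fun x : unitInterval => (m : ℝ) * (x : ℝ)) := by fun_prop
  have hm : (0 : ℝ) ≤ m := m.cast_nonneg
  cases b with
  | true =>
    refine ⟨⌊(m : ℝ) * (u : ℝ)⌋₊, ?_⟩
    filter_upwards [hc.continuousAt.eventually_lt_const (Nat.lt_floor_add_one ((m : ℝ) * (u : ℝ)))]
      with x hx hux
    have hux' : (u : ℝ) ≤ x := by simpa using hux
    have h0 : (0 : ℝ) ≤ (m : ℝ) * x := mul_nonneg hm x.2.1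
    rw [Nat.floor_eq_iff h0]
    exact ⟨(Nat.floor_le (mul_nonneg hm u.2.1)).trans (mul_le_mul_of_nonneg_left hux' hm), hx⟩
  | false =>
    refine ⟨⌈(m : ℝ) * (u : ℝ)⌉₊ - 1, ?_⟩
    rcases Nat.eq_zero_or_pos m with rfl | hpos
    · exact Eventually.of_forall fun x _ => by simp
    have hlt : ((⌈(m : ℝ) * (u : ℝ)⌉₊ : ℝ) - 1) < (m : ℝ) * (u : ℝ) := by
      linarith [Nat.ceil_lt_add_one (mul_nonneg hm u.2.1)]
    filter_upwards [hc.continuousAt.eventually_const_lt hlt] with x hx hux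
    have hux' : (x : ℝ) < u := by simpa using hux
    have h0 : (0 : ℝ) ≤ (m : ℝ) * x := mul_nonneg hm x.2.1
    have hm' : (0 : ℝ) < m := by exact_mod_cast hpos
    have h1 : (m : ℝ) * x < (m : ℝ) * u := mul_lt_mul_of_pos_left hux' hm'
    have h2 : (m : ℝ) * (u : ℝ) ≤ ⌈(m : ℝ) * (u : ℝ)⌉₊ := Nat.le_ceil _
    have h3 : 1 ≤ ⌈(m : ℝ) * (u : ℝ)⌉₊ := Nat.ceil_pos.2 (h0.trans_lt h1)
    rw [Nat.floor_eq_iff h0, Nat.cast_sub h3]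
    push_cast
    exact ⟨hx.le, by linarith⟩

theorem isCadlag_partialSumFun (e : (Fin 3 → ℤ) → ℝ) (n : Fin 3 → ℕ) :
    IsCadlag (partialSumFun e n) := by
  intro t
  have key : ∀ R : Fin 3 → Bool, ∃ l, ∀ᶠ s in 𝓝[quadrant R t] t, partialSumFun e n s = l := by
    intro R
    choose k hk using fun p => eventually_floor_const (n p) (R p) (t p)
    refine ⟨(∏ j, (n j : ℝ)) ^ (-(1 / 2) : ℝ) *
      ∑ i ∈ Finset.Icc (1 : Fin 3 → ℕ) k, e (fun j => (i j : ℤ)), ?_⟩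
    have hall : ∀ᶠ s in 𝓝 t, ∀ p, (if R p = true then t p ≤ s p else s p < t p) →
        ⌊(n p : ℝ) * (s p : ℝ)⌋₊ = k p :=
      eventually_all.2 fun p => (continuous_apply p).continuousAt.eventually (hk p)
    rw [eventually_nhdsWithin_iff]
    filter_upwards [hall] with s hs hsQ
    have : (fun j => ⌊(n j : ℝ) * (s j : ℝ)⌋₊) = k := funext fun p => hs p (hsQ p)
    simp only [partialSumFun, this]
  refine ⟨fun R => ?_, ?_⟩
  · obtain ⟨l, hl⟩ := key R
    exact ⟨l, tendsto_nhds_of_eventually_eq hl⟩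
  · obtain ⟨l, hl⟩ := key fun _ => true
    have ht : t ∈ quadrant (fun _ => true) t := fun p => by simp
    rw [hl.self_of_nhdsWithin ht]
    exact tendsto_nhds_of_eventually_eq hl

/-- The partial sum process `Z_n` of the noise, as a random element of `D[0,1]³`. -/
def partialSumProcess {Ω : Type*} (ε : (Fin 3 → ℤ) → Ω → ℝ) (n : Fin 3 → ℕ) (ω : Ω) :
    SkorohodSpace 3 :=
  ⟨partialSumFun (fun i => ε i ω) n, isCadlag_partialSumFun _ n⟩

/-! ### The detection process and its limit -/

/-- The product reconstruction kernel `φ(x) = ∏_j sin(Ω_j x_j) / (π x_j)` with bandwidths `Ω_j`;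
the `j`-th factor is `Ω_j / π` at `x_j = 0`. -/
def kernel (W : Fin 3 → ℝ) (x : Fin 3 → ℝ) : ℝ :=
  ∏ j, W j / Real.pi * Real.sinc (W j * x j)

/-- The sampling point `(i₁τ₁, i₂τ₂, i₃τ₃)`, where `τ_j = τ_{j, n_j}` is the `j`-th sampling period
at sample size `n`. -/
def samplingPoint (τ : Fin 3 → ℕ → ℝ) (n i : Fin 3 → ℕ) : Fin 3 → ℝ :=
  fun j => (i j : ℝ) * τ j (n j)

/-- The noisy samples `y_i = f(i₁τ₁, i₂τ₂, i₃τ₃) + ε_i`. -/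
def observation {Ω : Type*} (f : (Fin 3 → ℝ) → ℝ) (ε : (Fin 3 → ℤ) → Ω → ℝ) (τ : Fin 3 → ℕ → ℝ)
    (n i : Fin 3 → ℕ) (ω : Ω) : ℝ :=
  f (samplingPoint τ n i) + ε (fun j => (i j : ℤ)) ω

/-- The detection process `𝓕_n(s, x)`, `x = (t, r₂, r₃)`:
`√(τ₁τ₂τ₃) ∑_{l₁ ≤ ⌊n₁s⌋} ∑_{l₂ ≤ n₂} ∑_{l₃ ≤ n₃} [y_l - f₀(lτ)] φ(x - lτ)`. -/
def detectionProcess {Ω : Type*} (W : Fin 3 → ℝ) (τ : Fin 3 → ℕ → ℝ) (f f₀ : (Fin 3 → ℝ) → ℝ)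
    (ε : (Fin 3 → ℤ) → Ω → ℝ) (n : Fin 3 → ℕ) (ω : Ω) (s : ℝ) (x : Fin 3 → ℝ) : ℝ :=
  Real.sqrt (∏ j, τ j (n j)) *
    ∑ l ∈ Finset.Icc (1 : Fin 3 → ℕ) ![⌊(n 0 : ℝ) * s⌋₊, n 1, n 2],
      (observation f ε τ n l ω - f₀ (samplingPoint τ n l)) * kernel W (x - samplingPoint τ n l)

/-- The limit process `𝓕(s, x)`, `x = (t, r₂, r₃)`:
`√(τ̄₁τ̄₂τ̄₃) σ ∫_0^s ∫_0^1 ∫_0^1 φ(x - (τ̄₁z₁, τ̄₂z₂, τ̄₃z₃)) dB(z)`. -/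
def limitProcess {Ω : Type*} (W τbar : Fin 3 → ℝ) (σ : ℝ) (B : (Fin 3 → ℝ) → Ω → ℝ) (ω : Ω)
    (s : ℝ) (x : Fin 3 → ℝ) : ℝ :=
  Real.sqrt (∏ j, τbar j) * σ *
    stieltjesByParts (fun z => kernel W (x - τbar * z)) (fun z => B z ω) 0 ![s, 1, 1]

/-! ### Detectors -/

/-- `sup_{r₂ ∈ [0, τ̄₂], r₃ ∈ [0, τ̄₃]} |G(s, sτ̄₁, r₂, r₃)|`. -/
def localSup (τbar : Fin 3 → ℝ) (G : ℝ → (Fin 3 → ℝ) → ℝ) (s : ℝ) : ℝ :=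
  sSup ((fun x => |G s x|) '' Icc ![s * τbar 0, 0, 0] ![s * τbar 0, τbar 1, τbar 2])

/-- `sup_{0 ≤ t ≤ sτ̄₁} sup_{r₂ ∈ [0, τ̄₂], r₃ ∈ [0, τ̄₃]} |G(s, t, r₂, r₃)|`. -/
def globalSup (τbar : Fin 3 → ℝ) (G : ℝ → (Fin 3 → ℝ) → ℝ) (s : ℝ) : ℝ :=
  sSup ((fun x => |G s x|) '' Icc ![0, 0, 0] ![s * τbar 0, τbar 1, τbar 2])

/-- `min {n₀ ≤ k ≤ n₁ : D(k / n₁) > c}`, with `n₀ = ⌊n₁s₀⌋` and `min ∅ = +∞`. -/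
def discretePassageTime (s₀ : ℝ) (n₁ : ℕ) (c : ℝ) (D : ℝ → ℝ) : EReal :=
  sInf ((fun k : ℕ => ((k : ℝ) : EReal)) ''
    {k : ℕ | ⌊(n₁ : ℝ) * s₀⌋₊ ≤ k ∧ k ≤ n₁ ∧ c < D ((k : ℝ) / (n₁ : ℝ))})

/-- `inf {s ∈ [s₀, 1] : D(s) > c}`, with `inf ∅ = +∞`. -/
def passageTime (s₀ c : ℝ) (D : ℝ → ℝ) : EReal :=
  sInf ((fun s : ℝ => (s : EReal)) '' {s : ℝ | s ∈ Icc s₀ 1 ∧ c < D s})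

/-! ### Conditions on the signal -/

/-- The null hypothesis: signal and reference signal agree on the observation region
`[0, τ̄₁] × [0, τ̄₂] × [0, τ̄₃]` and at the points where the signal is sampled (these may fall outside
the region, as `n_j τ_j` is only required to converge to `τ̄_j`). -/
def NullHypothesis (τbar : Fin 3 → ℝ) (τ : Fin 3 → ℕ → ℝ) (f f₀ : (Fin 3 → ℝ) → ℝ) : Prop :=
  (∀ x ∈ Icc 0 τbar, f x = f₀ x) ∧
    ∀ n i : Fin 3 → ℕ, 1 ≤ i → i ≤ n → f (samplingPoint τ n i) = f₀ (samplingPoint τ n i)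

/-- The learning-sample condition: no change for times `0 ≤ t ≤ s₀ τ̄₁`. -/
def LearningSample (s₀ : ℝ) (τbar : Fin 3 → ℝ) (f f₀ : (Fin 3 → ℝ) → ℝ) : Prop :=
  ∀ x ∈ Icc 0 τbar, x 0 ≤ s₀ * τbar 0 → f x = f₀ x

end

noncomputable section

/-! ### Derivative of the cardinal sine -/

/-! Under the null hypothesis the signal cancels, and the detection process is a kernel-weighted sum
of the noise, that is, an integral of the kernel against the partial sum path. Integration by parts
moves the differential to the smooth kernel. On paths vanishing on the lower faces, what remains is
the integral of the path against a bounded density with respect to a finite measure: in each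
coordinate Lebesgue measure on [0,1) with density minus the derivative of the kernel factor, plus an
atom at the endpoint 1 with density its value there. This functional makes sense for step paths and
for Brownian paths alike. It reproduces the detection process exactly
(`detectionProcess_eq_pathIntegral`) and the limit process almost surely
(`limitProcess_eq_pathFunctional`), and it is linear and Lipschitz in the sup norm of the path,
uniformly in time and position.

The time-dependent window is rescaled to a fixed box of relative positions, so that the supremum
over positions is a continuous function of time whenever the path is continuous. Skorohod
convergence to a continuous path is uniform convergence; hence the whole detector curves converge
uniformly (`eventually_abs_relSup_sub_lt`), and an extended continuous mapping theorem
(`tendstoInDistribution_of_tendsto_prod`) reduces the claim to convergence of passage times along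
almost every limit path. A first passage time above c is stable under uniform perturbation unless
the curve touches the level without crossing it. It is enough that the running maximum over [s₀, r]
differs from c for every rational r (`tendsto_discretePassageTime`).

It remains to see that these maxima have no atoms (`IsBrownianMotion.ae_sSup_relSup_ne`). Write B =
(B − vol·B(1,1,1)) + vol·B(1,1,1). The tied-down part is independent of the Gaussian variable
B(1,1,1) on all grids, by a covariance computation. With the tied-down part fixed, the maximum is a
↦ sup |G + a h| at a = B(1,1,1), where h is the functional of the volume function. It factors into
integrals of sinc over intervals containing 0, hence is positive because the sine integral is
positive (`integral_sinc_pos`). A supremum of absolute values of affine functions with nonzero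
slopes takes the value c at most twice (`finite_setOf_sSup_abs_affine_eq`), so Fubini gives
probability zero.

Measurability is handled by discretization: partial sum paths are step paths, and the functionals of
step paths depend continuously on finitely many grid values. -/

/-- The derivative of `Real.sinc`. -/
def sincDeriv (x : ℝ) : ℝ := ∫ t in (0 : ℝ)..1, -(t * Real.sin (t * x))

/-- As an average of cosines, sinc can be differentiated under the integral sign at every point, 0
included, and its derivative is visibly continuous and bounded by 1. -/
theorem sinc_eq_integral_cos (x : ℝ) : Real.sinc x = ∫ t in (0 : ℝ)..1, Real.cos (t * x) := by
  rcases eq_or_ne x 0 with rfl | hx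
  · simp
  · rw [intervalIntegral.integral_comp_mul_right (fun t => Real.cos t) hx,
      Real.sinc_of_ne_zero hx]
    simp [div_eq_inv_mul]

theorem hasDerivAt_sinc (x : ℝ) : HasDerivAt Real.sinc (sincDeriv x) x := by
  have h := intervalIntegral.hasDerivAt_integral_of_dominated_loc_of_deriv_le
    (F := fun x t => Real.cos (t * x)) (F' := fun x t => -(t * Real.sin (t * x)))
    (μ := volume) (a := 0) (b := 1) (x₀ := x) (s := univ) (bound := fun _ => 1)
    Filter.univ_mem
    (Eventually.of_forall fun y => (by fun_prop : Continuous _).aestronglyMeasurable)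
    ((by fun_prop : Continuous _).intervalIntegrable _ _)
    (by fun_prop : Continuous _).aestronglyMeasurable
    (Eventually.of_forall fun t ht y _ => by
      rw [uIoc_of_le zero_le_one] at ht
      rw [norm_neg, norm_mul, Real.norm_eq_abs, Real.norm_eq_abs, abs_of_pos ht.1]
      exact mul_le_one₀ ht.2 (abs_nonneg _) (Real.abs_sin_le_one _))
    (by simp)
    (Eventually.of_forall fun t _ y _ => by
      have := ((hasDerivAt_id y).const_mul t).cos
      simpa [mul_comm] using this)
  have h2 := h.2
  rwa [show (fun y => ∫ t in (0 : ℝ)..1, Real.cos (t * y)) = Real.sinc from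
    funext fun y => (sinc_eq_integral_cos y).symm] at h2

theorem abs_sincDeriv_le_one (x : ℝ) : |sincDeriv x| ≤ 1 := by
  have := intervalIntegral.norm_integral_le_of_norm_le_const (a := (0 : ℝ)) (b := 1) (C := 1)
    (f := fun t => -(t * Real.sin (t * x))) (fun t ht => by
      rw [uIoc_of_le zero_le_one] at ht
      rw [norm_neg, norm_mul, Real.norm_eq_abs, Real.norm_eq_abs, abs_of_pos ht.1]
      exact mul_le_one₀ ht.2 (abs_nonneg _) (Real.abs_sin_le_one _))
  simpa [sincDeriv] using this

@[fun_prop]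
theorem continuous_sincDeriv : Continuous sincDeriv := by
  unfold sincDeriv
  exact intervalIntegral.continuous_parametric_intervalIntegral_of_continuous' (by fun_prop) _ _

/-! ### Integration by parts against the kernel in one variable -/

/-- Lebesgue measure on `[0, 1)` together with a unit mass at the endpoint `1`. -/
def endpointMeasure : Measure ℝ := volume.restrict (Ico 0 1) + Measure.dirac 1

instance : IsFiniteMeasure endpointMeasure := by
  unfold endpointMeasure; infer_instance

/-- The `j`-th factor of the kernel along the segment from `x` to `x - ϑ`. -/
def kernelFactor (w ϑ x u : ℝ) : ℝ := w / Real.pi * Real.sinc (w * (x - ϑ * u))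

/-- The negative derivative of `kernelFactor` in `u`. -/
def kernelSlope (w ϑ x u : ℝ) : ℝ := w / Real.pi * (w * ϑ) * sincDeriv (w * (x - ϑ * u))

open Classical in
/-- The density with respect to `endpointMeasure` of the functional
`h ↦ g 1 * h 1 - ∫ u in 0..1, h u * g' u`, where `g = kernelFactor w ϑ x`. -/
def byPartsDensity (w ϑ x u : ℝ) : ℝ :=
  if u = 1 then kernelFactor w ϑ x 1 else kernelSlope w ϑ x u

theorem hasDerivAt_kernelFactor (w ϑ x u : ℝ) :
    HasDerivAt (kernelFactor w ϑ x) (-kernelSlope w ϑ x u) u := by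
  have h1 : HasDerivAt (fun u => w * (x - ϑ * u)) (w * (-ϑ)) u := by
    have := (((hasDerivAt_id u).const_mul ϑ).const_sub x).const_mul w
    simpa using this
  have := ((hasDerivAt_sinc (w * (x - ϑ * u))).comp u h1).const_mul (w / Real.pi)
  refine this.congr_deriv ?_
  unfold kernelSlope; ring

@[fun_prop]
theorem continuous_kernelFactor {X : Type*} [TopologicalSpace X] {w ϑ x u : X → ℝ}
    (hw : Continuous w) (hϑ : Continuous ϑ) (hx : Continuous x) (hu : Continuous u) :
    Continuous fun a => kernelFactor (w a) (ϑ a) (x a) (u a) := by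
  unfold kernelFactor
  have := Real.continuous_sinc
  fun_prop

@[fun_prop]
theorem continuous_kernelSlope {X : Type*} [TopologicalSpace X] {w ϑ x u : X → ℝ}
    (hw : Continuous w) (hϑ : Continuous ϑ) (hx : Continuous x) (hu : Continuous u) :
    Continuous fun a => kernelSlope (w a) (ϑ a) (x a) (u a) := by
  unfold kernelSlope
  fun_prop

theorem continuous_byPartsDensity {X : Type*} [TopologicalSpace X] {w ϑ x : X → ℝ}
    (hw : Continuous w) (hϑ : Continuous ϑ) (hx : Continuous x) (u : ℝ) :
    Continuous fun a => byPartsDensity (w a) (ϑ a) (x a) u := by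
  unfold byPartsDensity
  split_ifs <;> fun_prop

@[fun_prop]
theorem measurable_byPartsDensity (w ϑ x : ℝ) : Measurable (byPartsDensity w ϑ x) := by
  unfold byPartsDensity
  refine Measurable.ite (measurableSet_singleton 1) measurable_const ?_
  exact (by fun_prop : Continuous fun u => kernelSlope w ϑ x u).measurable

theorem abs_byPartsDensity_le {w ϑ R : ℝ} (hw : 0 ≤ w) (hϑ : |ϑ| ≤ R) (x u : ℝ) :
    |byPartsDensity w ϑ x u| ≤ w * (1 + w * R) := by
  have h1 : w / Real.pi ≤ w := div_le_self hw (by linarith [Real.pi_gt_three])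
  have h0 : 0 ≤ w / Real.pi := div_nonneg hw Real.pi_pos.le
  have h2 : |w * ϑ| ≤ w * R := by
    rw [abs_mul, abs_of_nonneg hw]; exact mul_le_mul_of_nonneg_left hϑ hw
  have h3 : 0 ≤ w * R := (abs_nonneg _).trans h2
  unfold byPartsDensity kernelFactor kernelSlope
  split_ifs
  · rw [abs_mul, abs_of_nonneg h0]
    have := Real.abs_sinc_le_one (w * (x - ϑ * 1))
    calc _ ≤ w * 1 := by gcongr
      _ ≤ _ := by gcongr; linarith
  · rw [abs_mul, abs_mul, abs_of_nonneg h0]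
    have := abs_sincDeriv_le_one (w * (x - ϑ * u))
    calc _ ≤ w * (w * R) * 1 := by gcongr
      _ ≤ _ := by rw [mul_one]; gcongr; linarith

theorem byPartsDensity_ae_eq (w ϑ x : ℝ) :
    byPartsDensity w ϑ x =ᵐ[volume.restrict (Ico 0 1)] kernelSlope w ϑ x := by
  filter_upwards [ae_restrict_mem measurableSet_Ico] with u hu
  simp [byPartsDensity, hu.2.ne]

theorem integral_kernelSlope (w ϑ x a b : ℝ) :
    ∫ u in a..b, kernelSlope w ϑ x u = kernelFactor w ϑ x a - kernelFactor w ϑ x b := by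
  have h := intervalIntegral.integral_eq_sub_of_hasDerivAt
    (fun u _ => hasDerivAt_kernelFactor w ϑ x u)
    ((by fun_prop : Continuous fun u => -kernelSlope w ϑ x u).intervalIntegrable a b)
  rw [intervalIntegral.integral_neg] at h
  linarith

theorem integral_Ico_kernelSlope (w ϑ x : ℝ) {a b : ℝ} (hab : a ≤ b) :
    ∫ u in Ico a b, kernelSlope w ϑ x u = kernelFactor w ϑ x a - kernelFactor w ϑ x b := by
  rw [integral_Ico_eq_integral_Ioo, ← integral_Ioc_eq_integral_Ioo,
    ← intervalIntegral.integral_of_le hab, integral_kernelSlope]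

/-- The functional with density `byPartsDensity`, on functions `h`. -/
theorem integral_endpointMeasure {w ϑ : ℝ} (x : ℝ) {h : ℝ → ℝ}
    (hi : Integrable (fun u => h u * kernelSlope w ϑ x u) (volume.restrict (Ico 0 1))) :
    ∫ u, h u * byPartsDensity w ϑ x u ∂endpointMeasure =
      (∫ u in Ico 0 1, h u * kernelSlope w ϑ x u) + h 1 * kernelFactor w ϑ x 1 := by
  have hae : (fun u => h u * byPartsDensity w ϑ x u) =ᵐ[volume.restrict (Ico 0 1)]
      fun u => h u * kernelSlope w ϑ x u := by
    filter_upwards [byPartsDensity_ae_eq w ϑ x] with u hu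
    rw [hu]
  unfold endpointMeasure
  rw [integral_add_measure (hi.congr hae.symm) (integrable_dirac (by
      rw [enorm_mul]; exact ENNReal.mul_lt_top enorm_lt_top enorm_lt_top)), integral_dirac,
    integral_congr_ae hae]
  simp [byPartsDensity]

/-- The slope integrates to g(p) − g(1) over [p,1), and the atom at 1 gives g(1) back. So a unit
jump at p, even at p = 1, is mapped to g(p): this is summation by parts for a single noise variable.
-/
theorem integral_tail_byPartsDensity (w ϑ x : ℝ) {p : ℝ} (hp : 0 ≤ p) (hp' : p ≤ 1) :
    ∫ u, (Ici p).indicator 1 u * byPartsDensity w ϑ x u ∂endpointMeasure =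
      kernelFactor w ϑ x p := by
  have hc : Continuous fun u => kernelSlope w ϑ x u := by fun_prop
  have hI : IntegrableOn (fun u => kernelSlope w ϑ x u) (Ico 0 1) :=
    (hc.integrableOn_Icc (a := 0) (b := 1)).mono_set Ico_subset_Icc_self
  have hi : (fun u => (Ici p).indicator (1 : ℝ → ℝ) u * kernelSlope w ϑ x u) =
      (Ici p).indicator (fun u => kernelSlope w ϑ x u) := by
    ext u; by_cases hu : u ∈ Ici p <;> simp [hu]
  rw [integral_endpointMeasure x (by
    rw [hi]; exact hI.integrable.indicator measurableSet_Ici), hi,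
    setIntegral_indicator measurableSet_Ici,
    show Ico (0 : ℝ) 1 ∩ Ici p = Ico p 1 by
      ext u; simp only [mem_inter_iff, mem_Ico, mem_Ici]
      exact ⟨fun h => ⟨h.2, h.1.2⟩, fun h => ⟨⟨hp.trans h.1, h.2⟩, h.1⟩⟩,
    integral_Ico_kernelSlope _ _ _ hp', indicator_of_mem (show (1 : ℝ) ∈ Ici p from hp')]
  simp

/-- For the identity path the by-parts functional is the ordinary integral of the kernel factor;
this gives its action on the volume function. -/
theorem integral_id_mul_byPartsDensity (w ϑ x : ℝ) :
    ∫ u, u * byPartsDensity w ϑ x u ∂endpointMeasure =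
      ∫ u in (0 : ℝ)..1, kernelFactor w ϑ x u := by
  have hc : Continuous fun u => kernelSlope w ϑ x u := by fun_prop
  have hI : IntegrableOn (fun u => u * kernelSlope w ϑ x u) (Ico 0 1) :=
    ((continuous_id.mul hc).integrableOn_Icc (a := 0) (b := 1)).mono_set Ico_subset_Icc_self
  rw [integral_endpointMeasure (h := fun u => u) x hI.integrable, integral_Ico_eq_integral_Ioo,
    ← integral_Ioc_eq_integral_Ioo, ← intervalIntegral.integral_of_le zero_le_one]
  have := intervalIntegral.integral_mul_deriv_eq_deriv_mul (a := (0 : ℝ)) (b := 1)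
    (u := fun u => u) (u' := fun _ => 1) (v := kernelFactor w ϑ x)
    (v' := fun u => -kernelSlope w ϑ x u)
    (fun u _ => hasDerivAt_id u) (fun u _ => hasDerivAt_kernelFactor w ϑ x u)
    (by simp) (hc.neg.intervalIntegrable _ _)
  simp only [mul_neg, intervalIntegral.integral_neg, one_mul, zero_mul, sub_zero] at this
  linarith

/-! ### Positivity of the sine integral -/

/-- Integrating by parts, the sine integral equals (1 − cos x)/x plus half the integral of
sinc(t/2)² over [0, x]. The first term, written (x/2) sinc(x/2)², is nonnegative; `S` is the second
one, identified through its derivative. -/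
theorem integral_sinc_pos {x : ℝ} (hx : 0 < x) : 0 < ∫ t in (0 : ℝ)..x, Real.sinc t := by
  set S : ℝ → ℝ := fun x => (∫ t in (0 : ℝ)..x, Real.sinc t) - x / 2 * Real.sinc (x / 2) ^ 2
    with hS
  have hder : ∀ y : ℝ, 0 < y → HasDerivAt S (Real.sinc (y / 2) ^ 2 / 2) y := by
    intro y hy
    have hd1 : HasDerivAt (fun x => ∫ t in (0 : ℝ)..x, Real.sinc t) (Real.sinc y) y :=
      intervalIntegral.integral_hasDerivAt_right (Real.continuous_sinc.intervalIntegrable _ _)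
        (Real.continuous_sinc.stronglyMeasurableAtFilter _ _) Real.continuous_sinc.continuousAt
    have hd2 : HasDerivAt (fun x => (1 - Real.cos x) / x)
        ((Real.sin y * y - (1 - Real.cos y)) / y ^ 2) y := by
      exact (((Real.hasDerivAt_cos y).const_sub 1).div (hasDerivAt_id y) hy.ne').congr_deriv
        (by simp)
    have key : ∀ z : ℝ, 0 < z → z / 2 * Real.sinc (z / 2) ^ 2 = (1 - Real.cos z) / z := by
      intro z hz
      rw [Real.sinc_of_ne_zero (by positivity)]
      have : Real.cos z = 1 - 2 * Real.sin (z / 2) ^ 2 := by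
        have := Real.cos_two_mul (z / 2)
        rw [show 2 * (z / 2) = z by ring, Real.cos_sq'] at this
        linarith
      rw [this]; field_simp; ring
    have hd3 : HasDerivAt (fun x => x / 2 * Real.sinc (x / 2) ^ 2)
        ((Real.sin y * y - (1 - Real.cos y)) / y ^ 2) y :=
      hd2.congr_of_eventuallyEq
        ((eventually_gt_nhds hy).mono fun z hz => key z hz)
    refine (hd1.sub hd3).congr_deriv ?_
    have h2 := key y hy
    rw [show Real.sinc (y / 2) ^ 2 / 2 = (1 - Real.cos y) / y / y by
      rw [← h2]; field_simp, Real.sinc_of_ne_zero hy.ne']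
    field_simp; ring
  have hcont : Continuous S := by
    have := Real.continuous_sinc
    refine Continuous.sub ?_ (by fun_prop)
    exact intervalIntegral.continuous_primitive
      (fun a b => Real.continuous_sinc.intervalIntegrable a b) 0
  have hmono : MonotoneOn S (Ici 0) := by
    refine monotoneOn_of_deriv_nonneg (convex_Ici 0) hcont.continuousOn ?_ ?_
    · intro y hy
      rw [interior_Ici] at hy
      exact (hder y hy).differentiableAt.differentiableWithinAt
    · intro y hy
      rw [interior_Ici] at hy
      rw [(hder y hy).deriv]; positivity
  have hsm : 0 < S x := by
    -- Strict growth of `S` is needed only near 0, where sin(z/2) > 0 is immediate; beyond that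
    -- monotonicity suffices.
    set y := min x 1 with hy
    have hy0 : 0 < y := lt_min hx one_pos
    have hyS : StrictMonoOn S (Icc 0 1) := by
      refine strictMonoOn_of_deriv_pos (convex_Icc 0 1) hcont.continuousOn fun z hz => ?_
      rw [interior_Icc] at hz
      rw [(hder z hz.1).deriv, Real.sinc_of_ne_zero (by linarith [hz.1])]
      have : 0 < Real.sin (z / 2) :=
        Real.sin_pos_of_pos_of_lt_pi (by linarith [hz.1]) (by linarith [hz.2, Real.pi_gt_three])
      have hz1 := hz.1
      positivity
    have h1 : S 0 < S y := hyS ⟨le_rfl, zero_le_one⟩ ⟨hy0.le, min_le_right _ _⟩ hy0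
    have h2 : S y ≤ S x := hmono hy0.le hx.le (min_le_left _ _)
    have h0 : S 0 = 0 := by simp [hS]
    linarith
  have : 0 ≤ x / 2 * Real.sinc (x / 2) ^ 2 := by positivity
  simp only [hS] at hsm
  linarith

theorem integral_sinc_nonneg {x : ℝ} (hx : 0 ≤ x) : 0 ≤ ∫ t in (0 : ℝ)..x, Real.sinc t := by
  rcases hx.eq_or_lt with rfl | hx
  · simp
  · exact (integral_sinc_pos hx).le

/-- After substitution sinc is integrated from −wϑ(1 − q) to wϑq. As sinc is even, this is a sum of
two sine integrals with nonnegative arguments that do not both vanish. -/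
theorem integral_kernelFactor_pos {w ϑ q : ℝ} (hw : 0 < w) (hϑ : 0 < ϑ) (hq : 0 ≤ q)
    (hq' : q ≤ 1) : 0 < ∫ u in (0 : ℝ)..1, kernelFactor w ϑ (ϑ * q) u := by
  have hne : w * ϑ ≠ 0 := by positivity
  have h1 : ∀ u, kernelFactor w ϑ (ϑ * q) u =
      w / Real.pi * Real.sinc (w * ϑ * q - w * ϑ * u) := fun u => by
    unfold kernelFactor; congr 2; ring
  simp only [h1]
  rw [intervalIntegral.integral_const_mul,
    intervalIntegral.integral_comp_sub_mul (fun t => Real.sinc t) hne, smul_eq_mul]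
  have hint : ∀ a b, IntervalIntegrable Real.sinc volume a b :=
    fun a b => Real.continuous_sinc.intervalIntegrable a b
  have hsplit : ∫ t in (w * ϑ * q - w * ϑ * 1)..(w * ϑ * q - w * ϑ * 0), Real.sinc t =
      (∫ t in (0 : ℝ)..(w * ϑ * (1 - q)), Real.sinc t) +
        ∫ t in (0 : ℝ)..(w * ϑ * q), Real.sinc t := by
    rw [← intervalIntegral.integral_add_adjacent_intervals (hint _ 0) (hint 0 _)]
    congr 1
    · have := intervalIntegral.integral_comp_neg (fun t => Real.sinc t) (a := 0)
        (b := w * ϑ * (1 - q))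
      simp only [Real.sinc_neg, neg_zero] at this
      rw [this]; congr 1; ring
    · congr 1; ring
  rw [hsplit]
  have hpos : 0 < w * ϑ := by positivity
  have : 0 < (∫ t in (0 : ℝ)..(w * ϑ * (1 - q)), Real.sinc t) +
        ∫ t in (0 : ℝ)..(w * ϑ * q), Real.sinc t := by
    rcases hq.eq_or_lt with rfl | hq0
    · have := integral_sinc_pos (x := w * ϑ * (1 - 0)) (by simpa using hpos)
      simpa using this
    · have h1 := integral_sinc_pos (x := w * ϑ * q) (by positivity)
      have h2 := integral_sinc_nonneg (x := w * ϑ * (1 - q))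
        (mul_nonneg hpos.le (by linarith))
      linarith
  have := Real.pi_pos
  positivity

/-! ### The path functional behind the detection process and its limit -/

/-- A path on the unit cube, extended to the whole space by projecting on the cube. -/
def extendPath {ι : Type*} (y : (ι → unitInterval) → ℝ) (z : ι → ℝ) : ℝ :=
  y fun j => projIcc 0 1 zero_le_one (z j)

/-- The box `[0, s] × [0, 1] × [0, 1]` has the upper corner `boxCorner s`. -/
def boxCorner (s : ℝ) : Fin 3 → ℝ := ![s, 1, 1]

/-- The integral `∫_0^b g dy` by parts, after the substitution `z = b u`, for
`g z = ∏ j, kernelFactor (W j) (ϑ j) (x j) (z j / b j)` and paths `y` vanishing on the faces. -/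
def pathIntegral (W : Fin 3 → ℝ) (y : (Fin 3 → unitInterval) → ℝ) (b ϑ x : Fin 3 → ℝ) : ℝ :=
  ∫ u, extendPath y (b * u) * ∏ j, byPartsDensity (W j) (ϑ j) (x j) (u j)
    ∂Measure.pi fun _ => endpointMeasure

/-- The detection functional of the path `y` at time `s` and relative position `q`, with observation
window `[0, θ]`. -/
def pathFunctional (W τbar θ : Fin 3 → ℝ) (y : (Fin 3 → unitInterval) → ℝ) (s : ℝ)
    (q : Fin 3 → ℝ) : ℝ :=
  Real.sqrt (∏ j, θ j) *
    pathIntegral W y (boxCorner s) (θ * boxCorner s) (τbar * boxCorner s * q)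

/-- Total mass bound for the densities in `pathIntegral`. -/
def densityBound (W : Fin 3 → ℝ) (R : ℝ) : ℝ := ∏ j, W j * (1 + W j * R)

theorem abs_prod_byPartsDensity_le {W ϑ : Fin 3 → ℝ} {R : ℝ} (hW : ∀ j, 0 < W j)
    (hϑ : ∀ j, |ϑ j| ≤ R) (x u : Fin 3 → ℝ) :
    |∏ j, byPartsDensity (W j) (ϑ j) (x j) (u j)| ≤ densityBound W R := by
  rw [Finset.abs_prod]
  exact Finset.prod_le_prod (fun _ _ => abs_nonneg _)
    fun j _ => abs_byPartsDensity_le (hW j).le (hϑ j) _ _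

@[fun_prop]
theorem measurable_prod_byPartsDensity (W ϑ x : Fin 3 → ℝ) :
    Measurable fun u : Fin 3 → ℝ => ∏ j, byPartsDensity (W j) (ϑ j) (x j) (u j) :=
  Finset.measurable_prod _ fun j _ =>
    (measurable_byPartsDensity (W j) (ϑ j) (x j)).comp (measurable_pi_apply j)

theorem densityBound_nonneg {W : Fin 3 → ℝ} {R : ℝ} (hW : ∀ j, 0 < W j) (hR : 0 ≤ R) :
    0 ≤ densityBound W R :=
  Finset.prod_nonneg fun j _ => by have := hW j; positivity

/-- A path with measurable extension and bounded values. -/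
structure IsTamePath (y : (Fin 3 → unitInterval) → ℝ) : Prop where
  measurable : Measurable (extendPath y)
  bounded : ∃ M, ∀ t, |y t| ≤ M

theorem continuous_extendPath {y : (Fin 3 → unitInterval) → ℝ} (hy : Continuous y) :
    Continuous (extendPath y) :=
  hy.comp (continuous_pi fun j => continuous_projIcc.comp (continuous_apply j))

theorem exists_bound_of_continuous {y : (Fin 3 → unitInterval) → ℝ} (hy : Continuous y) :
    ∃ M, ∀ t, |y t| ≤ M := by
  obtain ⟨M, hM⟩ := isCompact_univ.exists_bound_of_continuousOn hy.continuousOn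
  exact ⟨M, fun t => hM t (mem_univ t)⟩

theorem IsTamePath.of_continuous {y : (Fin 3 → unitInterval) → ℝ} (hy : Continuous y) :
    IsTamePath y :=
  ⟨(continuous_extendPath hy).measurable, exists_bound_of_continuous hy⟩

theorem IsTamePath.sub {y z : (Fin 3 → unitInterval) → ℝ} (hy : IsTamePath y)
    (hz : IsTamePath z) : IsTamePath (fun t => y t - z t) := by
  obtain ⟨M, hM⟩ := hy.bounded
  obtain ⟨N, hN⟩ := hz.bounded
  exact ⟨hy.measurable.sub hz.measurable,
    M + N, fun t => (abs_sub _ _).trans (add_le_add (hM t) (hN t))⟩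

theorem IsTamePath.integrable {y : (Fin 3 → unitInterval) → ℝ} (hy : IsTamePath y)
    {W : Fin 3 → ℝ} (hW : ∀ j, 0 < W j) (b ϑ x : Fin 3 → ℝ) :
    Integrable (fun u => extendPath y (b * u) * ∏ j, byPartsDensity (W j) (ϑ j) (x j) (u j))
      (Measure.pi fun _ => endpointMeasure) := by
  obtain ⟨M, hM⟩ := hy.bounded
  have hmeas : Measurable fun u : Fin 3 → ℝ => extendPath y (b * u) :=
    hy.measurable.comp (by fun_prop)
  refine Integrable.of_bound (hmeas.mul (by fun_prop)).aestronglyMeasurable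
    (M * densityBound W (∑ j, |ϑ j|)) (Eventually.of_forall fun u => ?_)
  rw [norm_mul]
  have hϑ : ∀ j, |ϑ j| ≤ ∑ j, |ϑ j| := fun j =>
    Finset.single_le_sum (f := fun j => |ϑ j|) (fun _ _ => abs_nonneg _) (Finset.mem_univ j)
  exact mul_le_mul (hM _) (abs_prod_byPartsDensity_le hW hϑ x u) (norm_nonneg _)
    ((abs_nonneg _).trans (hM fun _ => 0))

theorem pathIntegral_add {y z : (Fin 3 → unitInterval) → ℝ} (hy : IsTamePath y)
    (hz : IsTamePath z) {W : Fin 3 → ℝ} (hW : ∀ j, 0 < W j) (b ϑ x : Fin 3 → ℝ) :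
    pathIntegral W (fun t => y t + z t) b ϑ x = pathIntegral W y b ϑ x + pathIntegral W z b ϑ x := by
  unfold pathIntegral
  rw [← integral_add (hy.integrable hW b ϑ x) (hz.integrable hW b ϑ x)]
  congr 1; ext u; unfold extendPath; ring

theorem pathIntegral_sub {y z : (Fin 3 → unitInterval) → ℝ} (hy : IsTamePath y)
    (hz : IsTamePath z) {W : Fin 3 → ℝ} (hW : ∀ j, 0 < W j) (b ϑ x : Fin 3 → ℝ) :
    pathIntegral W (fun t => y t - z t) b ϑ x = pathIntegral W y b ϑ x - pathIntegral W z b ϑ x := by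
  unfold pathIntegral
  rw [← integral_sub (hy.integrable hW b ϑ x) (hz.integrable hW b ϑ x)]
  congr 1; ext u; unfold extendPath; ring

theorem pathIntegral_const_mul (c : ℝ) (y : (Fin 3 → unitInterval) → ℝ) (W b ϑ x : Fin 3 → ℝ) :
    pathIntegral W (fun t => c * y t) b ϑ x = c * pathIntegral W y b ϑ x := by
  unfold pathIntegral
  rw [← integral_const_mul]
  congr 1; ext u; unfold extendPath; ring

theorem abs_pathIntegral_le {y : (Fin 3 → unitInterval) → ℝ} {M : ℝ} (hM : ∀ t, |y t| ≤ M)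
    {W ϑ : Fin 3 → ℝ} (hW : ∀ j, 0 < W j) {R : ℝ} (hϑ : ∀ j, |ϑ j| ≤ R) (b x : Fin 3 → ℝ) :
    |pathIntegral W y b ϑ x| ≤
      M * densityBound W R * (Measure.pi fun _ : Fin 3 => endpointMeasure).real univ := by
  rw [pathIntegral, ← Real.norm_eq_abs]
  refine norm_integral_le_of_norm_le_const (Eventually.of_forall fun u => ?_)
  rw [norm_mul]
  exact mul_le_mul (hM _) (abs_prod_byPartsDensity_le hW hϑ x u) (norm_nonneg _)
    ((abs_nonneg _).trans (hM fun _ => 0))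

/-- Lipschitz constant of the path functional with respect to the path. -/
def lipBound (W : Fin 3 → ℝ) (R : ℝ) : ℝ :=
  Real.sqrt (R ^ 3) * (densityBound W R * (Measure.pi fun _ : Fin 3 => endpointMeasure).real univ)

theorem abs_boxCorner_le {s : ℝ} (hs : s ∈ Icc (0 : ℝ) 1) (j : Fin 3) : |boxCorner s j| ≤ 1 := by
  fin_cases j <;> simp [boxCorner, abs_le, hs.2]
  linarith [hs.1]

theorem lipBound_nonneg {W : Fin 3 → ℝ} {R : ℝ} (hW : ∀ j, 0 < W j) (hR : 0 ≤ R) :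
    0 ≤ lipBound W R :=
  mul_nonneg (Real.sqrt_nonneg _) (mul_nonneg (densityBound_nonneg hW hR) measureReal_nonneg)

/-- Bounded density times finite measure. With linearity in the path this is a Lipschitz estimate in
the sup norm whose constant does not depend on time, position or windows within [0, R]. -/
theorem abs_pathFunctional_le {y : (Fin 3 → unitInterval) → ℝ} {M : ℝ} (hM : ∀ t, |y t| ≤ M)
    {W τbar θ : Fin 3 → ℝ} (hW : ∀ j, 0 < W j) {R : ℝ} (hθ : ∀ j, θ j ∈ Icc 0 R) {s : ℝ}
    (hs : s ∈ Icc (0 : ℝ) 1) (q : Fin 3 → ℝ) :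
    |pathFunctional W τbar θ y s q| ≤ lipBound W R * M := by
  have hM0 : 0 ≤ M := (abs_nonneg _).trans (hM fun _ => 0)
  have hR : 0 ≤ R := (hθ 0).1.trans (hθ 0).2
  unfold pathFunctional lipBound
  rw [abs_mul, abs_of_nonneg (Real.sqrt_nonneg _)]
  have h1 : Real.sqrt (∏ j, θ j) ≤ Real.sqrt (R ^ 3) := by
    refine Real.sqrt_le_sqrt ?_
    calc ∏ j, θ j ≤ ∏ _j : Fin 3, R := Finset.prod_le_prod (fun j _ => (hθ j).1) fun j _ => (hθ j).2
      _ = R ^ 3 := by simp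
  have h2 := abs_pathIntegral_le hM hW (ϑ := θ * boxCorner s) (R := R) (fun j => by
    rw [Pi.mul_apply, abs_mul, abs_of_nonneg (hθ j).1]
    calc _ ≤ R * 1 := mul_le_mul (hθ j).2 (abs_boxCorner_le hs j) (abs_nonneg _) hR
      _ = R := mul_one R) (boxCorner s) (τbar * boxCorner s * q)
  calc _ ≤ Real.sqrt (R ^ 3) * (M * densityBound W R *
        (Measure.pi fun _ : Fin 3 => endpointMeasure).real univ) :=
        mul_le_mul h1 h2 (abs_nonneg _) (Real.sqrt_nonneg _)
    _ = _ := by ring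

theorem pathFunctional_add {y z : (Fin 3 → unitInterval) → ℝ} (hy : IsTamePath y)
    (hz : IsTamePath z) {W : Fin 3 → ℝ} (hW : ∀ j, 0 < W j) (τbar θ : Fin 3 → ℝ) (s : ℝ)
    (q : Fin 3 → ℝ) :
    pathFunctional W τbar θ (fun t => y t + z t) s q =
      pathFunctional W τbar θ y s q + pathFunctional W τbar θ z s q := by
  unfold pathFunctional
  rw [pathIntegral_add hy hz hW, mul_add]

theorem pathFunctional_sub {y z : (Fin 3 → unitInterval) → ℝ} (hy : IsTamePath y)
    (hz : IsTamePath z) {W : Fin 3 → ℝ} (hW : ∀ j, 0 < W j) (τbar θ : Fin 3 → ℝ) (s : ℝ)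
    (q : Fin 3 → ℝ) :
    pathFunctional W τbar θ (fun t => y t - z t) s q =
      pathFunctional W τbar θ y s q - pathFunctional W τbar θ z s q := by
  unfold pathFunctional
  rw [pathIntegral_sub hy hz hW, mul_sub]

theorem pathFunctional_const_mul (c : ℝ) (y : (Fin 3 → unitInterval) → ℝ) (W τbar θ : Fin 3 → ℝ)
    (s : ℝ) (q : Fin 3 → ℝ) :
    pathFunctional W τbar θ (fun t => c * y t) s q = c * pathFunctional W τbar θ y s q := by
  unfold pathFunctional
  rw [pathIntegral_const_mul]; ring

/-- Dominated convergence: the density jumps in u at 1, but for each fixed u it is continuous in the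
parameters. -/
theorem continuous_pathFunctional {y : (Fin 3 → unitInterval) → ℝ} (hy : Continuous y)
    {W : Fin 3 → ℝ} (hW : ∀ j, 0 < W j) (τbar : Fin 3 → ℝ) :
    Continuous fun p : (Fin 3 → ℝ) × ℝ × (Fin 3 → ℝ) =>
      pathFunctional W τbar p.1 y p.2.1 p.2.2 := by
  have hbc : Continuous boxCorner := by
    unfold boxCorner
    refine continuous_pi fun j => ?_
    fin_cases j <;> simp <;> fun_prop
  have hext := continuous_extendPath hy
  obtain ⟨M, hM⟩ := exists_bound_of_continuous hy
  unfold pathFunctional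
  refine Continuous.mul (by fun_prop) ?_
  rw [continuous_iff_continuousAt]
  intro p₀
  unfold pathIntegral
  -- `N` bounds all kernel scales and is continuous, so `N p₀ + 1` is a common bound near `p₀`.
  set N : (Fin 3 → ℝ) × ℝ × (Fin 3 → ℝ) → ℝ := fun p => ∑ j, |(p.1 * boxCorner p.2.1) j| with hN
  have hNc : Continuous N := by
    simp only [hN, Pi.mul_apply]
    refine continuous_finsetSum _ fun j _ => ?_
    have : Continuous fun p : (Fin 3 → ℝ) × ℝ × (Fin 3 → ℝ) => boxCorner p.2.1 j :=
      (continuous_apply j).comp (hbc.comp (by fun_prop))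
    fun_prop
  refine continuousAt_of_dominated (bound := fun _ => M * densityBound W (N p₀ + 1)) ?_ ?_
    (integrable_const _) ?_
  · exact Eventually.of_forall fun p =>
      ((IsTamePath.of_continuous hy).integrable hW _ _ _).aestronglyMeasurable
  · filter_upwards [hNc.continuousAt.eventually_lt_const (lt_add_one (N p₀))] with p hp
    refine Eventually.of_forall fun u => ?_
    rw [norm_mul]
    refine mul_le_mul (hM _) (abs_prod_byPartsDensity_le hW (fun j => ?_) _ u) (norm_nonneg _)
      ((abs_nonneg _).trans (hM fun _ => 0))
    exact (Finset.single_le_sum (f := fun j => |(p.1 * boxCorner p.2.1) j|)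
      (fun _ _ => abs_nonneg _) (Finset.mem_univ j)).trans hp.le
  · refine Eventually.of_forall fun u => Continuous.continuousAt ?_
    refine Continuous.mul (hext.comp (by fun_prop)) (continuous_finsetProd _ fun j _ => ?_)
    have h1 : Continuous fun p : (Fin 3 → ℝ) × ℝ × (Fin 3 → ℝ) => boxCorner p.2.1 j :=
      (continuous_apply j).comp (hbc.comp (by fun_prop))
    refine continuous_byPartsDensity continuous_const ?_ ?_ (u j)
    · simp only [Pi.mul_apply]; fun_prop
    · simp only [Pi.mul_apply]; fun_prop

/-! ### Step paths -/

/-- The step path with value `a i` on the cell `∏ j, [i j / n j, (i j + 1) / n j)`. -/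
def stepPath (n : Fin 3 → ℕ) (a : (Fin 3 → ℕ) → ℝ) (t : Fin 3 → unitInterval) : ℝ :=
  a fun j => ⌊(n j : ℝ) * (t j : ℝ)⌋₊

/-- The grid point `(i j / n j)_j`, projected on the cube. -/
def gridPoint (n i : Fin 3 → ℕ) : Fin 3 → unitInterval :=
  fun j => projIcc 0 1 zero_le_one ((i j : ℝ) / (n j : ℝ))

/-- The step path through the values of `y` at the grid points. -/
def discretize (n : Fin 3 → ℕ) (y : (Fin 3 → unitInterval) → ℝ) : (Fin 3 → unitInterval) → ℝ :=
  stepPath n fun i => y (gridPoint n i)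

theorem floor_mul_le (m : ℕ) (u : unitInterval) : ⌊(m : ℝ) * (u : ℝ)⌋₊ ≤ m :=
  Nat.floor_le_of_le (mul_le_of_le_one_right m.cast_nonneg u.2.2)

theorem isTamePath_stepPath (n : Fin 3 → ℕ) (a : (Fin 3 → ℕ) → ℝ) : IsTamePath (stepPath n a) := by
  refine ⟨?_, ∑ i ∈ Finset.Icc 0 n, |a i|, fun t => ?_⟩
  · refine (measurable_of_countable a).comp (measurable_pi_lambda _ fun j => ?_)
    refine Nat.measurable_floor.comp (measurable_const.mul ?_)
    exact measurable_subtype_coe.comp (continuous_projIcc.measurable.comp (measurable_pi_apply j))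
  · exact Finset.single_le_sum (f := fun i => |a i|) (fun _ _ => abs_nonneg _)
      (Finset.mem_Icc.2 ⟨fun _ => Nat.zero_le _, fun j => floor_mul_le _ _⟩)

/-- The indices run up to n inclusive, because the face t_j = 1 is a cell of its own with index n_j.
-/
theorem stepPath_eq_sum (n : Fin 3 → ℕ) (a : (Fin 3 → ℕ) → ℝ) (t : Fin 3 → unitInterval) :
    stepPath n a t = ∑ i ∈ Finset.Icc 0 n, a i * stepPath n (Pi.single i 1) t := by
  unfold stepPath
  set k : Fin 3 → ℕ := fun j => ⌊(n j : ℝ) * (t j : ℝ)⌋₊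
  have hk : k ∈ Finset.Icc 0 n :=
    Finset.mem_Icc.2 ⟨fun _ => Nat.zero_le _, fun j => floor_mul_le _ _⟩
  rw [Finset.sum_eq_single_of_mem k hk]
  · simp
  · intro i _ hi
    rw [Pi.single_eq_of_ne (M := fun _ => ℝ) hi.symm, mul_zero]

/-- On step paths the functional is a finite linear combination of grid values; continuity and
measurability of suprema rest on this. -/
theorem pathFunctional_stepPath {W : Fin 3 → ℝ} (hW : ∀ j, 0 < W j) (τbar θ : Fin 3 → ℝ)
    (n : Fin 3 → ℕ) (a : (Fin 3 → ℕ) → ℝ) (s : ℝ) (q : Fin 3 → ℝ) :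
    pathFunctional W τbar θ (stepPath n a) s q = ∑ i ∈ Finset.Icc 0 n,
      a i * pathFunctional W τbar θ (stepPath n (Pi.single i 1)) s q := by
  have h : ∀ S : Finset (Fin 3 → ℕ), pathIntegral W
      (fun t => ∑ i ∈ S, a i * stepPath n (Pi.single i 1) t) (boxCorner s) (θ * boxCorner s)
        (τbar * boxCorner s * q) = ∑ i ∈ S, a i * pathIntegral W (stepPath n (Pi.single i 1))
          (boxCorner s) (θ * boxCorner s) (τbar * boxCorner s * q) := by
    intro S
    simp only [← pathIntegral_const_mul]
    unfold pathIntegral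
    rw [← integral_finsetSum]
    · congr 1; ext u; unfold extendPath; rw [Finset.sum_mul]
    · intro i _
      have := ((isTamePath_stepPath n (Pi.single i 1)).integrable hW (boxCorner s)
        (θ * boxCorner s) (τbar * boxCorner s * q)).const_mul (a i)
      refine this.congr (Eventually.of_forall fun u => ?_)
      simp only [extendPath]; ring
  unfold pathFunctional
  rw [show stepPath n a = fun t => ∑ i ∈ Finset.Icc 0 n, a i * stepPath n (Pi.single i 1) t from
    funext fun t => stepPath_eq_sum n a t, h, Finset.mul_sum]
  exact Finset.sum_congr rfl fun i _ => by ring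

theorem dist_gridPoint_floor_le (n : Fin 3 → ℕ) (hn : ∀ j, 0 < n j) (t : Fin 3 → unitInterval)
    (j : Fin 3) :
    dist (gridPoint n (fun j => ⌊(n j : ℝ) * (t j : ℝ)⌋₊) j) (t j) ≤ 1 / (n j : ℝ) := by
  have hn' : (0 : ℝ) < n j := by exact_mod_cast hn j
  have h0 : (0 : ℝ) ≤ (n j : ℝ) * (t j : ℝ) := mul_nonneg hn'.le (t j).2.1
  have h1 := Nat.floor_le h0
  have h2 := Nat.lt_floor_add_one ((n j : ℝ) * (t j : ℝ))
  have h3 : ((⌊(n j : ℝ) * (t j : ℝ)⌋₊ : ℝ)) / n j ∈ Icc (0 : ℝ) 1 := by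
    refine ⟨by positivity, ?_⟩
    rw [div_le_one hn']
    exact_mod_cast floor_mul_le (n j) (t j)
  unfold gridPoint
  rw [projIcc_of_mem _ h3, Subtype.dist_eq, Real.dist_eq, abs_le]
  constructor
  · have : (t j : ℝ) ≤ ((⌊(n j : ℝ) * (t j : ℝ)⌋₊ : ℝ) + 1) / n j := by
      rw [le_div_iff₀ hn']; linarith
    rw [add_div] at this; linarith
  · have : ((⌊(n j : ℝ) * (t j : ℝ)⌋₊ : ℝ)) / n j ≤ t j := by
      rw [div_le_iff₀ hn']; linarith
    have : 0 ≤ 1 / (n j : ℝ) := by positivity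
    linarith

theorem eventually_abs_discretize_sub_lt {y : (Fin 3 → unitInterval) → ℝ} (hy : Continuous y)
    {e : ℝ} (he : 0 < e) :
    ∀ᶠ n : Fin 3 → ℕ in atTop, ∀ t, |discretize n y t - y t| < e := by
  have huc := CompactSpace.uniformContinuous_of_continuous hy
  obtain ⟨d, hd, h⟩ := Metric.uniformContinuous_iff.1 huc e he
  obtain ⟨N, hN⟩ := exists_nat_gt (1 / d)
  filter_upwards [eventually_ge_atTop (fun _ : Fin 3 => N + 1)] with n hn t
  refine h ((dist_pi_lt_iff hd).2 fun j => ?_)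
  have hnj : (N : ℝ) + 1 ≤ n j := by exact_mod_cast hn j
  have hpos : ∀ j, 0 < n j := fun j => lt_of_lt_of_le (Nat.succ_pos N) (hn j)
  refine (dist_gridPoint_floor_le n hpos t j).trans_lt ?_
  rw [div_lt_comm₀ (by exact_mod_cast hpos j) hd]
  linarith

/-- Partial sums are constant on grid cells, so a discretization can be inserted in the functional
at no cost. The functional is then defined on every path of the Skorohod space and sees only
finitely many of its values. -/
theorem discretize_partialSumFun (e : (Fin 3 → ℤ) → ℝ) (n : Fin 3 → ℕ) :
    discretize n (partialSumFun e n) = partialSumFun e n := by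
  ext t
  unfold discretize stepPath partialSumFun gridPoint
  have : ∀ j, ⌊(n j : ℝ) * ((projIcc (0 : ℝ) 1 zero_le_one
      ((⌊(n j : ℝ) * (t j : ℝ)⌋₊ : ℝ) / (n j : ℝ)) : unitInterval) : ℝ)⌋₊ =
      ⌊(n j : ℝ) * (t j : ℝ)⌋₊ := by
    intro j
    rcases Nat.eq_zero_or_pos (n j) with h | h
    · simp [h]
    · have hn' : (0 : ℝ) < n j := by exact_mod_cast h
      have h3 : ((⌊(n j : ℝ) * (t j : ℝ)⌋₊ : ℝ)) / n j ∈ Icc (0 : ℝ) 1 := by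
        refine ⟨by positivity, ?_⟩
        rw [div_le_one hn']
        exact_mod_cast floor_mul_le (n j) (t j)
      rw [projIcc_of_mem _ h3]
      simp only
      rw [mul_div_cancel₀ _ hn'.ne', Nat.floor_natCast]
  simp only [this]

/-! ### The detection process as a functional of the partial sum path -/

theorem ae_mem_Icc_endpointMeasure : ∀ᵐ u ∂endpointMeasure, u ∈ Icc (0 : ℝ) 1 := by
  unfold endpointMeasure
  rw [ae_add_measure_iff]
  constructor
  · filter_upwards [ae_restrict_mem measurableSet_Ico] with u hu using Ico_subset_Icc_self hu
  · refine (ae_dirac_iff (p := fun x => x ∈ Icc (0 : ℝ) 1) measurableSet_Icc).2 ?_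
    exact ⟨zero_le_one, le_rfl⟩

theorem integral_ite_mul_byPartsDensity (w ϑ x : ℝ) {i : ℕ} (hi : 1 ≤ i) (N : ℕ) :
    ∫ u, (if (i : ℝ) ≤ N * u then 1 else 0) * byPartsDensity w ϑ x u ∂endpointMeasure =
      if i ≤ N then kernelFactor w ϑ x ((i : ℝ) / N) else 0 := by
  split_ifs with h
  · have hN : (0 : ℝ) < N := by exact_mod_cast hi.trans h
    rw [← integral_tail_byPartsDensity w ϑ x (p := (i : ℝ) / N) (by positivity)
      ((div_le_one hN).2 (by exact_mod_cast h))]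
    congr 1; ext u; congr 1
    simp only [indicator_apply, mem_Ici, div_le_iff₀ hN, Pi.one_apply, mul_comm]
  · refine integral_eq_zero_of_ae ?_
    filter_upwards [ae_mem_Icc_endpointMeasure] with u hu
    rw [if_neg]
    · simp
    · have h1 : (N : ℝ) * u ≤ N := mul_le_of_le_one_right N.cast_nonneg hu.2
      have h2 : (N : ℝ) < i := by exact_mod_cast not_le.1 h
      linarith

/-- Projecting on [0,1] changes nothing: for z ≤ 0 both sides fail since i ≥ 1, and for z ≥ 1 both
hold since i ≤ m. -/
theorem le_floor_projIcc_iff {i m : ℕ} (hi : 1 ≤ i) (him : i ≤ m) (z : ℝ) :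
    i ≤ ⌊(m : ℝ) * ((projIcc (0 : ℝ) 1 zero_le_one z : unitInterval) : ℝ)⌋₊ ↔
      (i : ℝ) ≤ m * z := by
  have hm : (0 : ℝ) < m := by exact_mod_cast hi.trans him
  have him' : (i : ℝ) ≤ m := by exact_mod_cast him
  have hi' : (1 : ℝ) ≤ i := by exact_mod_cast hi
  rw [Nat.le_floor_iff (mul_nonneg hm.le (projIcc (0 : ℝ) 1 zero_le_one z).2.1), coe_projIcc]
  rcases le_total z 0 with h0 | h0
  · have : m * z ≤ 0 := mul_nonpos_of_nonneg_of_nonpos hm.le h0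
    rw [min_eq_right (by linarith), max_eq_left h0, mul_zero]
    constructor <;> intro <;> linarith
  · rcases le_total z 1 with h1 | h1
    · rw [min_eq_right h1, max_eq_right h0]
    · have : (m : ℝ) ≤ m * z := le_mul_of_one_le_right hm.le h1
      rw [min_eq_left h1, max_eq_right zero_le_one, mul_one]
      constructor <;> intro <;> linarith

theorem extendPath_partialSumFun (e : (Fin 3 → ℤ) → ℝ) (n : Fin 3 → ℕ) (z : Fin 3 → ℝ) :
    extendPath (partialSumFun e n) z = (∏ j, (n j : ℝ)) ^ (-(1 / 2) : ℝ) *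
      ∑ i ∈ Finset.Icc 1 n, e (fun j => (i j : ℤ)) *
        ∏ j, if (i j : ℝ) ≤ n j * z j then 1 else 0 := by
  unfold extendPath partialSumFun
  congr 1
  have hsub : Finset.Icc (1 : Fin 3 → ℕ) (fun j => ⌊(n j : ℝ) *
      ((projIcc (0 : ℝ) 1 zero_le_one (z j) : unitInterval) : ℝ)⌋₊) =
      (Finset.Icc 1 n).filter fun i => ∀ j, (i j : ℝ) ≤ n j * z j := by
    ext i
    simp only [Finset.mem_Icc, Finset.mem_filter]
    constructor
    · rintro ⟨h1, h2⟩
      have h3 : i ≤ n := fun j => (h2 j).trans (floor_mul_le _ _)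
      exact ⟨⟨h1, h3⟩, fun j => (le_floor_projIcc_iff (h1 j) (h3 j) _).1 (h2 j)⟩
    · rintro ⟨⟨h1, h3⟩, h2⟩
      exact ⟨h1, fun j => (le_floor_projIcc_iff (h1 j) (h3 j) _).2 (h2 j)⟩
  rw [hsub, Finset.sum_filter]
  refine Finset.sum_congr rfl fun i _ => ?_
  rw [Finset.prod_ite_zero]
  simp

/-- Multivariate summation by parts. Each noise variable enters the path as a product of unit jumps,
located at i_j/N_j after rescaling the box. The integral factors into tail integrals that return the
kernel at the jump, and jumps outside the box contribute nothing. -/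
theorem pathIntegral_partialSumFun (e : (Fin 3 → ℤ) → ℝ) {W : Fin 3 → ℝ} (hW : ∀ j, 0 < W j)
    (n : Fin 3 → ℕ) (N : Fin 3 → ℕ) (hN : N ≤ n) (b : Fin 3 → ℝ)
    (hb : ∀ j, (n j : ℝ) * b j = N j) (ϑ x : Fin 3 → ℝ) :
    pathIntegral W (partialSumFun e n) b ϑ x = (∏ j, (n j : ℝ)) ^ (-(1 / 2) : ℝ) *
      ∑ i ∈ Finset.Icc 1 N, e (fun j => (i j : ℤ)) *
        ∏ j, kernelFactor (W j) (ϑ j) (x j) ((i j : ℝ) / N j) := by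
  classical
  unfold pathIntegral
  have h1 : ∀ u : Fin 3 → ℝ, extendPath (partialSumFun e n) (b * u) *
      ∏ j, byPartsDensity (W j) (ϑ j) (x j) (u j) = ∑ i ∈ Finset.Icc 1 n,
        ((∏ j, (n j : ℝ)) ^ (-(1 / 2) : ℝ) * e (fun j => (i j : ℤ))) *
        ∏ j, ((if (i j : ℝ) ≤ N j * u j then 1 else 0) *
          byPartsDensity (W j) (ϑ j) (x j) (u j)) := by
    intro u
    rw [extendPath_partialSumFun, Finset.mul_sum, Finset.sum_mul]
    refine Finset.sum_congr rfl fun i _ => ?_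
    simp only [Pi.mul_apply, ← mul_assoc, hb]
    rw [Finset.prod_mul_distrib]; ring
  simp only [h1]
  rw [integral_finsetSum]
  · simp only [integral_const_mul]
    rw [Finset.mul_sum]
    have h2 : Finset.Icc 1 N = (Finset.Icc 1 n).filter fun i => i ≤ N := by
      ext i; simp only [Finset.mem_Icc, Finset.mem_filter]
      exact ⟨fun h => ⟨⟨h.1, h.2.trans hN⟩, h.2⟩, fun h => ⟨h.1.1, h.2⟩⟩
    rw [h2, Finset.sum_filter]
    refine Finset.sum_congr rfl fun i hi => ?_
    have hi1 := (Finset.mem_Icc.1 hi).1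
    rw [integral_fintype_prod_eq_prod (fun j v =>
      (if (i j : ℝ) ≤ N j * v then (1 : ℝ) else 0) * byPartsDensity (W j) (ϑ j) (x j) v)]
    simp only [fun j => integral_ite_mul_byPartsDensity (W j) (ϑ j) (x j) (hi1 j) (N j)]
    rw [Finset.prod_ite_zero]
    by_cases h : i ≤ N
    · rw [if_pos h, if_pos fun j _ => h j]; ring
    · rw [if_neg h, if_neg fun h' => h fun j => h' j (Finset.mem_univ j), mul_zero]
  · intro i _
    refine Integrable.const_mul (Integrable.fintype_prod (f := fun j v =>
      (if (i j : ℝ) ≤ N j * v then (1 : ℝ) else 0) * byPartsDensity (W j) (ϑ j) (x j) v)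
      fun j => ?_) _
    refine Integrable.of_bound (Measurable.mul ?_ (by fun_prop)).aestronglyMeasurable
      (W j * (1 + W j * |ϑ j|)) (Eventually.of_forall fun u => ?_)
    · exact Measurable.ite (measurableSet_le measurable_const (by fun_prop)) measurable_const
        measurable_const
    · have := abs_byPartsDensity_le (hW j).le le_rfl (x j) u (ϑ := ϑ j)
      split_ifs
      · simpa using this
      · simpa using (abs_nonneg _).trans this

/-- The null hypothesis leaves only noise in the sum, and the normalizations of the two processes
differ by the square root of ∏ n_j. At times k/n₁ the box corner lies on the grid, so the identity
is exact. -/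
theorem detectionProcess_eq_pathIntegral {Ω : Type*} {W : Fin 3 → ℝ} (hW : ∀ j, 0 < W j)
    {τ : Fin 3 → ℕ → ℝ} {τbar : Fin 3 → ℝ} {f f₀ : (Fin 3 → ℝ) → ℝ}
    (hnull : NullHypothesis τbar τ f f₀) (ε : (Fin 3 → ℤ) → Ω → ℝ) {n : Fin 3 → ℕ}
    (hn : ∀ j, 0 < n j) (ω : Ω) {k : ℕ} (hk : k ≤ n 0) (x : Fin 3 → ℝ) :
    detectionProcess W τ f f₀ ε n ω ((k : ℝ) / n 0) x =
      Real.sqrt (∏ j, (n j : ℝ) * τ j (n j)) *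
        pathIntegral W (partialSumFun (fun i => ε i ω) n) (boxCorner ((k : ℝ) / n 0))
          ((fun j => (n j : ℝ) * τ j (n j)) * boxCorner ((k : ℝ) / n 0)) x := by
  have hn' : ∀ j, (0 : ℝ) < n j := fun j => by exact_mod_cast hn j
  set N : Fin 3 → ℕ := ![k, n 1, n 2] with hNdef
  have hN : N ≤ n := by
    intro j; fin_cases j <;> simp [hNdef, hk]
  have hb : ∀ j, (n j : ℝ) * boxCorner ((k : ℝ) / n 0) j = N j := by
    intro j
    fin_cases j
    · simp [hNdef, boxCorner]; exact mul_div_cancel₀ _ (hn' 0).ne'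
    · simp [hNdef, boxCorner]
    · simp [hNdef, boxCorner]
  rw [pathIntegral_partialSumFun _ hW n N hN _ hb]
  have hfl : ![⌊(n 0 : ℝ) * ((k : ℝ) / n 0)⌋₊, n 1, n 2] = N := by
    rw [mul_div_cancel₀ _ (hn' 0).ne', Nat.floor_natCast]
  have hs : Real.sqrt (∏ j, (n j : ℝ) * τ j (n j)) * (∏ j, (n j : ℝ)) ^ (-(1 / 2) : ℝ) =
      Real.sqrt (∏ j, τ j (n j)) := by
    have hp : (0 : ℝ) < ∏ j, (n j : ℝ) := Finset.prod_pos fun j _ => hn' j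
    rw [Finset.prod_mul_distrib, Real.sqrt_mul hp.le, Real.rpow_neg hp.le,
      ← Real.sqrt_eq_rpow]
    have := (Real.sqrt_pos.2 hp).ne'
    field_simp
  rw [← mul_assoc, hs]
  unfold detectionProcess
  rw [hfl]
  congr 1
  refine Finset.sum_congr rfl fun i hi => ?_
  obtain ⟨hi1, hi2⟩ := Finset.mem_Icc.1 hi
  unfold observation
  rw [hnull.2 n i hi1 (hi2.trans hN), add_sub_cancel_left]
  congr 1
  unfold kernel kernelFactor
  refine Finset.prod_congr rfl fun j _ => ?_
  congr 3
  have hNj : (0 : ℝ) < N j := by exact_mod_cast (hi1 j).trans (hi2 j)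
  simp only [Pi.sub_apply, samplingPoint, Pi.mul_apply]
  congr 1
  -- Since N = n·b, the rescaled jump position (nτb)·(i/N) is the sampling point iτ.
  rw [show (n j : ℝ) * τ j (n j) * boxCorner ((k : ℝ) / n 0) j * ((i j : ℝ) / N j) =
    (n j : ℝ) * boxCorner ((k : ℝ) / n 0) j * (τ j (n j) * ((i j : ℝ) / N j)) by ring, hb]
  field_simp

/-! ### Suprema over the relative positions -/

/-- The supremum of `|F s q|` over the relative positions `q ∈ A`. -/
def relSup (A : Set (Fin 3 → ℝ)) (F : ℝ → (Fin 3 → ℝ) → ℝ) (s : ℝ) : ℝ :=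
  sSup ((fun q => |F s q|) '' A)

/-- Relative positions of the local detector. -/
def localBox : Set (Fin 3 → ℝ) := Icc ![1, 0, 0] 1

/-- Relative positions of the global detector. -/
def globalBox : Set (Fin 3 → ℝ) := Icc 0 1

theorem localBox_subset : localBox ⊆ Icc 0 1 :=
  Icc_subset_Icc_left fun j => by fin_cases j <;> simp

theorem isCompact_localBox : IsCompact localBox := isCompact_Icc

theorem localBox_nonempty : localBox.Nonempty :=
  nonempty_Icc.2 fun j => by fin_cases j <;> simp

theorem globalBox_nonempty : globalBox.Nonempty := nonempty_Icc.2 zero_le_one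

theorem image_mul_Icc_pi {ι : Type*} {c a b : ι → ℝ} (hc : ∀ j, 0 ≤ c j) (hab : a ≤ b) :
    (fun q => c * q) '' Icc a b = Icc (c * a) (c * b) := by
  ext z
  constructor
  · rintro ⟨q, hq, rfl⟩
    exact ⟨fun j => mul_le_mul_of_nonneg_left (hq.1 j) (hc j),
      fun j => mul_le_mul_of_nonneg_left (hq.2 j) (hc j)⟩
  · rintro ⟨h1, h2⟩
    -- In a direction with c_j = 0 the image degenerates to a point, and any preimage will do.
    refine ⟨fun j => if c j = 0 then a j else z j / c j, ⟨fun j => ?_, fun j => ?_⟩, ?_⟩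
    · dsimp only
      split_ifs with h
      · exact le_rfl
      · have := (hc j).lt_of_ne' h
        rw [le_div_iff₀ this, mul_comm]; exact h1 j
    · dsimp only
      split_ifs with h
      · exact hab j
      · have := (hc j).lt_of_ne' h
        rw [div_le_iff₀ this, mul_comm]; exact h2 j
    · ext j
      simp only [Pi.mul_apply]
      split_ifs with h
      · have h1 := h1 j; have h2 := h2 j
        simp only [Pi.mul_apply, h, zero_mul] at h1 h2 ⊢
        linarith
      · field_simp

/-- Writing t = sτ̄₁q₁ replaces the moving window by a fixed compact set (here q₁ = 1), so that
continuity in s is a compactness statement. -/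
theorem localSup_eq_relSup {τbar : Fin 3 → ℝ} (hτ : ∀ j, 0 < τbar j)
    (G : ℝ → (Fin 3 → ℝ) → ℝ) {s : ℝ} (hs : 0 ≤ s) :
    localSup τbar G s = relSup localBox (fun s q => G s (τbar * boxCorner s * q)) s := by
  have hc : ∀ j, 0 ≤ (τbar * boxCorner s) j := by
    intro j
    have := (hτ j).le
    fin_cases j <;> simp [boxCorner] <;> positivity
  unfold localSup relSup localBox
  have := image_mul_Icc_pi hc (localBox_nonempty.elim fun q hq => hq.1.trans hq.2)
  rw [show ![s * τbar 0, 0, 0] = τbar * boxCorner s * ![1, 0, 0] by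
      ext j; fin_cases j <;> simp [boxCorner, mul_comm],
    show ![s * τbar 0, τbar 1, τbar 2] = τbar * boxCorner s * 1 by
      ext j; fin_cases j <;> simp [boxCorner, mul_comm], ← this, image_image]

theorem globalSup_eq_relSup {τbar : Fin 3 → ℝ} (hτ : ∀ j, 0 < τbar j)
    (G : ℝ → (Fin 3 → ℝ) → ℝ) {s : ℝ} (hs : 0 ≤ s) :
    globalSup τbar G s = relSup globalBox (fun s q => G s (τbar * boxCorner s * q)) s := by
  have hc : ∀ j, 0 ≤ (τbar * boxCorner s) j := by
    intro j
    have := (hτ j).le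
    fin_cases j <;> simp [boxCorner] <;> positivity
  unfold globalSup relSup globalBox
  have := image_mul_Icc_pi hc (zero_le_one (α := Fin 3 → ℝ))
  rw [show ![(0 : ℝ), 0, 0] = τbar * boxCorner s * 0 by
      ext j; fin_cases j <;> simp [boxCorner],
    show ![s * τbar 0, τbar 1, τbar 2] = τbar * boxCorner s * 1 by
      ext j; fin_cases j <;> simp [boxCorner, mul_comm], ← this, image_image]

/-! ### Riemann–Stieltjes integrals against products of smooth functions -/

theorem sum_neg_one_pow_mul_prod_piecewise {ι α : Type*} [Fintype ι] [DecidableEq ι]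
    (g : ι → α → ℝ) (a b : ι → α) :
    ∑ v : Finset ι, (-1 : ℝ) ^ v.card * ∏ j, g j (v.piecewise a b j) =
      ∏ j, (g j (b j) - g j (a j)) := by
  have h : ∏ j, (g j (b j) - g j (a j)) = ∏ j, (-g j (a j) + g j (b j)) :=
    Finset.prod_congr rfl fun j _ => by ring
  rw [h, Finset.prod_add, Finset.powerset_univ]
  refine Finset.sum_congr rfl fun v _ => ?_
  rw [← Finset.prod_mul_prod_compl v (fun j => g j (v.piecewise a b j)), Finset.prod_neg,
    Finset.prod_congr rfl fun j hj => by rw [Finset.piecewise_eq_of_mem _ _ _ hj],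
    Finset.prod_congr (s₁ := vᶜ) rfl fun j hj => by
      rw [Finset.piecewise_eq_of_notMem _ _ _ (Finset.mem_compl.1 hj)], Finset.compl_eq_univ_sdiff]
  ring

theorem altSum_const_mul_prod {ι : Type*} [Fintype ι] [DecidableEq ι] (C : ℝ) (g : ι → ℝ → ℝ)
    (a b : ι → ℝ) :
    altSum (fun x => C * ∏ j, g j (x j)) a b = C * ∏ j, (g j (b j) - g j (a j)) := by
  rw [← sum_neg_one_pow_mul_prod_piecewise, Finset.mul_sum]
  exact Finset.sum_congr rfl fun v _ => by ring

theorem ladderSucc_le_right (b : ℝ) (Y : Finset ℝ) (y : ℝ) : ladderSucc b Y y ≤ b :=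
  Finset.min'_le _ _ (Finset.mem_insert_self _ _)

theorem ladderSucc_le {b : ℝ} {Y : Finset ℝ} {y z : ℝ} (hz : z ∈ Y) (h : y < z) :
    ladderSucc b Y y ≤ z :=
  Finset.min'_le _ _ (Finset.mem_insert_of_mem (Finset.mem_filter.2 ⟨hz, h⟩))

theorem lt_ladderSucc {b : ℝ} {Y : Finset ℝ} {y z : ℝ} (hb : z < b)
    (h : ∀ w ∈ Y, y < w → z < w) : z < ladderSucc b Y y := by
  refine (Finset.lt_min'_iff _ _).2 fun w hw => ?_
  rcases Finset.mem_insert.1 hw with rfl | hw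
  · exact hb
  · exact h w (Finset.mem_filter.1 hw).1 (Finset.mem_filter.1 hw).2

/-- The half-open cells of a ladder partition [a, b): the cell of z starts at the largest ladder
point not exceeding z. -/
theorem IsLadder.existsUnique_cell {a b : ℝ} {Y : Finset ℝ} (hY : IsLadder a b Y) {z : ℝ}
    (hz : z ∈ Ico a b) : ∃ y ∈ Y, z ∈ Ico y (ladderSucc b Y y) ∧
      ∀ w ∈ Y, z ∈ Ico w (ladderSucc b Y w) → w = y := by
  have hne : (Y.filter (fun w => w ≤ z)).Nonempty := ⟨a, Finset.mem_filter.2 ⟨hY.1, hz.1⟩⟩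
  set y := (Y.filter (fun w => w ≤ z)).max' hne with hy
  have hyY := Finset.mem_filter.1 ((Y.filter (fun w => w ≤ z)).max'_mem hne)
  refine ⟨y, hyY.1, ⟨hyY.2, lt_ladderSucc hz.2 fun w hw hyw => ?_⟩, fun w hw hwz => ?_⟩
  · by_contra hcon
    have h1 : w ≤ y := Finset.le_max' (Y.filter (fun w => w ≤ z)) w (Finset.mem_filter.2 ⟨hw, not_lt.1 hcon⟩)
    exact absurd h1 (not_le.2 hyw)
  · refine le_antisymm (Finset.le_max' (Y.filter (fun w => w ≤ z)) w (Finset.mem_filter.2 ⟨hw, hwz.1⟩)) ?_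
    by_contra hcon
    exact absurd (hwz.2.trans_le (ladderSucc_le hyY.1 (not_le.1 hcon))) (not_lt.2 hyY.2)

theorem IsLadder.mem_Icc {a b : ℝ} {Y : Finset ℝ} (hY : IsLadder a b Y) (hab : a < b) {y : ℝ}
    (hy : y ∈ Y) : a ≤ y ∧ y < b := by
  rcases hY.2 y hy with rfl | h
  · exact ⟨le_rfl, hab⟩
  · exact ⟨h.1.le, h.2⟩

theorem exists_fine_ladder {a b d : ℝ} (hab : a < b) (hd : 0 < d) :
    ∃ Y, IsLadder a b Y ∧ ∀ y ∈ Y, ladderSucc b Y y - y < d := by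
  classical
  obtain ⟨N, hN⟩ := exists_nat_gt ((b - a) / d)
  have hba : 0 < b - a := sub_pos.2 hab
  have hN0 : (0 : ℝ) < N := (div_pos hba hd).trans hN
  have hstep : (b - a) / N < d := by rwa [div_lt_comm₀ hN0 hd]
  have hs0 : 0 < (b - a) / N := by positivity
  refine ⟨(Finset.range N).image fun i : ℕ => a + (b - a) / N * i, ⟨?_, ?_⟩, ?_⟩
  · exact Finset.mem_image.2 ⟨0, Finset.mem_range.2 (by exact_mod_cast hN0), by simp⟩
  · intro y hy
    obtain ⟨i, hi, rfl⟩ := Finset.mem_image.1 hy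
    rcases Nat.eq_zero_or_pos i with rfl | hi0
    · left; simp
    · right
      have hi0' : (0 : ℝ) < i := by exact_mod_cast hi0
      have hiN : (i : ℝ) < N := by exact_mod_cast Finset.mem_range.1 hi
      refine ⟨by have := mul_pos hs0 hi0'; linarith, ?_⟩
      have : (b - a) / N * i < (b - a) / N * N := mul_lt_mul_of_pos_left hiN hs0
      rw [div_mul_cancel₀ _ hN0.ne'] at this
      linarith
  · intro y hy
    obtain ⟨i, hi, rfl⟩ := Finset.mem_image.1 hy
    have key : ladderSucc b ((Finset.range N).image fun i : ℕ => a + (b - a) / N * i)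
        (a + (b - a) / N * i) ≤ a + (b - a) / N * (i + 1) := by
      rcases (Nat.succ_le_of_lt (Finset.mem_range.1 hi)).eq_or_lt with h | h
      · refine (ladderSucc_le_right _ _ _).trans (le_of_eq ?_)
        have : (i : ℝ) + 1 = N := by exact_mod_cast h
        rw [this, div_mul_cancel₀ _ hN0.ne']; ring
      · refine ladderSucc_le (Finset.mem_image.2 ⟨i + 1, Finset.mem_range.2 h, by push_cast; rfl⟩) ?_
        rw [mul_add, mul_one]; linarith
    rw [mul_add, mul_one] at key
    linarith

/-- Two candidate limits are compared on one common ladder fine enough for both; on a nondegenerate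
interval such a ladder exists, so the chosen value is the limit. -/
theorem rsIntegral_eq {ι : Type*} [Fintype ι] [DecidableEq ι] {h f : (ι → ℝ) → ℝ} {a b : ι → ℝ}
    (hab : ∀ j, a j < b j) {I : ℝ} (H : HasRSIntegral h f a b I) : rsIntegral h f a b = I := by
  have Hex : ∃ I, HasRSIntegral h f a b I := ⟨I, H⟩
  unfold rsIntegral
  rw [dif_pos Hex]
  have H' := Hex.choose_spec
  set J := Hex.choose
  by_contra hne
  have he : 0 < |J - I| / 2 := half_pos (abs_pos.2 (sub_ne_zero.2 hne))
  obtain ⟨d, hd, h1⟩ := H _ he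
  obtain ⟨d', hd', h2⟩ := H' _ he
  choose Y hY hYd using fun j => exists_fine_ladder (hab j) (lt_min hd hd')
  have htag : ∀ y ∈ Fintype.piFinset Y, id y ∈ Icc y (fun j => ladderSucc (b j) (Y j) (y j)) := by
    refine fun y hy => ⟨le_rfl, fun j => le_of_lt ?_⟩
    have hj := Fintype.mem_piFinset.1 hy j
    exact lt_ladderSucc ((hY j).mem_Icc (hab j) hj).2 fun w _ h => h
  have e1 := h1 Y hY (fun j y hy => (hYd j y hy).trans_le (min_le_left _ _)) id htag
  have e2 := h2 Y hY (fun j y hy => (hYd j y hy).trans_le (min_le_right _ _)) id htag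
  set S := ∑ y ∈ Fintype.piFinset Y,
    h (id y) * altSum f y (fun j => ladderSucc (b j) (Y j) (y j))
  have : |J - I| ≤ |S - I| + |S - J| := by
    calc |J - I| = |(S - I) - (S - J)| := by congr 1; ring
      _ ≤ _ := abs_sub _ _
  linarith

/-- The increment of a product integrator over a cell is the integral of ∏ r_j over the rescaled
cell. A Riemann–Stieltjes sum is therefore exactly the integral of a step function with values
h(tag), which is uniformly close to h(bu). The constant `C` carries the factors of coordinates
frozen by integration by parts. -/
theorem hasRSIntegral_prod {ι : Type*} [Fintype ι] [DecidableEq ι] {h : (ι → ℝ) → ℝ}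
    {b : ι → ℝ} (hb : ∀ j, 0 < b j) (hc : ContinuousOn h (Icc 0 b)) (C : ℝ) {g r : ι → ℝ → ℝ}
    (hr : ∀ j, Continuous (r j))
    (hg : ∀ j p p', 0 ≤ p → p ≤ p' → p' ≤ 1 →
      ∫ u in Ico p p', r j u = g j (b j * p') - g j (b j * p)) :
    HasRSIntegral h (fun x => C * ∏ j, g j (x j)) (fun _ => 0) b
      (C * ∫ u, h (b * u) * ∏ j, r j (u j) ∂Measure.pi fun _ => volume.restrict (Ico 0 1)) := by
  set μ : Measure (ι → ℝ) := Measure.pi fun _ => volume.restrict (Ico (0 : ℝ) 1) with hμ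
  have hμ' : μ = volume.restrict (univ.pi fun _ => Ico (0 : ℝ) 1) := by
    rw [hμ, ← Measure.restrict_pi_pi]; rfl
  have : IsFiniteMeasure μ := by rw [hμ]; infer_instance
  have hsub : (univ.pi fun _ : ι => Ico (0 : ℝ) 1) ⊆ Icc 0 1 := by
    intro u hu
    exact ⟨fun j => (hu j (mem_univ j)).1, fun j => (hu j (mem_univ j)).2.le⟩
  have hmem : ∀ᵐ u ∂μ, u ∈ univ.pi fun _ : ι => Ico (0 : ℝ) 1 := by
    rw [hμ']
    exact ae_restrict_mem (MeasurableSet.univ_pi fun _ => measurableSet_Ico)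
  have hmaps : MapsTo (fun u => b * u) (Icc (0 : ι → ℝ) 1) (Icc 0 b) := fun u hu =>
    ⟨fun j => mul_nonneg (hb j).le (hu.1 j), fun j => mul_le_of_le_one_right (hb j).le (hu.2 j)⟩
  have hprod : Continuous fun u : ι → ℝ => ∏ j, r j (u j) :=
    continuous_finsetProd _ fun j _ => (hr j).comp (continuous_apply j)
  have hint : Integrable (fun u => h (b * u) * ∏ j, r j (u j)) μ := by
    have : ContinuousOn (fun u : ι → ℝ => h (b * u) * ∏ j, r j (u j)) (Icc 0 1) :=
      (hc.comp (by fun_prop) hmaps).mul hprod.continuousOn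
    rw [hμ']
    exact (this.integrableOn_compact isCompact_Icc).mono_set hsub
  obtain ⟨K, hK⟩ := (isCompact_Icc (a := (0 : ι → ℝ)) (b := 1)).exists_bound_of_continuousOn
    hprod.continuousOn
  have hK0 : 0 ≤ K := (norm_nonneg _).trans (hK 0 ⟨le_rfl, zero_le_one⟩)
  intro e he
  -- The oscillation of h allowed within a cell; the total error is at most |C|·K·μ·ω, and the +1
  -- keeps the denominator positive.
  set ω : ℝ := e / (|C| * (K * μ.real univ) + 1) with hω
  have hCK : 0 ≤ |C| * (K * μ.real univ) := by positivity
  have hω0 : 0 < ω := by positivity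
  have huc := (isCompact_Icc (a := (0 : ι → ℝ)) (b := b)).uniformContinuousOn_of_continuous hc
  obtain ⟨d, hd, hdω⟩ := Metric.uniformContinuousOn_iff.1 huc ω hω0
  refine ⟨d, hd, fun Y hY hmesh tag htag => ?_⟩
  set S : ι → ℝ → ℝ := fun j y => ladderSucc (b j) (Y j) y with hS
  set ind : ι → ℝ → ℝ → ℝ := fun j y => (Ico (y / b j) (S j y / b j)).indicator 1 with hind
  have hSlt : ∀ j, ∀ y ∈ Y j, y < S j y := fun j y hy =>
    lt_ladderSucc ((hY j).mem_Icc (hb j) hy).2 fun w _ h => h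
  have hindint : ∀ j, ∀ y ∈ Y j, ∫ u, ind j y u * r j u ∂(volume.restrict (Ico (0 : ℝ) 1)) =
      g j (S j y) - g j y := by
    intro j y hy
    have hy' := (hY j).mem_Icc (hb j) hy
    have h1 : (fun u => ind j y u * r j u) =
        (Ico (y / b j) (S j y / b j)).indicator (r j) := by
      ext u; by_cases hu : u ∈ Ico (y / b j) (S j y / b j) <;> simp [hind, hu]
    have hle : S j y / b j ≤ 1 := (div_le_one (hb j)).2 (ladderSucc_le_right _ _ _)
    have h0 : 0 ≤ y / b j := div_nonneg hy'.1 (hb j).le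
    rw [h1, setIntegral_indicator measurableSet_Ico,
      inter_eq_right.2 (Ico_subset_Ico h0 hle),
      hg j _ _ h0 (div_le_div_of_nonneg_right (hSlt j y hy).le (hb j).le) hle,
      mul_div_cancel₀ _ (hb j).ne', mul_div_cancel₀ _ (hb j).ne']
  have hfac : ∀ j y, Integrable (fun u => ind j y u * r j u) (volume.restrict (Ico (0 : ℝ) 1)) := by
    intro j y
    have h1 : (fun u => ind j y u * r j u) =
        (Ico (y / b j) (S j y / b j)).indicator (r j) := by
      ext u; by_cases hu : u ∈ Ico (y / b j) (S j y / b j) <;> simp [hind, hu]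
    rw [h1]
    refine Integrable.indicator ?_ measurableSet_Ico
    exact ((hr j).integrableOn_Icc (a := 0) (b := 1)).mono_set Ico_subset_Icc_self
  have hterm : ∀ y ∈ Fintype.piFinset Y,
      h (tag y) * altSum (fun x => C * ∏ j, g j (x j)) y (fun j => S j (y j)) =
        C * ∫ u, h (tag y) * ∏ j, (ind j (y j) (u j) * r j (u j)) ∂μ := by
    intro y hy
    rw [altSum_const_mul_prod, integral_const_mul, hμ,
      integral_fintype_prod_eq_prod (fun j v => ind j (y j) v * r j v)]
    rw [Finset.prod_congr rfl fun j _ => hindint j (y j) (Fintype.mem_piFinset.1 hy j)]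
    ring
  have htint : ∀ y, Integrable (fun u => h (tag y) * ∏ j, (ind j (y j) (u j) * r j (u j))) μ :=
    fun y => (Integrable.fintype_prod (f := fun j v => ind j (y j) v * r j v)
      fun j => hfac j (y j)).const_mul _
  rw [Finset.sum_congr rfl hterm, ← Finset.mul_sum, ← integral_finsetSum _ fun y _ => htint y,
    ← mul_sub, ← integral_sub (integrable_finsetSum _ fun y _ => htint y) hint, abs_mul]
  have hpt : ∀ᵐ u ∂μ, ‖(∑ y ∈ Fintype.piFinset Y,
      h (tag y) * ∏ j, (ind j (y j) (u j) * r j (u j))) - h (b * u) * ∏ j, r j (u j)‖ ≤ ω * K := by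
    filter_upwards [hmem] with u hu
    have hbu : ∀ j, b j * u j ∈ Ico 0 (b j) := fun j =>
      ⟨mul_nonneg (hb j).le (hu j (mem_univ j)).1,
        mul_lt_of_lt_one_right (hb j) (hu j (mem_univ j)).2⟩
    choose y0 hy0 hcell huniq using fun j => (hY j).existsUnique_cell (hbu j)
    have hy0Y : y0 ∈ Fintype.piFinset Y := Fintype.mem_piFinset.2 hy0
    have hindeq : ∀ j y, ind j y (u j) = if b j * u j ∈ Ico y (S j y) then 1 else 0 := by
      intro j y
      simp only [hind, indicator_apply, mem_Ico, div_le_iff₀ (hb j), lt_div_iff₀ (hb j),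
        mul_comm (u j), Pi.one_apply]
    rw [Finset.sum_eq_single_of_mem y0 hy0Y]
    · have h1 : ∏ j, (ind j (y0 j) (u j) * r j (u j)) = ∏ j, r j (u j) :=
        Finset.prod_congr rfl fun j _ => by rw [hindeq, if_pos (hcell j), one_mul]
      rw [h1, ← sub_mul, norm_mul]
      refine mul_le_mul (le_of_lt ?_) (hK u (hsub hu)) (norm_nonneg _) hω0.le
      have ht := htag y0 hy0Y
      refine hdω _ ⟨fun j => ?_, fun j => ?_⟩ _ (hmaps (hsub hu)) ((dist_pi_lt_iff hd).2 fun j => ?_)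
      · exact ((hY j).mem_Icc (hb j) (hy0 j)).1.trans (ht.1 j)
      · exact (ht.2 j).trans (ladderSucc_le_right _ _ _)
      · have hm := hmesh j (y0 j) (hy0 j)
        have h1 := ht.1 j; have h2 := ht.2 j; have h3 := (hcell j).1; have h4 := (hcell j).2
        simp only at h2 h4
        rw [Real.dist_eq, abs_lt, Pi.mul_apply]
        constructor <;> linarith
    · intro y hy hne
      obtain ⟨j, hj⟩ := Function.ne_iff.1 hne
      rw [Finset.prod_eq_zero (Finset.mem_univ j), mul_zero]
      rw [hindeq, if_neg, zero_mul]
      exact fun hcon => hj (huniq j (y j) (Fintype.mem_piFinset.1 hy j) hcon)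
  have hfin := norm_integral_le_of_norm_le_const hpt
  rw [Real.norm_eq_abs] at hfin
  calc |C| * _ ≤ |C| * (ω * K * μ.real univ) := mul_le_mul_of_nonneg_left hfin (abs_nonneg _)
    _ = (|C| * (K * μ.real univ)) * ω := by ring
    _ < (|C| * (K * μ.real univ) + 1) * ω := by gcongr; linarith
    _ = e := by rw [hω]; field_simp

/-! ### The limit process as a path functional -/

theorem prod_glue {ι : Type*} [Fintype ι] [DecidableEq ι] (G : ι → ℝ → ℝ) (v : Finset ι)
    (x : v → ℝ) (z : ι → ℝ) :
    ∏ j, G j (glue v x z j) = (∏ j ∈ vᶜ, G j (z j)) * ∏ j : v, G j (x j) := by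
  rw [← Finset.prod_mul_prod_compl v, mul_comm, ← Finset.prod_coe_sort v]
  congr 1
  · refine Finset.prod_congr rfl fun j hj => ?_
    simp [glue, Finset.mem_compl.1 hj]
  · refine Finset.prod_congr rfl fun j _ => ?_
    simp [glue]

theorem measurable_glue {ι : Type*} [DecidableEq ι] (v : Finset ι) (z : ι → ℝ) :
    Measurable fun x : v → ℝ => glue v x z := by
  refine measurable_pi_lambda _ fun j => ?_
  unfold glue
  split_ifs
  · exact measurable_pi_apply _
  · exact measurable_const

theorem continuous_glue {ι : Type*} [DecidableEq ι] (v : Finset ι) (z : ι → ℝ) :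
    Continuous fun x : v → ℝ => glue v x z := by
  refine continuous_pi fun j => ?_
  unfold glue
  split_ifs
  · exact continuous_apply _
  · exact continuous_const

/-- Expanding the product of the sums, v collects the coordinates that carry Lebesgue measure while
the others sit at 1. These are the terms v of the integration by parts formula. -/
theorem pi_endpointMeasure {ι : Type*} [Fintype ι] [DecidableEq ι] :
    Measure.pi (fun _ : ι => endpointMeasure) = ∑ v : Finset ι,
      (Measure.pi fun _ : v => volume.restrict (Ico (0 : ℝ) 1)).map fun u => glue v u 1 := by
  refine Measure.pi_eq fun s hs => ?_
  unfold endpointMeasure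
  simp only [Measure.add_apply]
  rw [Finset.prod_add, Finset.powerset_univ, Measure.finsetSum_apply]
  refine Finset.sum_congr rfl fun v _ => ?_
  rw [Measure.map_apply (measurable_glue v 1) (MeasurableSet.univ_pi hs)]
  by_cases h : ∀ j ∈ vᶜ, (1 : ℝ) ∈ s j
  · have h1 : (fun u : v → ℝ => glue v u 1) ⁻¹' univ.pi s = univ.pi fun j : v => s j := by
      ext u
      simp only [mem_preimage, mem_univ_pi]
      constructor
      · intro hu j
        simpa [glue] using hu j
      · intro hu j
        by_cases hj : j ∈ v
        · simpa [glue, hj] using hu ⟨j, hj⟩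
        · simpa [glue, hj] using h j (Finset.mem_compl.2 hj)
    rw [h1, Measure.pi_pi, ← Finset.compl_eq_univ_sdiff,
      Finset.prod_congr (s₁ := vᶜ) rfl fun j hj => by
        rw [Measure.dirac_apply' _ (hs j), indicator_of_mem (h j hj)]]
    simp only [Pi.one_apply, Finset.prod_const_one, mul_one]
    exact Finset.prod_coe_sort v fun j => (volume.restrict (Ico (0 : ℝ) 1)) (s j)
  · push Not at h
    obtain ⟨j, hj, hjs⟩ := h
    have h1 : (fun u : v → ℝ => glue v u 1) ⁻¹' univ.pi s = ∅ := by
      ext u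
      simp only [mem_preimage, mem_univ_pi, mem_empty_iff_false, iff_false, not_forall]
      exact ⟨j, by simpa [glue, Finset.mem_compl.1 hj] using hjs⟩
    rw [h1, measure_empty, Finset.prod_eq_zero (i := j) (s := Finset.univ \ v)
      (by rwa [← Finset.compl_eq_univ_sdiff])
      (by rw [Measure.dirac_apply' _ (hs j), indicator_of_notMem hjs]), mul_zero]

/-- One factor of the kernel, as a function of the integration variable. -/
theorem integral_neg_kernelSlope (w τ x b : ℝ) (p p' : ℝ) (hp : p ≤ p') :
    ∫ u in Ico p p', -kernelSlope w (τ * b) x u =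
      kernelFactor w τ x (b * p') - kernelFactor w τ x (b * p) := by
  rw [integral_neg, integral_Ico_kernelSlope _ _ _ hp]
  unfold kernelFactor
  rw [mul_assoc, mul_assoc]; ring

theorem rsIntegral_glue {h : (Fin 3 → ℝ) → ℝ} (hc : ContinuousOn h (Icc 0 1))
    (W τbar x b z : Fin 3 → ℝ) (hb : ∀ j, 0 < b j) (hb1 : b ≤ 1) (hz : z ∈ Icc 0 1)
    (v : Finset (Fin 3)) :
    rsIntegral (fun u : v → ℝ => h (glue v u z))
      (fun u : v → ℝ => kernel W (x - τbar * glue v u z)) (fun j => (0 : Fin 3 → ℝ) j)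
      (fun j => b j) =
    (∏ j ∈ vᶜ, kernelFactor (W j) (τbar j) (x j) (z j)) *
      ∫ u, h (glue v ((fun j : v => b j) * u) z) *
        ∏ j : v, -kernelSlope (W j) (τbar j * b j) (x j) (u j)
        ∂Measure.pi fun _ => volume.restrict (Ico 0 1) := by
  refine rsIntegral_eq (a := fun j : v => (0 : Fin 3 → ℝ) j) (b := fun j : v => b j)
    (fun j => hb j) ?_
  have hmaps : MapsTo (fun u : v → ℝ => glue v u z) (Icc 0 fun j : v => b j) (Icc 0 1) := by
    intro u hu
    constructor
    · intro j
      by_cases hj : j ∈ v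
      · simpa [glue, hj] using hu.1 ⟨j, hj⟩
      · simpa [glue, hj] using hz.1 j
    · intro j
      by_cases hj : j ∈ v
      · simpa [glue, hj] using (hu.2 ⟨j, hj⟩).trans (hb1 j)
      · simpa [glue, hj] using hz.2 j
  have := hasRSIntegral_prod (h := fun u : v → ℝ => h (glue v u z)) (b := fun j : v => b j)
    (fun j => hb j) (hc.comp (continuous_glue v z).continuousOn hmaps)
    (∏ j ∈ vᶜ, kernelFactor (W j) (τbar j) (x j) (z j))
    (g := fun j => kernelFactor (W j) (τbar j) (x j))
    (r := fun j u => -kernelSlope (W j) (τbar j * b j) (x j) u)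
    (fun j => by fun_prop)
    (fun j p p' _ hp _ => integral_neg_kernelSlope (W j) (τbar j) (x j) (b j) p p' hp)
  convert this using 2 with u
  · exact prod_glue (fun j => kernelFactor (W j) (τbar j) (x j)) v u z
  · rfl

/-- The summands of both sides match for each v: coordinates in v are integrated against the kernel
slope, and the others are evaluated at the upper corner, which is u = 1 after z = bu. -/
theorem stieltjesByParts_eq_pathIntegral {h : (Fin 3 → ℝ) → ℝ} (hc : ContinuousOn h (Icc 0 1))
    (h0 : ∀ x ∈ Icc (0 : Fin 3 → ℝ) 1, (∃ j, x j = 0) → h x = 0)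
    {W : Fin 3 → ℝ} (hW : ∀ j, 0 < W j) (τbar x b : Fin 3 → ℝ) (hb : ∀ j, 0 < b j) (hb1 : b ≤ 1) :
    stieltjesByParts (fun z => kernel W (x - τbar * z)) h 0 b =
      pathIntegral W (fun v => h fun j => (v j : ℝ)) b (τbar * b) x := by
  have hb0 : 0 ≤ b := fun j => (hb j).le
  set y : (Fin 3 → unitInterval) → ℝ := fun v => h fun j => (v j : ℝ) with hy
  have hyc : Continuous y := by
    refine hc.comp_continuous (by fun_prop) fun v => ⟨fun j => (v j).2.1, fun j => (v j).2.2⟩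
  have hext : ∀ z ∈ Icc (0 : Fin 3 → ℝ) 1, extendPath y z = h z := by
    intro z hz
    simp only [extendPath, hy]
    congr 1; ext j
    rw [projIcc_of_mem zero_le_one (show z j ∈ Icc (0 : ℝ) 1 from ⟨hz.1 j, hz.2 j⟩)]
  have hmem : ∀ v : Finset (Fin 3), ∀ᵐ u ∂(Measure.pi fun _ : v => volume.restrict (Ico (0 : ℝ) 1)),
      ∀ j, u j ∈ Ico (0 : ℝ) 1 := by
    intro v
    have : (Measure.pi fun _ : v => volume.restrict (Ico (0 : ℝ) 1)) =
        volume.restrict (univ.pi fun _ => Ico (0 : ℝ) 1) := by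
      rw [← Measure.restrict_pi_pi]; rfl
    rw [this]
    filter_upwards [ae_restrict_mem (MeasurableSet.univ_pi fun _ => measurableSet_Ico)] with u hu j
      using hu j (mem_univ j)
  have hglue : ∀ (v : Finset (Fin 3)) (u : v → ℝ) (z : Fin 3 → ℝ), z ∈ Icc (0 : Fin 3 → ℝ) 1 →
      (∀ j, u j ∈ Ico (0 : ℝ) 1) → glue v ((fun j : v => b j) * u) z ∈ Icc (0 : Fin 3 → ℝ) 1 := by
    intro v u z hz hu
    constructor
    · intro j
      by_cases hj : j ∈ v
      · simpa [glue, hj] using mul_nonneg (hb0 j) (hu ⟨j, hj⟩).1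
      · simpa [glue, hj] using hz.1 j
    · intro j
      by_cases hj : j ∈ v
      · simpa [glue, hj] using mul_le_one₀ (hb1 j) (hu ⟨j, hj⟩).1 (hu ⟨j, hj⟩).2.le
      · simpa [glue, hj] using hz.2 j
  have hint := (IsTamePath.of_continuous hyc).integrable hW b (τbar * b) x
  unfold pathIntegral
  rw [pi_endpointMeasure] at hint ⊢
  have hint' := integrable_finsetSum_measure.1 hint
  rw [integral_finsetSum_measure fun v _ => hint' v (Finset.mem_univ v)]
  unfold stieltjesByParts
  refine Finset.sum_congr rfl fun v _ => ?_
  rw [integral_map (measurable_glue v 1).aemeasurable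
    (hint' v (Finset.mem_univ v)).aestronglyMeasurable]
  -- Every nonempty w puts a coordinate outside v at 0, where h vanishes; only the upper endpoints
  -- survive.
  rw [Finset.sum_eq_single_of_mem ∅ (Finset.empty_mem_powerset _)]
  · simp only [Finset.card_empty, pow_zero, one_mul, Finset.piecewise_empty]
    rw [rsIntegral_glue hc W τbar x b b hb hb1 ⟨hb0, hb1⟩ v, ← mul_assoc, ← integral_const_mul]
    refine integral_congr_ae ?_
    filter_upwards [hmem v] with u hu
    have e1 : b * glue v u 1 = glue v ((fun j : v => b j) * u) b := by
      ext j
      by_cases hj : j ∈ v <;> simp [glue, hj]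
    rw [e1, hext _ (hglue v u b ⟨hb0, hb1⟩ hu),
      prod_glue (fun j => byPartsDensity (W j) ((τbar * b) j) (x j)) v u 1, Finset.prod_neg,
      Finset.prod_congr (s₁ := vᶜ)
        (f := fun j => byPartsDensity (W j) ((τbar * b) j) (x j) ((1 : Fin 3 → ℝ) j))
        (g := fun j => kernelFactor (W j) (τbar j) (x j) (b j)) rfl fun j _ => by simp [byPartsDensity, kernelFactor],
      Finset.prod_congr (s₁ := Finset.univ) (f := fun j : v => byPartsDensity _ _ _ _)
        (g := fun j : v => kernelSlope (W j) (τbar j * b j) (x j) (u j)) rfl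
        fun j _ => by simp [byPartsDensity, (hu j).2.ne]]
    -- The sign of integration by parts cancels the one from the slopes being negative derivatives.
    have : (-1 : ℝ) ^ v.card * (-1 : ℝ) ^ v.card = 1 := by
      rw [← mul_pow]; norm_num
    simp only [Finset.card_univ, Fintype.card_coe]
    linear_combination (∏ j ∈ vᶜ, kernelFactor (W j) (τbar j) (x j) (b j)) *
      h (glue v ((fun j : v => b j) * u) b) *
      (∏ j : v, kernelSlope (W j) (τbar j * b j) (x j) (u j)) * this
  · intro w hw hne
    obtain ⟨j, hj⟩ := Finset.nonempty_iff_ne_empty.2 hne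
    have hz : w.piecewise 0 b ∈ Icc (0 : Fin 3 → ℝ) 1 := by
      constructor
      · intro i; by_cases hi : i ∈ w <;> simp [hi]
        exact hb0 i
      · intro i; by_cases hi : i ∈ w <;> simp [hi]
        exact hb1 i
    have := rsIntegral_glue hc W τbar x b (w.piecewise 0 b) hb hb1 hz v
    rw [this, integral_eq_zero_of_ae, mul_zero, mul_zero]
    filter_upwards [hmem v] with u hu
    rw [h0 _ (hglue v u _ hz hu), zero_mul]; · rfl
    refine ⟨j, ?_⟩
    have hjv : j ∉ v := Finset.mem_compl.1 (Finset.mem_powerset.1 hw hj)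
    simp [glue, hjv, hj]

/-- Continuity and vanishing on the faces permit integration by parts on this path; s > 0 keeps the
box nondegenerate, so that the Riemann–Stieltjes values are determined. -/
theorem limitProcess_eq_pathFunctional {Ω : Type*} {B : (Fin 3 → ℝ) → Ω → ℝ} {ω : Ω}
    (hc : ContinuousOn (fun x => B x ω) (Icc 0 1))
    (h0 : ∀ x ∈ Icc (0 : Fin 3 → ℝ) 1, (∃ j, x j = 0) → B x ω = 0)
    {W : Fin 3 → ℝ} (hW : ∀ j, 0 < W j) (τbar : Fin 3 → ℝ) (σ : ℝ) {s : ℝ} (hs : 0 < s)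
    (hs1 : s ≤ 1) (q : Fin 3 → ℝ) :
    limitProcess W τbar σ B ω s (τbar * boxCorner s * q) =
      pathFunctional W τbar τbar (fun v => σ * B (fun j => (v j : ℝ)) ω) s q := by
  rw [pathFunctional_const_mul]
  unfold limitProcess pathFunctional
  have := stieltjesByParts_eq_pathIntegral hc h0 hW τbar (τbar * boxCorner s * q) (boxCorner s)
    (fun j => by fin_cases j <;> simp [boxCorner, hs])
    (fun j => by fin_cases j <;> simp [boxCorner, hs1])
  rw [show ![s, 1, 1] = boxCorner s from rfl, this]
  ring

/-! ### The Skorohod topology is pseudometrizable -/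

theorem SkorohodClose.refl {q : ℕ} {e : ℝ} (he : 0 < e) (x : SkorohodSpace q) :
    SkorohodClose e x x :=
  ⟨fun _ => OrderIso.refl _, fun p u => by simpa using he, fun t => by simpa using he⟩

theorem SkorohodClose.symm {q : ℕ} {e : ℝ} {x y : SkorohodSpace q} (h : SkorohodClose e x y) :
    SkorohodClose e y x := by
  obtain ⟨lam, h1, h2⟩ := h
  refine ⟨fun p => (lam p).symm, fun p u => ?_, fun t => ?_⟩
  · have := h1 p ((lam p).symm u)
    rwa [OrderIso.apply_symm_apply, abs_sub_comm] at this
  · have := h2 fun p => (lam p).symm (t p)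
    simp only [OrderIso.apply_symm_apply] at this
    rwa [abs_sub_comm]

theorem SkorohodClose.trans {q : ℕ} {e e' : ℝ} {x y z : SkorohodSpace q}
    (h : SkorohodClose e x y) (h' : SkorohodClose e' y z) : SkorohodClose (e + e') x z := by
  obtain ⟨lam, h1, h2⟩ := h
  obtain ⟨mu, h3, h4⟩ := h'
  refine ⟨fun p => (lam p).trans (mu p), fun p u => ?_, fun t => ?_⟩
  · have := abs_sub_le ((mu p (lam p u) : unitInterval) : ℝ) ((lam p u : unitInterval) : ℝ) (u : ℝ)
    have h5 := h1 p u
    have h6 := h3 p (lam p u)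
    simp only [OrderIso.trans_apply]
    linarith
  · have := abs_sub_le (x.1 t) (y.1 fun p => lam p (t p)) (z.1 fun p => mu p (lam p (t p)))
    have h5 := h2 t
    have h6 := h4 fun p => lam p (t p)
    simp only [OrderIso.trans_apply]
    linarith

theorem SkorohodClose.mono {q : ℕ} {e e' : ℝ} (he : e ≤ e') {x y : SkorohodSpace q}
    (h : SkorohodClose e x y) : SkorohodClose e' x y := by
  obtain ⟨lam, h1, h2⟩ := h
  exact ⟨lam, fun p u => (h1 p u).trans_le he, fun t => (h2 t).trans_le he⟩

/-- The filter generated by the relations `SkorohodClose e`. -/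
def skorohodUniformity (q : ℕ) : Filter (SkorohodSpace q × SkorohodSpace q) :=
  ⨅ e ∈ Ioi (0 : ℝ), 𝓟 {p | SkorohodClose e p.1 p.2}

theorem hasBasis_skorohodUniformity (q : ℕ) :
    (skorohodUniformity q).HasBasis (fun e : ℝ => 0 < e) fun e => {p | SkorohodClose e p.1 p.2} := by
  refine hasBasis_biInf_principal (fun a ha b hb => ⟨min a b,
    mem_Ioi.2 (lt_min (mem_Ioi.1 ha) (mem_Ioi.1 hb)), ?_, ?_⟩) ⟨1, mem_Ioi.2 one_pos⟩
  · exact fun p hp => hp.mono (min_le_left _ _)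
  · exact fun p hp => hp.mono (min_le_right _ _)

/-- The uniform structure generated by the relations `SkorohodClose e`. -/
def skorohodCore (q : ℕ) : UniformSpace.Core (SkorohodSpace q) where
  uniformity := skorohodUniformity q
  refl := by
    rw [(hasBasis_skorohodUniformity q).ge_iff]
    rintro e he ⟨x, y⟩ (rfl : x = y)
    exact SkorohodClose.refl he x
  symm := by
    rw [(hasBasis_skorohodUniformity q).tendsto_iff (hasBasis_skorohodUniformity q)]
    exact fun e he => ⟨e, he, fun p hp => hp.symm⟩
  comp := by
    refine (((hasBasis_skorohodUniformity q).lift' (monotone_id.relComp monotone_id)).le_basis_iff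
      (hasBasis_skorohodUniformity q)).2 ?_
    refine fun e he => ⟨e / 2, half_pos he, ?_⟩
    rintro ⟨x, z⟩ ⟨y, h1, h2⟩
    have := SkorohodClose.trans h1 h2
    rwa [add_halves] at this

/-- Inverting and composing time changes gives symmetry and a triangle inequality, so the Skorohod
balls are the neighbourhoods of a uniform structure. -/
theorem skorohod_topology_eq (q : ℕ) :
    SkorohodSpace.instTopologicalSpace q = (skorohodCore q).toTopologicalSpace := by
  refine TopologicalSpace.ext_iff.2 fun U => ?_
  rw [@isOpen_iff_mem_nhds _ (skorohodCore q).toTopologicalSpace]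
  simp only [(skorohodCore q).nhds_toTopologicalSpace]
  have : ∀ x, U ∈ comap (Prod.mk x) (skorohodCore q).uniformity ↔
      ∃ e > (0 : ℝ), ∀ y, SkorohodClose e x y → y ∈ U := fun x =>
    ((hasBasis_skorohodUniformity q).comap (Prod.mk x)).mem_iff
  simp only [this]
  rfl

/-- The radii 1/(k+1) give a countable basis. Pseudometrizability supplies the approximation of
closed sets that the portmanteau theorem requires. -/
instance SkorohodSpace.pseudoMetrizableSpace (q : ℕ) :
    TopologicalSpace.PseudoMetrizableSpace (SkorohodSpace q) := by
  let _ : UniformSpace (SkorohodSpace q) :=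
    UniformSpace.ofCoreEq (skorohodCore q) _ (skorohod_topology_eq q)
  have : (uniformity (SkorohodSpace q)).IsCountablyGenerated := by
    have hB : (uniformity (SkorohodSpace q)).HasBasis (fun e : ℝ => 0 < e)
      fun e => {p | SkorohodClose e p.1 p.2} := hasBasis_skorohodUniformity q
    refine (hB.to_hasBasis (p' := fun _ : ℕ => True)
      (s' := fun k : ℕ => {p | SkorohodClose (1 / ((k : ℝ) + 1)) p.1 p.2}) ?_ ?_).isCountablyGenerated
    · intro e he
      obtain ⟨k, hk⟩ := exists_nat_one_div_lt he
      exact ⟨k, trivial, fun p hp => hp.mono hk.le⟩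
    · exact fun k _ => ⟨1 / ((k : ℝ) + 1), by positivity, subset_rfl⟩
  exact UniformSpace.pseudoMetrizableSpace

theorem eventually_skorohodClose {q : ℕ} (x : SkorohodSpace q) {e : ℝ} (he : 0 < e) :
    ∀ᶠ y in 𝓝 x, SkorohodClose e x y := by
  have h : 𝓝 x = comap (Prod.mk x) (skorohodUniformity q) := by
    rw [skorohod_topology_eq]
    exact (skorohodCore q).nhds_toTopologicalSpace x
  rw [h]
  exact ((hasBasis_skorohodUniformity q).comap (Prod.mk x)).mem_of_mem he

/-- Near a continuous path, the Skorohod topology is the topology of uniform convergence. -/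
theorem eventually_abs_sub_lt_of_continuous {q : ℕ} {x : SkorohodSpace q} (hx : Continuous x.1)
    {e : ℝ} (he : 0 < e) : ∀ᶠ y in 𝓝 x, ∀ t, |y.1 t - x.1 t| < e := by
  have huc := CompactSpace.uniformContinuous_of_continuous hx
  obtain ⟨d, hd, h⟩ := Metric.uniformContinuous_iff.1 huc (e / 2) (half_pos he)
  filter_upwards [eventually_skorohodClose x (lt_min hd (half_pos he))] with y hy t
  -- The relation is reversed so that the time change acts inside the continuous path x, where
  -- uniform continuity absorbs it.
  obtain ⟨lam, h1, h2⟩ := hy.symm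
  have h3 := (h2 t).trans_le (min_le_right _ _)
  have h4 : dist (x.1 fun p => lam p (t p)) (x.1 t) < e / 2 :=
    h ((dist_pi_lt_iff hd).2 fun p => (h1 p (t p)).trans_le (min_le_left _ _))
  rw [Real.dist_eq] at h4
  have := abs_sub_le (y.1 t) (x.1 fun p => lam p (t p)) (x.1 t)
  linarith

/-! ### The extended continuous mapping theorem -/

/-- The functionals `H n` vary with n and need not be measurable: only their joint convergence at
almost every limit point is used, through the open-set form of the portmanteau theorem. -/
theorem tendstoInDistribution_of_tendsto_prod {S E Ω Ω' : Type*} [TopologicalSpace S]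
    [MeasurableSpace S] [BorelSpace S] [HasOuterApproxClosed S] [TopologicalSpace E]
    [MeasurableSpace E] [BorelSpace E] [HasOuterApproxClosed E] [MeasurableSpace Ω]
    [MeasurableSpace Ω'] {P : Measure Ω} [IsProbabilityMeasure P] {P' : Measure Ω'}
    [IsProbabilityMeasure P'] {q : ℕ} {X : (Fin q → ℕ) → Ω → S} {Z : Ω' → S}
    (hX : TendstoInDistribution X atTop Z (fun _ => P) P') {H : (Fin q → ℕ) → S → E} {G : S → E}
    {Y : (Fin q → ℕ) → Ω → E} (hY : ∀ n, AEMeasurable (Y n) P)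
    (hYH : ∀ᶠ n in atTop, ∀ ω, Y n ω = H n (X n ω))
    (hG : AEMeasurable (fun ω => G (Z ω)) P')
    (hHG : ∀ᵐ ω ∂P', Tendsto (fun p : (Fin q → ℕ) × S => H p.1 p.2) (atTop ×ˢ 𝓝 (Z ω))
      (𝓝 (G (Z ω)))) :
    TendstoInDistribution Y atTop (fun ω => G (Z ω)) (fun _ => P) P' := by
  refine ⟨hY, hG, tendsto_of_forall_isOpen_le_liminf' fun U hU => ?_⟩
  simp only [ProbabilityMeasure.coe_mk]
  rw [Measure.map_apply_of_aemeasurable hG hU.measurableSet]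
  -- Points around which all later functionals land in U. These open sets increase with N, and joint
  -- convergence puts almost every limit point mapped into U in their union.
  set A : ℕ → Set S := fun N => interior {y | ∀ n : Fin q → ℕ, (fun _ => N) ≤ n → H n y ∈ U} with hA
  have hAmono : Monotone A := fun N M hNM => interior_mono fun y hy n hn =>
    hy n (fun j => hNM.trans (hn j))
  have hsub : (fun ω => G (Z ω)) ⁻¹' U ≤ᵐ[P'] Z ⁻¹' ⋃ N, A N := by
    filter_upwards [hHG] with ω hω hmem
    have h1 : ∀ᶠ p : (Fin q → ℕ) × S in atTop ×ˢ 𝓝 (Z ω), H p.1 p.2 ∈ U :=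
      hω (hU.mem_nhds hmem)
    obtain ⟨pa, ha, pb, hb, hab⟩ := eventually_prod_iff.1 h1
    obtain ⟨m, hm⟩ := eventually_atTop.1 ha
    refine mem_iUnion.2 ⟨Finset.univ.sup m, mem_interior_iff_mem_nhds.2 ?_⟩
    filter_upwards [hb] with y hy n hn
    exact hab (hm n fun j => (Finset.le_sup (Finset.mem_univ j)).trans (hn j)) hy
  refine (measure_mono_ae hsub).trans ?_
  rw [← Measure.map_apply_of_aemeasurable hX.aemeasurable_limit
    (isOpen_iUnion fun N => isOpen_interior).measurableSet, hAmono.measure_iUnion]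
  refine iSup_le fun N => ?_
  have hport := ProbabilityMeasure.le_liminf_measure_open_of_tendsto hX.tendsto
    (isOpen_interior : IsOpen (A N))
  simp only [ProbabilityMeasure.coe_mk] at hport
  refine hport.trans (liminf_le_liminf ?_)
  filter_upwards [hYH, eventually_ge_atTop fun _ => N] with n hn hnN
  rw [Measure.map_apply_of_aemeasurable (hX.forall_aemeasurable n) isOpen_interior.measurableSet,
    Measure.map_apply_of_aemeasurable (hY n) hU.measurableSet]
  refine measure_mono fun ω hω => ?_
  rw [mem_preimage, hn]
  exact interior_subset hω n hnN

/-! ### Convergence of passage times -/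

theorem discretePassageTime_div {s₀ : ℝ} {m : ℕ} (hm : 0 < m) (c : ℝ) (D : ℝ → ℝ) :
    discretePassageTime s₀ m c D / ((m : ℝ) : EReal) =
      sInf ((fun k : ℕ => (((k : ℝ) / (m : ℝ) : ℝ) : EReal)) ''
        {k : ℕ | ⌊(m : ℝ) * s₀⌋₊ ≤ k ∧ k ≤ m ∧ c < D ((k : ℝ) / (m : ℝ))}) := by
  have hm' : (0 : EReal) < ((m : ℝ) : EReal) := by exact_mod_cast hm
  refine eq_of_forall_le_iff fun a => ?_
  unfold discretePassageTime
  rw [EReal.le_div_iff_mul_le hm' (EReal.coe_ne_top _)]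
  simp only [le_sInf_iff, forall_mem_image, EReal.coe_div]
  exact forall₂_congr fun k _ => (EReal.le_div_iff_mul_le hm' (EReal.coe_ne_top _)).symm

/-- The maximum over [s₀, r] is attained, and being different from c it is strictly below c; half of
the gap is left for the approximation error. -/
theorem eventually_forall_lt_of_le {T : Type*} {l : Filter T} {m : T → ℕ}
    (hm : Tendsto m l atTop) {Dn : T → ℝ → ℝ} {D : ℝ → ℝ} (hD : Continuous D)
    (hclose : ∀ η > (0 : ℝ), ∀ᶠ p in l, ∀ s ∈ Icc (0 : ℝ) 1, |Dn p s - D s| < η)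
    {s₀ c r : ℝ} (hr : s₀ ≤ r) (hle : ∀ u ∈ Icc s₀ r, D u ≤ c)
    (hne : sSup (D '' Icc s₀ r) ≠ c) :
    ∀ᶠ p in l, ∀ k : ℕ, ⌊(m p : ℝ) * s₀⌋₊ ≤ k → k ≤ m p → c < Dn p ((k : ℝ) / (m p : ℝ)) →
      r < (k : ℝ) / (m p : ℝ) := by
  obtain ⟨u, hu, hmax⟩ := isCompact_Icc.exists_sSup_image_eq (nonempty_Icc.2 hr)
    (hD.continuousOn (s := Icc s₀ r))
  have hub : ∀ v ∈ Icc s₀ r, D v ≤ D u := by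
    intro v hv
    rw [← hmax]
    exact le_csSup (isCompact_Icc.image hD).bddAbove (mem_image_of_mem _ hv)
  rw [hmax] at hne
  have hlt : D u < c := lt_of_le_of_ne (hle u hu) hne
  set η := (c - D u) / 2 with hη
  have hη0 : 0 < η := by rw [hη]; linarith
  -- The discrete monitoring starts at ⌊m s₀⌋/m, possibly left of s₀ by less than 1/m; continuity at
  -- s₀ covers this first point.
  have hcont : ∀ᶠ s in 𝓝 s₀, D s < D u + η :=
    hD.continuousAt.eventually_lt_const (by have := hub s₀ ⟨le_rfl, hr⟩; linarith)
  obtain ⟨d, hd, hdD⟩ := Metric.eventually_nhds_iff.1 hcont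
  obtain ⟨N, hN⟩ := exists_nat_gt (1 / d)
  filter_upwards [hclose η hη0, hm.eventually_ge_atTop (N + 1)] with p hp hpN k hk hkm hck
  by_contra hcon
  rw [not_lt] at hcon
  have hmpos : (0 : ℝ) < m p := by exact_mod_cast (Nat.succ_pos N).trans_le hpN
  have hkm' : (k : ℝ) / m p ≤ 1 := (div_le_one hmpos).2 (by exact_mod_cast hkm)
  have h1 := hp ((k : ℝ) / m p) ⟨by positivity, hkm'⟩
  have h2 : D ((k : ℝ) / m p) < D u + η := by
    rcases le_total s₀ ((k : ℝ) / m p) with h | h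
    · linarith [hub _ ⟨h, hcon⟩]
    · refine hdD ?_
      have h3 := Nat.lt_floor_add_one ((m p : ℝ) * s₀)
      have h4 : (⌊(m p : ℝ) * s₀⌋₊ : ℝ) ≤ k := by exact_mod_cast hk
      have h5 : s₀ < ((k : ℝ) + 1) / m p := by rw [lt_div_iff₀ hmpos]; linarith
      have h6 : 1 / (m p : ℝ) < d := by
        rw [div_lt_comm₀ hmpos hd]
        have : (N : ℝ) + 1 ≤ m p := by exact_mod_cast hpN
        linarith
      rw [add_div] at h5
      rw [Real.dist_eq, abs_lt]
      constructor <;> linarith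
  rw [abs_lt] at h1
  linarith [h1.2]

/-- Passing too late is excluded by a strict crossing point of the limit curve, passing too early by
the running maximum being strictly below c. Rational r suffice, so only countably many null events
need to be discarded. -/
theorem tendsto_discretePassageTime {T : Type*} {l : Filter T} {m : T → ℕ}
    (hm : Tendsto m l atTop) {Dn : T → ℝ → ℝ} {D : ℝ → ℝ} (hD : Continuous D)
    (hclose : ∀ η > (0 : ℝ), ∀ᶠ p in l, ∀ s ∈ Icc (0 : ℝ) 1, |Dn p s - D s| < η)
    {s₀ c : ℝ} (hs₀ : 0 < s₀) (hs₀' : s₀ < 1)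
    (hne : ∀ r : ℚ, (r : ℝ) ∈ Icc s₀ 1 → sSup (D '' Icc s₀ (r : ℝ)) ≠ c) :
    Tendsto (fun p => discretePassageTime s₀ (m p) c (Dn p) / ((m p : ℝ) : EReal)) l
      (𝓝 (passageTime s₀ c D)) := by
  have hpos : ∀ᶠ p in l, 0 < m p := hm.eventually_gt_atTop 0
  have hmR : Tendsto (fun p => (m p : ℝ)) l atTop := tendsto_natCast_atTop_atTop.comp hm
  have hfloor : ∀ s : ℝ, 0 ≤ s →
      Tendsto (fun p => (⌊(m p : ℝ) * s⌋₊ : ℝ) / (m p : ℝ)) l (𝓝 s) := fun s hs => by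
    have := (tendsto_nat_floor_mul_div_atTop hs).comp hmR
    simpa only [Function.comp_def, mul_comm] using this
  refine tendsto_order.2 ⟨fun a ha => ?_, fun a ha => ?_⟩
  -- If the limit curve never exceeds c, its maximum on [s₀, 1] is strictly below c, so that
  -- eventually no discrete crossing occurs and both passage times are +∞.
  · by_cases hall : ∀ u ∈ Icc s₀ 1, D u ≤ c
    · have h1 := eventually_forall_lt_of_le hm hD hclose hs₀'.le hall
        (by simpa using hne 1 (by simpa using hs₀'.le))
      filter_upwards [h1, hpos] with p hp hp0
      have hset : {k : ℕ | ⌊(m p : ℝ) * s₀⌋₊ ≤ k ∧ k ≤ m p ∧ c < Dn p ((k : ℝ) / (m p : ℝ))} = ∅ := by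
        ext k
        simp only [mem_ofPred_eq, mem_empty_iff_false, iff_false]
        rintro ⟨hk1, hk2, hk3⟩
        have hmpos : (0 : ℝ) < m p := by exact_mod_cast hp0
        have : (k : ℝ) / m p ≤ 1 := (div_le_one hmpos).2 (by exact_mod_cast hk2)
        exact absurd (hp k hk1 hk2 hk3) (not_lt.2 this)
      rw [discretePassageTime_div hp0, hset, image_empty, sInf_empty]
      exact ha.trans_le le_top
    · push Not at hall
      obtain ⟨u, hu, huc⟩ := hall
      have hL1 : passageTime s₀ c D ≤ ((1 : ℝ) : EReal) :=
        (sInf_le (mem_image_of_mem _ (show u ∈ {s : ℝ | s ∈ Icc s₀ 1 ∧ c < D s} from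
          ⟨hu, huc⟩))).trans (EReal.coe_le_coe_iff.2 hu.2)
      -- A bound below s₀ follows from the starting index alone; otherwise a rational r is placed
      -- between a and the passage time.
      rcases lt_or_ge a (s₀ : EReal) with has | has
      · obtain ⟨a', ha1, ha2⟩ := EReal.lt_iff_exists_real_btwn.1 has
        have ha2' : a' < s₀ := EReal.coe_lt_coe_iff.1 ha2
        filter_upwards [(hfloor s₀ hs₀.le).eventually_const_lt ha2', hpos] with p hp hp0
        rw [discretePassageTime_div hp0]
        refine ha1.trans_le (le_sInf ?_)
        rintro _ ⟨k, hk, rfl⟩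
        refine EReal.coe_le_coe_iff.2 (hp.le.trans ?_)
        have : (⌊(m p : ℝ) * s₀⌋₊ : ℝ) ≤ k := by exact_mod_cast hk.1
        gcongr
      · obtain ⟨r, hr1, hr2⟩ := EReal.exists_rat_btwn_of_lt ha
        have hr1' : s₀ ≤ r := (EReal.coe_lt_coe_iff.1 (has.trans_lt hr1)).le
        have hr2' : (r : ℝ) ≤ 1 := EReal.coe_le_coe_iff.1 (hr2.le.trans hL1)
        have hle : ∀ v ∈ Icc s₀ (r : ℝ), D v ≤ c := by
          intro v hv
          by_contra hcon
          have : passageTime s₀ c D ≤ (v : EReal) :=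
            sInf_le (mem_image_of_mem _ ⟨⟨hv.1, hv.2.trans hr2'⟩, not_le.1 hcon⟩)
          exact absurd (this.trans (EReal.coe_le_coe_iff.2 hv.2)) (not_le.2 hr2)
        filter_upwards [eventually_forall_lt_of_le hm hD hclose hr1' hle (hne r ⟨hr1', hr2'⟩),
          hpos] with p hp hp0
        rw [discretePassageTime_div hp0]
        refine hr1.trans_le (le_sInf ?_)
        rintro _ ⟨k, hk, rfl⟩
        exact EReal.coe_le_coe_iff.2 (hp k hk.1 hk.2.1 hk.2.2).le
  -- Upper bound: near a point s < a with D(s) > c the index ⌊ms⌋ is admissible, lies to the left of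
  -- s, and eventually gives an alarm.
  · obtain ⟨_, ⟨s, ⟨hs, hsc⟩, rfl⟩, hsa⟩ := sInf_lt_iff.1 ha
    have hs0 : 0 ≤ s := hs₀.le.trans hs.1
    set η := (D s - c) / 2 with hη
    have hη0 : 0 < η := by rw [hη]; linarith
    have h1 : ∀ᶠ p in l, c + η < D ((⌊(m p : ℝ) * s⌋₊ : ℝ) / (m p : ℝ)) :=
      ((hD.tendsto s).comp (hfloor s hs0)).eventually_const_lt (by rw [hη]; linarith)
    filter_upwards [h1, hclose η hη0, hpos] with p hp1 hp2 hp0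
    have hmpos : (0 : ℝ) < m p := by exact_mod_cast hp0
    have hle : (⌊(m p : ℝ) * s⌋₊ : ℝ) / (m p : ℝ) ≤ s := by
      rw [div_le_iff₀ hmpos, mul_comm s]
      exact Nat.floor_le (mul_nonneg hmpos.le hs0)
    rw [discretePassageTime_div hp0]
    refine lt_of_le_of_lt (sInf_le ⟨⌊(m p : ℝ) * s⌋₊, ⟨?_, ?_, ?_⟩, rfl⟩)
      (lt_of_le_of_lt (EReal.coe_le_coe_iff.2 hle) hsa)
    · exact Nat.floor_le_floor (mul_le_mul_of_nonneg_left hs.1 hmpos.le)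
    · exact Nat.floor_le_of_le (mul_le_of_le_one_right hmpos.le hs.2)
    · have := abs_lt.1 (hp2 _ ⟨by positivity, hle.trans hs.2⟩)
      linarith [this.1]

/-! ### Uniform convergence of the detection functionals -/

theorem bddAbove_image_abs {X : Type*} {A : Set X} {F : X → ℝ} {M : ℝ} (h : ∀ q, |F q| ≤ M) :
    BddAbove ((fun q => |F q|) '' A) :=
  ⟨M, by rintro _ ⟨q, _, rfl⟩; exact h q⟩

theorem abs_sSup_sub_sSup_le {X : Type*} {A : Set X} (hA : A.Nonempty) {F G : X → ℝ} {η : ℝ}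
    (hF : BddAbove ((fun q => |F q|) '' A)) (hG : BddAbove ((fun q => |G q|) '' A))
    (h : ∀ q ∈ A, |F q - G q| ≤ η) :
    |sSup ((fun q => |F q|) '' A) - sSup ((fun q => |G q|) '' A)| ≤ η := by
  have key : ∀ F G : X → ℝ, BddAbove ((fun q => |G q|) '' A) → (∀ q ∈ A, |F q - G q| ≤ η) →
      sSup ((fun q => |F q|) '' A) ≤ sSup ((fun q => |G q|) '' A) + η := by
    intro F G hG h
    refine csSup_le (hA.image _) ?_
    rintro _ ⟨q, hq, rfl⟩
    have h1 := le_csSup hG (mem_image_of_mem (fun q => |G q|) hq)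
    have h2 := h q hq
    have h3 := abs_sub_abs_le_abs_sub (F q) (G q)
    dsimp only at h1 ⊢
    linarith
  rw [abs_le]
  have h1 := key F G hG h
  have h2 := key G F hF fun q hq => by rw [abs_sub_comm]; exact h q hq
  constructor <;> linarith

theorem continuous_relSup {y : (Fin 3 → unitInterval) → ℝ} (hy : Continuous y) {W : Fin 3 → ℝ}
    (hW : ∀ j, 0 < W j) (τbar θ : Fin 3 → ℝ) {A : Set (Fin 3 → ℝ)} (hA : IsCompact A) :
    Continuous (relSup A (pathFunctional W τbar θ y)) := by
  unfold relSup
  refine hA.continuous_sSup (f := fun s q => |pathFunctional W τbar θ y s q|) ?_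
  have := (continuous_pathFunctional hy hW τbar).comp
    (by fun_prop : Continuous fun p : ℝ × (Fin 3 → ℝ) => (θ, p.1, p.2))
  exact this.abs

theorem isTamePath_discretize (n : Fin 3 → ℕ) (y : (Fin 3 → unitInterval) → ℝ) :
    IsTamePath (discretize n y) :=
  isTamePath_stepPath n _

theorem eventually_abs_relSup_sub_lt {x : SkorohodSpace 3} (hx : Continuous x.1) {W : Fin 3 → ℝ}
    (hW : ∀ j, 0 < W j) {τbar : Fin 3 → ℝ} (hτbar : ∀ j, 0 < τbar j)
    {θ : (Fin 3 → ℕ) → Fin 3 → ℝ} (hθ : Tendsto θ atTop (𝓝 τbar)) {A : Set (Fin 3 → ℝ)}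
    (hA : IsCompact A) (hA' : A.Nonempty) {η : ℝ} (hη : 0 < η) :
    ∀ᶠ p : (Fin 3 → ℕ) × SkorohodSpace 3 in atTop ×ˢ 𝓝 x, ∀ s ∈ Icc (0 : ℝ) 1,
      |relSup A (pathFunctional W τbar (θ p.1) (discretize p.1 p.2.1)) s -
        relSup A (pathFunctional W τbar τbar x.1) s| < η := by
  set R : ℝ := ∑ j, τbar j + 1 with hR
  have hτR : ∀ j, τbar j < R := fun j =>
    (Finset.single_le_sum (f := τbar) (fun j _ => (hτbar j).le) (Finset.mem_univ j)).trans_lt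
      (lt_add_one _)
  have hR0 : 0 ≤ R := (hτbar 0).le.trans (hτR 0).le
  have hθR : ∀ᶠ n in atTop, ∀ j, θ n j ∈ Icc 0 R := by
    refine eventually_all.2 fun j => ?_
    have hj : Tendsto (fun n => θ n j) atTop (𝓝 (τbar j)) :=
      ((continuous_apply j).tendsto _).comp hθ
    filter_upwards [hj.eventually_const_lt (hτbar j), hj.eventually_lt_const (hτR j)] with n h1 h2
      using ⟨h1.le, h2.le⟩
  set K := lipBound W R with hK
  have hK0 : 0 ≤ K := lipBound_nonneg hW hR0
  set e := η / (4 * (K + 1)) with he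
  have he0 : 0 < e := by positivity
  have hKe : K * (2 * e) < η / 2 := by
    calc K * (2 * e) < (K + 1) * (2 * e) := by gcongr; linarith
      _ = η / 2 := by rw [he]; field_simp; ring
  have hPF := continuous_pathFunctional hx hW τbar
  have hunif : ∀ᶠ n in atTop, ∀ z ∈ Icc (0 : ℝ) 1 ×ˢ A,
      |pathFunctional W τbar (θ n) x.1 z.1 z.2 - pathFunctional W τbar τbar x.1 z.1 z.2| < η / 2 := by
    refine hθ.eventually ((isCompact_Icc.prod hA).eventually_forall_of_forall_eventually
      (x₀ := τbar) (P := fun θ' z => |pathFunctional W τbar θ' x.1 z.1 z.2 -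
        pathFunctional W τbar τbar x.1 z.1 z.2| < η / 2) fun z _ => ?_)
    have hc : Continuous fun p : (Fin 3 → ℝ) × ℝ × (Fin 3 → ℝ) =>
        |pathFunctional W τbar p.1 x.1 p.2.1 p.2.2 - pathFunctional W τbar τbar x.1 p.2.1 p.2.2| :=
      (hPF.sub (hPF.comp (by fun_prop : Continuous fun p : (Fin 3 → ℝ) × ℝ × (Fin 3 → ℝ) =>
        (τbar, p.2.1, p.2.2)))).abs
    exact hc.continuousAt.eventually_lt_const (by simpa using half_pos hη)
  have h1 : ∀ᶠ n : Fin 3 → ℕ in atTop, (∀ j, θ n j ∈ Icc 0 R) ∧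
      (∀ t, |discretize n x.1 t - x.1 t| < e) ∧ ∀ z ∈ Icc (0 : ℝ) 1 ×ˢ A,
      |pathFunctional W τbar (θ n) x.1 z.1 z.2 - pathFunctional W τbar τbar x.1 z.1 z.2| < η / 2 :=
    hθR.and ((eventually_abs_discretize_sub_lt hx he0).and hunif)
  filter_upwards [h1.prod_mk (eventually_abs_sub_lt_of_continuous hx he0)] with p hp s hs
  obtain ⟨⟨hp1, hp2, hp3⟩, hp4⟩ := hp
  obtain ⟨M, hM⟩ := (isTamePath_discretize p.1 p.2.1).bounded
  obtain ⟨M', hM'⟩ := exists_bound_of_continuous hx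
  have hd : ∀ t, |discretize p.1 p.2.1 t - x.1 t| ≤ 2 * e := by
    intro t
    have h1 := hp4 (gridPoint p.1 fun j => ⌊(p.1 j : ℝ) * (t j : ℝ)⌋₊)
    have h2 := hp2 t
    have h3 := abs_sub_le (discretize p.1 p.2.1 t) (discretize p.1 x.1 t) (x.1 t)
    simp only [discretize, stepPath] at h1 h2 h3 ⊢
    linarith
  have hbound : ∀ q ∈ A, |pathFunctional W τbar (θ p.1) (discretize p.1 p.2.1) s q -
      pathFunctional W τbar τbar x.1 s q| ≤ K * (2 * e) + η / 2 := by
    intro q hq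
    have h1 := abs_pathFunctional_le hd hW hp1 hs q (τbar := τbar)
    rw [pathFunctional_sub (isTamePath_discretize _ _) (IsTamePath.of_continuous hx) hW] at h1
    have h2 := hp3 (s, q) ⟨hs, hq⟩
    have h3 := abs_sub_le (pathFunctional W τbar (θ p.1) (discretize p.1 p.2.1) s q)
      (pathFunctional W τbar (θ p.1) x.1 s q) (pathFunctional W τbar τbar x.1 s q)
    dsimp only at h2
    linarith
  have := abs_sSup_sub_sSup_le hA'
    (bddAbove_image_abs (A := A) fun q => abs_pathFunctional_le hM hW hp1 hs q (τbar := τbar))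
    (bddAbove_image_abs (A := A) fun q => abs_pathFunctional_le hM' hW
      (fun j => ⟨(hτbar j).le, (hτR j).le⟩) hs q (τbar := τbar)) hbound
  unfold relSup
  refine this.trans_lt ?_
  linarith

/-! ### Measurability of suprema and passage times -/

/-- The supremum is Lipschitz in the finitely many coefficients that occur, since each is multiplied
by a bounded function. -/
theorem continuous_sSup_abs_sum {ι X : Type*} {A : Set X} (hA : A.Nonempty) (I : Finset ι)
    {a : ι → X → ℝ} (ha : ∀ i ∈ I, ∃ K, ∀ q, |a i q| ≤ K) :
    Continuous fun e : ι → ℝ => sSup ((fun q => |∑ i ∈ I, e i * a i q|) '' A) := by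
  have ha' : ∀ i, ∃ K, i ∈ I → ∀ q, |a i q| ≤ K := fun i => by
    by_cases hi : i ∈ I
    · obtain ⟨K, hK⟩ := ha i hi; exact ⟨K, fun _ => hK⟩
    · exact ⟨0, fun h => absurd h hi⟩
  choose K hK using ha'
  have hbound : ∀ e : ι → ℝ, ∀ q, |∑ i ∈ I, e i * a i q| ≤ ∑ i ∈ I, |e i| * K i := by
    intro e q
    refine (Finset.abs_sum_le_sum_abs _ _).trans (Finset.sum_le_sum fun i hi => ?_)
    rw [abs_mul]
    exact mul_le_mul_of_nonneg_left (hK i hi q) (abs_nonneg _)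
  rw [continuous_iff_continuousAt]
  intro e₀
  have hlim : Tendsto (fun e : ι → ℝ => ∑ i ∈ I, |e i - e₀ i| * K i) (𝓝 e₀) (𝓝 0) := by
    have : Continuous fun e : ι → ℝ => ∑ i ∈ I, |e i - e₀ i| * K i := by fun_prop
    simpa using this.tendsto e₀
  refine tendsto_iff_dist_tendsto_zero.2 (squeeze_zero (fun _ => dist_nonneg) (fun e => ?_) hlim)
  rw [Real.dist_eq]
  refine abs_sSup_sub_sSup_le hA (bddAbove_image_abs (hbound e)) (bddAbove_image_abs (hbound e₀))
    fun q _ => ?_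
  rw [← Finset.sum_sub_distrib]
  simp only [← sub_mul]
  exact hbound (fun i => e i - e₀ i) q

theorem aemeasurable_discretePassageTime_div {Ω : Type*} [MeasurableSpace Ω] {P : Measure Ω}
    (s₀ c : ℝ) (m : ℕ) {D : Ω → ℝ → ℝ}
    (hD : ∀ k : ℕ, k ≤ m → AEMeasurable (fun ω => D ω ((k : ℝ) / m)) P) :
    AEMeasurable (fun ω => discretePassageTime s₀ m c (D ω) / ((m : ℝ) : EReal)) P := by
  have h1 : AEMeasurable (fun ω => discretePassageTime s₀ m c (D ω)) P := by
    unfold discretePassageTime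
    simp only [sInf_image]
    refine AEMeasurable.iInf fun k => ?_
    by_cases hk : ⌊(m : ℝ) * s₀⌋₊ ≤ k ∧ k ≤ m
    · classical
      have : (fun ω => ⨅ (_ : k ∈ {k : ℕ | ⌊(m : ℝ) * s₀⌋₊ ≤ k ∧ k ≤ m ∧ c < D ω ((k : ℝ) / m)}),
          ((k : ℝ) : EReal)) =
          (fun x : ℝ => if c < x then ((k : ℝ) : EReal) else ⊤) ∘ fun ω => D ω ((k : ℝ) / m) := by
        ext ω
        simp only [mem_ofPred_eq, hk.1, hk.2, true_and, Function.comp_apply]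
        by_cases h : c < D ω ((k : ℝ) / m) <;> simp [h]
      rw [this]
      refine Measurable.comp_aemeasurable ?_ (hD k hk.2)
      exact Measurable.ite measurableSet_Ioi measurable_const measurable_const
    · have : (fun ω => ⨅ (_ : k ∈ {k : ℕ | ⌊(m : ℝ) * s₀⌋₊ ≤ k ∧ k ≤ m ∧ c < D ω ((k : ℝ) / m)}),
          ((k : ℝ) : EReal)) = fun _ => ⊤ := by
        ext ω
        exact iInf_neg fun h => hk ⟨h.1, h.2.1⟩
      rw [this]
      exact aemeasurable_const
  have h2 : Monotone fun x : EReal => x / ((m : ℝ) : EReal) :=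
    EReal.monotone_div_right_of_nonneg (by exact_mod_cast m.cast_nonneg (α := ℝ))
  exact h2.measurable.comp_aemeasurable h1

theorem aemeasurable_sSup_abs_detectionProcess {Ω : Type*} [MeasurableSpace Ω] {P : Measure Ω}
    (W : Fin 3 → ℝ) (τ : Fin 3 → ℕ → ℝ) (f f₀ : (Fin 3 → ℝ) → ℝ) {ε : (Fin 3 → ℤ) → Ω → ℝ}
    (hε : ∀ i, AEMeasurable (ε i) P) (n : Fin 3 → ℕ) (s : ℝ) {A : Set (Fin 3 → ℝ)}
    (hA : A.Nonempty) :
    AEMeasurable (fun ω => sSup ((fun x => |(detectionProcess W τ f f₀ ε n ω s x)|) '' A)) P := by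
  set I : Finset (Fin 3 → ℕ) := Finset.Icc 1 ![⌊(n 0 : ℝ) * s⌋₊, n 1, n 2] with hI
  have hc := continuous_sSup_abs_sum hA I
    (a := fun l x => kernel W (x - samplingPoint τ n l)) (fun l _ => by
      refine ⟨∏ j, |W j / Real.pi|, fun q => ?_⟩
      unfold kernel
      rw [Finset.abs_prod]
      refine Finset.prod_le_prod (fun _ _ => abs_nonneg _) fun j _ => ?_
      rw [abs_mul]
      exact mul_le_of_le_one_right (abs_nonneg _) (Real.abs_sinc_le_one _))
  have he : AEMeasurable (fun ω (l : Fin 3 → ℕ) => Real.sqrt (∏ j, τ j (n j)) *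
      (observation f ε τ n l ω - f₀ (samplingPoint τ n l))) P := by
    refine aemeasurable_pi_iff.2 fun l => AEMeasurable.const_mul (AEMeasurable.sub_const ?_ _) _
    exact (hε _).const_add _
  refine (hc.measurable.comp_aemeasurable he).congr (Eventually.of_forall fun ω => ?_)
  simp only [Function.comp_apply, detectionProcess, ← hI, Finset.mul_sum, mul_assoc]

/-- The supremum of the path functional of a step path depends continuously on the values at the
grid points. -/
theorem continuous_sSup_pathFunctional_stepPath {W : Fin 3 → ℝ} (hW : ∀ j, 0 < W j)
    (τbar : Fin 3 → ℝ) {θ : Fin 3 → ℝ} (hθ : ∀ j, 0 ≤ θ j) (n : Fin 3 → ℕ)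
    {K : Set (ℝ × (Fin 3 → ℝ))} (hK : K.Nonempty) (hK1 : ∀ z ∈ K, z.1 ∈ Icc (0 : ℝ) 1) :
    Continuous fun e : (Fin 3 → ℕ) → ℝ =>
      sSup ((fun z => |pathFunctional W τbar θ (stepPath n e) z.1 z.2|) '' K) := by
  classical
  set R := ∑ j, θ j
  have hR : ∀ j, θ j ∈ Icc 0 R := fun j =>
    ⟨hθ j, Finset.single_le_sum (f := θ) (fun j _ => hθ j) (Finset.mem_univ j)⟩
  have hc := continuous_sSup_abs_sum (X := K) (A := univ) ⟨⟨_, hK.some_mem⟩, mem_univ _⟩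
    (Finset.Icc 0 n)
    (a := fun i z => pathFunctional W τbar θ (stepPath n (Pi.single i 1)) z.1.1 z.1.2) (fun i _ => by
      obtain ⟨M, hM⟩ := (isTamePath_stepPath n (Pi.single i 1)).bounded
      exact ⟨lipBound W R * M, fun z => abs_pathFunctional_le hM hW hR (hK1 z.1 z.2) _⟩)
  convert hc using 3 with e
  ext x
  simp only [mem_image, mem_univ, true_and, Subtype.exists, ← pathFunctional_stepPath hW]
  exact ⟨fun ⟨z, hz, h⟩ => ⟨z, hz, h⟩, fun ⟨z, hz, h⟩ => ⟨z, hz, h⟩⟩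

theorem aemeasurable_relSup_discretize {Ω : Type*} [MeasurableSpace Ω] {P : Measure Ω}
    {W : Fin 3 → ℝ} (hW : ∀ j, 0 < W j)
    (τbar : Fin 3 → ℝ) {θ : Fin 3 → ℝ} (hθ : ∀ j, 0 ≤ θ j) (n : Fin 3 → ℕ)
    {A : Set (Fin 3 → ℝ)} (hA : A.Nonempty) {s : ℝ} (hs : s ∈ Icc (0 : ℝ) 1)
    {y : Ω → (Fin 3 → unitInterval) → ℝ}
    (hy : ∀ i, AEMeasurable (fun ω => y ω (gridPoint n i)) P) :
    AEMeasurable (fun ω => relSup A (pathFunctional W τbar θ (discretize n (y ω))) s) P := by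
  have hc := continuous_sSup_pathFunctional_stepPath hW τbar hθ n (K := {s} ×ˢ A)
    ((singleton_nonempty s).prod hA) (fun z hz => by
      rw [show z.1 = s from hz.1]; exact hs)
  have he : AEMeasurable (fun ω (i : Fin 3 → ℕ) => y ω (gridPoint n i)) P :=
    aemeasurable_pi_iff.2 hy
  refine (hc.measurable.comp_aemeasurable he).congr (Eventually.of_forall fun ω => ?_)
  simp only [Function.comp_apply, relSup, discretize, singleton_prod, image_image]

/-! ### Brownian motion on a grid -/

/-- The increments over the unit cells of a grid add up to the increment over the box. -/
theorem sum_piFinset_range_increment {ι : Type*} [Fintype ι] [DecidableEq ι] (F : (ι → ℕ) → ℝ)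
    (k : ι → ℕ) :
    ∑ i ∈ Fintype.piFinset fun j => Finset.range (k j),
      ∑ v : Finset ι, (-1 : ℝ) ^ v.card * F (v.piecewise i (i + 1)) =
    ∑ v : Finset ι, (-1 : ℝ) ^ v.card * F (v.piecewise 0 k) := by
  set box : Finset (ι → ℕ) := Fintype.piFinset fun j => Finset.range (k j + 1)
  set δ : ℕ → ℕ → ℝ := fun m x => if x = m then 1 else 0
  -- Both sides are linear in F, so F may be expanded in products of one-dimensional indicators; for
  -- these the increments factor and telescope in each coordinate.
  have hF : ∀ x ∈ box, F x = ∑ m ∈ box, F m * ∏ j, δ (m j) (x j) := by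
    intro x hx
    rw [Finset.sum_eq_single_of_mem x hx]
    · simp [δ]
    · intro m _ hm
      obtain ⟨j, hj⟩ := Function.ne_iff.1 hm
      rw [Finset.prod_eq_zero (Finset.mem_univ j), mul_zero]
      exact if_neg hj.symm
  have hlin : ∀ a b : ι → ℕ, a ∈ box → b ∈ box →
      ∑ v : Finset ι, (-1 : ℝ) ^ v.card * F (v.piecewise a b) =
        ∑ m ∈ box, F m * ∏ j, (δ (m j) (b j) - δ (m j) (a j)) := by
    intro a b ha hb
    have hab : ∀ v : Finset ι, v.piecewise a b ∈ box := fun v => Fintype.mem_piFinset.2 fun j => by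
      by_cases hj : j ∈ v
      · rw [Finset.piecewise_eq_of_mem _ _ _ hj]; exact Fintype.mem_piFinset.1 ha j
      · rw [Finset.piecewise_eq_of_notMem _ _ _ hj]; exact Fintype.mem_piFinset.1 hb j
    rw [Finset.sum_congr rfl fun v _ => by rw [hF _ (hab v), Finset.mul_sum], Finset.sum_comm]
    refine Finset.sum_congr rfl fun m _ => ?_
    rw [← sum_neg_one_pow_mul_prod_piecewise (fun j => δ (m j)) a b, Finset.mul_sum]
    exact Finset.sum_congr rfl fun v _ => by ring
  have hmem : ∀ i ∈ Fintype.piFinset fun j => Finset.range (k j), i ∈ box ∧ i + 1 ∈ box := by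
    intro i hi
    constructor <;> refine Fintype.mem_piFinset.2 fun j => ?_
    · have := Finset.mem_range.1 (Fintype.mem_piFinset.1 hi j)
      exact Finset.mem_range.2 (by omega)
    · have := Finset.mem_range.1 (Fintype.mem_piFinset.1 hi j)
      exact Finset.mem_range.2 (by simp only [Pi.add_apply, Pi.one_apply]; omega)
  rw [Finset.sum_congr rfl fun i hi => hlin i (i + 1) (hmem i hi).1 (hmem i hi).2,
    hlin 0 k (Fintype.mem_piFinset.2 fun j => by simp) (Fintype.mem_piFinset.2 fun j => by simp),
    Finset.sum_comm]
  refine Finset.sum_congr rfl fun m _ => ?_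
  rw [← Finset.mul_sum]
  congr 1
  have := Finset.prod_univ_sum (fun j => Finset.range (k j))
    (fun j x => δ (m j) (x + 1) - δ (m j) x)
  simp only [Pi.add_apply, Pi.one_apply]
  rw [← this]
  exact Finset.prod_congr rfl fun j _ => by rw [Finset.sum_range_sub]; rfl

theorem altSum_zero_left {ι : Type*} [Fintype ι] [DecidableEq ι] {f : (ι → ℝ) → ℝ} {t : ι → ℝ}
    (ht : t ∈ Icc 0 1) (h0 : ∀ x ∈ Icc (0 : ι → ℝ) 1, (∃ j, x j = 0) → f x = 0) :
    altSum f 0 t = f t := by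
  unfold altSum
  rw [Finset.sum_eq_single_of_mem ∅ (Finset.mem_univ _)]
  · simp
  · intro v _ hv
    obtain ⟨j, hj⟩ := Finset.nonempty_iff_ne_empty.2 hv
    rw [h0, mul_zero]
    · constructor
      · intro i
        by_cases hi : i ∈ v
        · simp [hi]
        · simpa [hi] using ht.1 i
      · intro i
        by_cases hi : i ∈ v
        · simp [hi]
        · simpa [hi] using ht.2 i
    · exact ⟨j, by simp [hj]⟩

theorem covariance_congr_of_ae_eq {Ω : Type*} [MeasurableSpace Ω] {P : Measure Ω} {X X' Y Y' : Ω → ℝ}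
    (hX : X =ᵐ[P] X') (hY : Y =ᵐ[P] Y') : cov[X, Y; P] = cov[X', Y'; P] := by
  unfold covariance
  rw [integral_congr_ae hX, integral_congr_ae hY]
  refine integral_congr_ae ?_
  filter_upwards [hX, hY] with ω h1 h2
  rw [h1, h2]

/-- The residuals of the regression of a Gaussian process on one of its values are independent of
that value. -/
theorem ProbabilityTheory.IsGaussianProcess.indepFun_sub_const_mul {Ω T : Type*}
    [MeasurableSpace Ω] {P : Measure Ω} [IsProbabilityMeasure P] {X : T → Ω → ℝ}
    (hX : IsGaussianProcess X P) (t₀ : T) (κ : T → ℝ)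
    (hκ : ∀ t, cov[X t₀, X t; P] = κ t * Var[X t₀; P]) :
    IndepFun (X t₀) (fun ω t => X t ω - κ t * X t₀ ω) P := by
  have hm := hX.aemeasurable
  have hL2 : ∀ t, MemLp (X t) 2 P := fun t => (hX.hasGaussianLaw_eval t).memLp_two
  have hproc : IsGaussianProcess
      (Sum.elim (fun _ : Unit => X t₀) fun t ω => X t ω - κ t * X t₀ ω) P := by
    classical
    refine hX.of_isGaussianProcess fun s => ?_
    rcases s with _ | t
    · exact ⟨{t₀}, ContinuousLinearMap.proj (R := ℝ) (φ := fun _ : ({t₀} : Finset T) => ℝ)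
        ⟨t₀, Finset.mem_singleton_self _⟩, fun ω => rfl⟩
    · exact ⟨{t₀, t}, ContinuousLinearMap.proj (R := ℝ) (φ := fun _ : ({t₀, t} : Finset T) => ℝ)
        ⟨t, by simp⟩ - κ t • ContinuousLinearMap.proj (R := ℝ)
          (φ := fun _ : ({t₀, t} : Finset T) => ℝ) ⟨t₀, by simp⟩, fun ω => rfl⟩
  have hind := hproc.indepFun_of_covariance_eq_zero (fun _ => hm t₀)
    (fun t => (hm t).sub ((hm t₀).const_mul _)) fun _ t => by
      rw [covariance_fun_sub_right (hL2 t₀) (hL2 t) ((hL2 t₀).const_mul _),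
        covariance_const_mul_right, covariance_self (hm t₀), hκ, sub_self]
  exact hind.comp (φ := fun x : Unit → ℝ => x ()) (ψ := id) (measurable_pi_apply _) measurable_id

/-- The increment of `B` over the cell `∏ j, (i j / M, (i j + 1) / M]`. -/
def cellIncrement {Ω : Type*} (B : (Fin 3 → ℝ) → Ω → ℝ) (M : ℕ) (i : Fin 3 → ℕ) (ω : Ω) : ℝ :=
  altSum (fun x => B x ω) (fun j => (i j : ℝ) / M) (fun j => ((i j : ℝ) + 1) / M)

/-- The cells of the regular grid with mesh `1 / M`. -/
def gridCells (M : ℕ) : Finset (Fin 3 → ℕ) := Fintype.piFinset fun _ => Finset.range M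

section
variable {Ω : Type*} [MeasurableSpace Ω] {P : Measure Ω}
  {B : (Fin 3 → ℝ) → Ω → ℝ}

/-- As B vanishes on the faces, its value at a grid point is its increment over the box from the
origin, hence a sum of independent cell increments. -/
theorem IsBrownianMotion.ae_eq_sum_cellIncrement (hB : IsBrownianMotion B P) {M : ℕ} (hM : 0 < M)
    {k : Fin 3 → ℕ} (hk : ∀ j, k j ≤ M) :
    ∀ᵐ ω ∂P, B (fun j => (k j : ℝ) / M) ω =
      ∑ i ∈ Fintype.piFinset fun j => Finset.range (k j), cellIncrement B M i ω := by
  have hM' : (0 : ℝ) < M := by exact_mod_cast hM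
  filter_upwards [hB.zero_faces] with ω h0
  have h1 := sum_piFinset_range_increment (fun m => B (fun j => (m j : ℝ) / M) ω) k
  have hpw : ∀ (v : Finset (Fin 3)) (a b : Fin 3 → ℕ), (fun j => ((v.piecewise a b j : ℕ) : ℝ) / M)
      = v.piecewise (fun j => (a j : ℝ) / M) fun j => (b j : ℝ) / M := by
    intro v a b
    ext j
    by_cases hj : j ∈ v <;> simp [hj]
  simp only [hpw] at h1
  have h2 : altSum (fun x => B x ω) 0 (fun j => (k j : ℝ) / M) = B (fun j => (k j : ℝ) / M) ω := by
    refine altSum_zero_left ⟨fun j => by simp only [Pi.zero_apply]; positivity, fun j => ?_⟩ h0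
    exact (div_le_one hM').2 (by exact_mod_cast hk j)
  have hz : (fun j : Fin 3 => (((0 : Fin 3 → ℕ) j : ℕ) : ℝ) / M) = 0 := by ext; simp
  rw [hz] at h1
  unfold altSum at h2
  rw [← h2, ← h1]
  refine Finset.sum_congr rfl fun i _ => ?_
  unfold cellIncrement altSum
  simp only [Pi.add_apply, Pi.one_apply, Nat.cast_add, Nat.cast_one]

theorem cell_bounds {M : ℕ} {i : Fin 3 → ℕ} (hi : i ∈ gridCells M) :
    0 ≤ (fun j => (i j : ℝ) / M) ∧ (fun j => (i j : ℝ) / M) ≤ (fun j => ((i j : ℝ) + 1) / M) ∧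
      (fun j => ((i j : ℝ) + 1) / M) ≤ 1 := by
  refine ⟨fun j => by simp only [Pi.zero_apply]; positivity, fun j => ?_, fun j => ?_⟩
  · dsimp only; gcongr; linarith
  · have h := Finset.mem_range.1 (Fintype.mem_piFinset.1 hi j)
    have hM : (0 : ℝ) < M := by exact_mod_cast (Nat.zero_le _).trans_lt h
    exact (div_le_one hM).2 (by exact_mod_cast h)

theorem disjoint_cells {M : ℕ} {i i' : Fin 3 → ℕ} (hi : i ∈ gridCells M) (h : i ≠ i') :
    Disjoint (univ.pi fun j => Ioc ((i j : ℝ) / M) (((i j : ℝ) + 1) / M))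
      (univ.pi fun j => Ioc ((i' j : ℝ) / M) (((i' j : ℝ) + 1) / M)) := by
  obtain ⟨j, hj⟩ := Function.ne_iff.1 h
  refine disjoint_univ_pi.2 ⟨j, ?_⟩
  have hM : (0 : ℝ) < M := by
    exact_mod_cast (Nat.zero_le _).trans_lt (Finset.mem_range.1 (Fintype.mem_piFinset.1 hi j))
  rw [Set.disjoint_left]
  rintro x ⟨h1, h2⟩ ⟨h3, h4⟩
  rw [div_lt_iff₀ hM] at h1 h3
  rw [le_div_iff₀ hM] at h2 h4
  have h5 : i j < i' j + 1 := by exact_mod_cast h1.trans_le h4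
  have h6 : i' j < i j + 1 := by exact_mod_cast h3.trans_le h2
  omega

theorem IsBrownianMotion.hasGaussianLaw_altSum (hB : IsBrownianMotion B P) {s t : Fin 3 → ℝ}
    (h0 : 0 ≤ s) (hst : s ≤ t) (h1 : t ≤ 1) :
    HasGaussianLaw (fun ω => altSum (fun x => B x ω) s t) P :=
  (hB.law s t h0 hst h1).hasGaussianLaw

theorem IsBrownianMotion.iIndepFun_cellIncrement (hB : IsBrownianMotion B P) (M : ℕ) :
    iIndepFun (fun (i : gridCells M) => cellIncrement B M i) P := by
  set e := Fintype.equivFin (gridCells M)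
  have := hB.indep _ (fun m j => ((e.symm m).1 j : ℝ) / M)
    (fun m j => (((e.symm m).1 j : ℝ) + 1) / M) (fun m => cell_bounds (e.symm m).2)
    (fun m m' hmm' => disjoint_cells (e.symm m).2
      fun h => hmm' (e.symm.injective (Subtype.ext h)))
  have h2 := this.precomp e.injective
  simp only [e.symm_apply_apply] at h2
  exact h2

theorem IsBrownianMotion.hasGaussianLaw_cellIncrement (hB : IsBrownianMotion B P) (M : ℕ) :
    HasGaussianLaw (fun ω (i : gridCells M) => cellIncrement B M i ω) P :=
  (hB.iIndepFun_cellIncrement M).hasGaussianLaw fun i =>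
    have := cell_bounds i.2
    hB.hasGaussianLaw_altSum this.1 this.2.1 this.2.2

theorem gridPoint_const (N : ℕ) (i : Fin 3 → ℕ) :
    (fun j => (gridPoint (fun _ => N + 1) i j : ℝ)) =
      fun j => (min (i j) (N + 1) : ℕ) / ((N + 1 : ℕ) : ℝ) := by
  ext j
  have hN : (0 : ℝ) < ((N + 1 : ℕ) : ℝ) := by positivity
  unfold gridPoint
  rw [coe_projIcc, max_eq_right (le_min zero_le_one (by positivity)), Nat.cast_min, min_comm,
    ← min_div_div_right hN.le, div_self hN.ne']

/-- The Brownian motion at the points of all regular grids. -/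
def gridValue {Ω : Type*} (B : (Fin 3 → ℝ) → Ω → ℝ) (t : ℕ × (Fin 3 → ℕ)) (ω : Ω) : ℝ :=
  B (fun j => (gridPoint (fun _ => t.1 + 1) t.2 j : ℝ)) ω

/-- The product of the finitely many mesh numbers gives a common refinement. -/
theorem exists_common_grid (I : Finset (ℕ × (Fin 3 → ℕ))) :
    ∃ M : ℕ, 0 < M ∧ ∃ k : ℕ × (Fin 3 → ℕ) → Fin 3 → ℕ, (∀ t j, t ∈ I → k t j ≤ M) ∧
      ∀ t ∈ I, (fun j => (gridPoint (fun _ => t.1 + 1) t.2 j : ℝ)) =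
        fun j => (k t j : ℝ) / (M : ℝ) := by
  refine ⟨∏ t ∈ I, (t.1 + 1), Finset.prod_pos fun t _ => Nat.succ_pos _,
    fun t j => min (t.2 j) (t.1 + 1) * ((∏ t ∈ I, (t.1 + 1)) / (t.1 + 1)), fun t j ht => ?_,
    fun t ht => ?_⟩
  · have hd : (t.1 + 1) ∣ ∏ t ∈ I, (t.1 + 1) := Finset.dvd_prod_of_mem (fun t => t.1 + 1) ht
    calc _ ≤ (t.1 + 1) * ((∏ t ∈ I, (t.1 + 1)) / (t.1 + 1)) :=
          Nat.mul_le_mul_right _ (min_le_right _ _)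
      _ = _ := Nat.mul_div_cancel' hd
  · rw [gridPoint_const]
    obtain ⟨c, hc⟩ : (t.1 + 1) ∣ ∏ t ∈ I, (t.1 + 1) :=
      Finset.dvd_prod_of_mem (fun t => t.1 + 1) ht
    have hpos : 0 < ∏ t ∈ I, (t.1 + 1) := Finset.prod_pos fun t _ => Nat.succ_pos _
    have hc0 : c ≠ 0 := by rintro rfl; simp [hc] at hpos
    ext j
    dsimp only
    rw [hc, Nat.mul_div_cancel_left _ (by omega : 0 < t.1 + 1)]
    have hc0' : (c : ℝ) ≠ 0 := by exact_mod_cast hc0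
    have : ((t.1 + 1 : ℕ) : ℝ) ≠ 0 := by positivity
    rw [Nat.cast_mul, Nat.cast_mul, mul_div_mul_right _ _ hc0']

theorem sum_gridCells_ite {M : ℕ} {k : Fin 3 → ℕ} (hk : ∀ j, k j ≤ M) (D : (Fin 3 → ℕ) → ℝ) :
    ∑ i : gridCells M, (if i.1 ∈ Fintype.piFinset fun j => Finset.range (k j) then (1 : ℝ) else 0) *
      D i = ∑ i ∈ Fintype.piFinset fun j => Finset.range (k j), D i := by
  rw [Finset.sum_coe_sort (gridCells M) fun i =>
    (if i ∈ Fintype.piFinset fun j => Finset.range (k j) then (1 : ℝ) else 0) * D i]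
  have hsub : (Fintype.piFinset fun j => Finset.range (k j)) ⊆ gridCells M :=
    Fintype.piFinset_subset _ _ fun j => Finset.range_subset_range.2 (hk j)
  rw [← Finset.sum_subset hsub fun i _ hi => by rw [if_neg hi, zero_mul]]
  exact Finset.sum_congr rfl fun i hi => by rw [if_pos hi, one_mul]

/-- Finitely many grid values are a linear image of the Gaussian vector of cell increments on a
common refinement. -/
theorem IsBrownianMotion.isGaussianProcess_gridValue (hB : IsBrownianMotion B P) :
    IsGaussianProcess (gridValue B) P where
  hasGaussianLaw I := by
    obtain ⟨M, hM, k, hk, hgrid⟩ := exists_common_grid I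
    have hG := (hB.hasGaussianLaw_cellIncrement M).map
      (ContinuousLinearMap.pi fun t : I => ∑ i : gridCells M,
        (if i.1 ∈ Fintype.piFinset fun j => Finset.range (k t j) then (1 : ℝ) else 0) •
          (ContinuousLinearMap.proj i : (gridCells M → ℝ) →L[ℝ] ℝ))
    refine hG.congr ?_
    have hae : ∀ᵐ ω ∂P, ∀ t : I, gridValue B t ω =
        ∑ i ∈ Fintype.piFinset fun j => Finset.range (k t j), cellIncrement B M i ω := by
      refine ae_all_iff.2 fun t => ?_
      unfold gridValue
      rw [hgrid t t.2]
      exact hB.ae_eq_sum_cellIncrement hM fun j => hk t j t.2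
    filter_upwards [hae] with ω hω
    ext t
    simp only [Function.comp_apply, ContinuousLinearMap.coe_pi', _root_.sum_apply,
      _root_.smul_apply, ContinuousLinearMap.proj_apply, smul_eq_mul,
      Finset.restrict]
    rw [hω t]
    exact sum_gridCells_ite (fun j => hk t j t.2) fun i => cellIncrement B M i ω

theorem IsBrownianMotion.ae_eq_altSum (hB : IsBrownianMotion B P) {t : Fin 3 → ℝ}
    (ht : t ∈ Icc 0 1) : (fun ω => altSum (fun x => B x ω) 0 t) =ᵐ[P] B t := by
  filter_upwards [hB.zero_faces] with ω h0
  exact altSum_zero_left ht h0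

theorem IsBrownianMotion.aemeasurable (hB : IsBrownianMotion B P) {t : Fin 3 → ℝ}
    (ht : t ∈ Icc 0 1) : AEMeasurable (B t) P :=
  (hB.law 0 t le_rfl ht.1 ht.2).aemeasurable.congr (hB.ae_eq_altSum ht)

theorem IsBrownianMotion.variance_eq (hB : IsBrownianMotion B P) {t : Fin 3 → ℝ}
    (ht : t ∈ Icc 0 1) : Var[B t; P] = ∏ j, t j := by
  have hlaw := hB.law 0 t le_rfl ht.1 ht.2
  rw [← variance_congr (hB.ae_eq_altSum ht), hlaw.variance_eq, variance_id_gaussianReal]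
  rw [Real.volume_pi_Ioc, ENNReal.coe_toNNReal_eq_toReal, ENNReal.toReal_prod]
  refine Finset.prod_congr rfl fun j _ => ?_
  simpa using ht.1 j

/-- In the double sum over cells only the shared ones contribute. The corner value contains all
cells, so the covariance is the variance of the grid value. -/
theorem IsBrownianMotion.covariance_one_gridValue [IsProbabilityMeasure P]
    (hB : IsBrownianMotion B P) (t : ℕ × (Fin 3 → ℕ)) :
    cov[B 1, gridValue B t; P] = ∏ j, (gridPoint (fun _ => t.1 + 1) t.2 j : ℝ) := by
  obtain ⟨M, hM, k, hk, hgrid⟩ := exists_common_grid {t}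
  have hkt : ∀ j, k t j ≤ M := fun j => hk t j (Finset.mem_singleton_self t)
  have hmem : (fun j => (gridPoint (fun _ => t.1 + 1) t.2 j : ℝ)) ∈ Icc (0 : Fin 3 → ℝ) 1 :=
    ⟨fun j => (gridPoint _ _ j).2.1, fun j => (gridPoint _ _ j).2.2⟩
  have h1 : B 1 =ᵐ[P] fun ω => ∑ i ∈ gridCells M, cellIncrement B M i ω := by
    have := hB.ae_eq_sum_cellIncrement hM (k := fun _ => M) fun _ => le_rfl
    have hM' : (M : ℝ) ≠ 0 := by exact_mod_cast hM.ne'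
    rw [show (fun _ : Fin 3 => (M : ℝ) / M) = 1 from funext fun _ => div_self hM'] at this
    exact this
  have h2 : gridValue B t =ᵐ[P] fun ω =>
      ∑ i ∈ Fintype.piFinset fun j => Finset.range (k t j), cellIncrement B M i ω := by
    have := hB.ae_eq_sum_cellIncrement hM hkt
    rwa [← hgrid t (Finset.mem_singleton_self t)] at this
  have hsub : (Fintype.piFinset fun j => Finset.range (k t j)) ⊆ gridCells M :=
    Fintype.piFinset_subset _ _ fun j => Finset.range_subset_range.2 (hkt j)
  have hL2 : ∀ i ∈ gridCells M, MemLp (cellIncrement B M i) 2 P := fun i hi =>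
    have := cell_bounds hi
    (hB.hasGaussianLaw_altSum this.1 this.2.1 this.2.2).memLp_two
  have hcov : ∀ i ∈ gridCells M, ∀ i' ∈ gridCells M, i ≠ i' →
      cov[cellIncrement B M i, cellIncrement B M i'; P] = 0 := by
    intro i hi i' hi' hne
    have := (hB.iIndepFun_cellIncrement M).indepFun (i := ⟨i, hi⟩) (j := ⟨i', hi'⟩)
      fun h => hne (congrArg Subtype.val h)
    exact this.covariance_eq_zero (hL2 i hi) (hL2 i' hi')
  have hvar := hB.variance_eq hmem
  change Var[gridValue B t; P] = _ at hvar
  have hm : AEMeasurable (gridValue B t) P := hB.aemeasurable hmem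
  rw [← hvar, ← covariance_self hm, covariance_congr_of_ae_eq h1 h2, covariance_congr_of_ae_eq h2 h2,
    covariance_fun_sum_fun_sum' hL2 fun i hi => hL2 i (hsub hi),
    covariance_fun_sum_fun_sum' (fun i hi => hL2 i (hsub hi)) fun i hi => hL2 i (hsub hi)]
  refine (Finset.sum_subset hsub fun i hi hni => Finset.sum_eq_zero fun i' hi' => ?_).symm
  exact hcov i hi i' (hsub hi') fun h => hni (h ▸ hi')

/-- The Brownian motion tied down at the corner `(1, 1, 1)` by a multiple of the volume function. -/
def tiedValue {Ω : Type*} (B : (Fin 3 → ℝ) → Ω → ℝ) (t : ℕ × (Fin 3 → ℕ)) (ω : Ω) : ℝ :=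
  gridValue B t ω - (∏ j, (gridPoint (fun _ => t.1 + 1) t.2 j : ℝ)) * B 1 ω

theorem gridValue_zero_one {Ω : Type*} (B : (Fin 3 → ℝ) → Ω → ℝ) : gridValue B (0, 1) = B 1 := by
  ext ω
  unfold gridValue
  congr 1
  rw [gridPoint_const]
  ext j; simp

/-- Since B at the corner has variance 1, the volume is the regression coefficient, and the
tied-down values are regression residuals. The index (0, 1) encodes the corner. -/
theorem IsBrownianMotion.indepFun_one_tiedValue [IsProbabilityMeasure P]
    (hB : IsBrownianMotion B P) : IndepFun (B 1) (fun ω t => tiedValue B t ω) P := by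
  have h1mem : (1 : Fin 3 → ℝ) ∈ Icc 0 1 := ⟨zero_le_one, le_rfl⟩
  have h := hB.isGaussianProcess_gridValue.indepFun_sub_const_mul (0, 1)
    (fun t => ∏ j, (gridPoint (fun _ => t.1 + 1) t.2 j : ℝ)) fun t => by
      rw [gridValue_zero_one, hB.variance_eq h1mem, hB.covariance_one_gridValue]
      simp
  rw [gridValue_zero_one] at h
  exact h

theorem IsBrownianMotion.measure_one_mem_eq_zero (hB : IsBrownianMotion B P) {S : Set ℝ}
    (hS : S.Finite) : P.map (B 1) S = 0 := by
  have h1mem : (1 : Fin 3 → ℝ) ∈ Icc 0 1 := ⟨zero_le_one, le_rfl⟩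
  have hlaw := hB.law 0 1 le_rfl zero_le_one le_rfl
  rw [← Measure.map_congr (hB.ae_eq_altSum h1mem), hlaw.map_eq]
  have hv : (volume (univ.pi fun j : Fin 3 => Ioc ((0 : Fin 3 → ℝ) j) ((1 : Fin 3 → ℝ) j))).toNNReal
      = 1 := by
    rw [Real.volume_pi_Ioc]; simp
  rw [hv]
  have := nullSingletonClass_gaussianReal (μ := 0) (v := 1) one_ne_zero
  exact hS.measure_zero _

end

/-! ### The supremum of the limit has no atoms -/

/-- Suppose the value c were taken at a₀ < a₁ < a₂, and let z be a maximizer for a₁. Moving a away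
from a₁ in one of the two directions strictly increases |G(z) + a h(z)|, since the slope is not
zero, so the supremum exceeds c at a₀ or a₂. -/
theorem finite_setOf_sSup_abs_affine_eq {X : Type*} [TopologicalSpace X] {K : Set X}
    (hK : IsCompact K) (hK' : K.Nonempty) {G h : X → ℝ} (hG : ContinuousOn G K)
    (hh : ContinuousOn h K) (h0 : ∀ z ∈ K, h z ≠ 0) (c : ℝ) :
    {a : ℝ | sSup ((fun z => |G z + a * h z|) '' K) = c}.Finite := by
  by_contra hinf
  obtain ⟨T, hTS, hT⟩ := Set.Infinite.exists_subset_card_eq hinf 3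
  have hmem : ∀ i, T.orderEmbOfFin hT i ∈ {a : ℝ | sSup ((fun z => |G z + a * h z|) '' K) = c} :=
    fun i => hTS (T.orderEmbOfFin_mem hT i)
  have h01 : T.orderEmbOfFin hT 0 < T.orderEmbOfFin hT 1 :=
    (T.orderEmbOfFin hT).strictMono (by decide)
  have h12 : T.orderEmbOfFin hT 1 < T.orderEmbOfFin hT 2 :=
    (T.orderEmbOfFin hT).strictMono (by decide)
  have hc : ∀ a : ℝ, ContinuousOn (fun z => |G z + a * h z|) K := fun a =>
    (hG.add (continuousOn_const.mul hh)).abs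
  obtain ⟨z, hz, hmax⟩ := hK.exists_sSup_image_eq hK' (hc (T.orderEmbOfFin hT 1))
  have hle : ∀ i, |G z + T.orderEmbOfFin hT i * h z| ≤ c := fun i => by
    rw [← hmem i]
    exact le_csSup (hK.image_of_continuousOn (hc _)).bddAbove (mem_image_of_mem _ hz)
  have heq : |G z + T.orderEmbOfFin hT 1 * h z| = c := hmax.symm.trans (hmem 1)
  have hl0 := abs_le.1 (hle 0)
  have hl2 := abs_le.1 (hle 2)
  generalize T.orderEmbOfFin hT 0 = a₀ at *
  generalize T.orderEmbOfFin hT 1 = a₁ at *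
  generalize T.orderEmbOfFin hT 2 = a₂ at *
  refine h0 z hz ?_
  rcases abs_choice (G z + a₁ * h z) with h1 | h1 <;> rw [h1] at heq <;>
    refine le_antisymm (not_lt.1 fun hlt => ?_) (not_lt.1 fun hlt => ?_)
  · nlinarith [mul_pos hlt (sub_pos.2 h12)]
  · nlinarith [mul_pos (neg_pos.2 hlt) (sub_pos.2 h01)]
  · nlinarith [mul_pos hlt (sub_pos.2 h01)]
  · nlinarith [mul_pos (neg_pos.2 hlt) (sub_pos.2 h12)]

theorem sSup_image_relSup {A : Set (Fin 3 → ℝ)} (hA : A.Nonempty) {I : Set ℝ} (hI : I.Nonempty)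
    {F : ℝ → (Fin 3 → ℝ) → ℝ} (hb : BddAbove ((fun z : ℝ × (Fin 3 → ℝ) => |F z.1 z.2|) '' I ×ˢ A)) :
    sSup (relSup A F '' I) = sSup ((fun z : ℝ × (Fin 3 → ℝ) => |F z.1 z.2|) '' I ×ˢ A) := by
  obtain ⟨M, hM⟩ := hb
  have hM' : ∀ s ∈ I, ∀ q ∈ A, |F s q| ≤ M := fun s hs q hq =>
    hM (mem_image_of_mem (fun z : ℝ × (Fin 3 → ℝ) => |F z.1 z.2|) (mk_mem_prod hs hq))
  have hbs : ∀ s ∈ I, BddAbove ((fun q => |F s q|) '' A) := fun s hs =>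
    ⟨M, by rintro _ ⟨q, hq, rfl⟩; exact hM' s hs q hq⟩
  have hrel : ∀ s ∈ I, relSup A F s ≤ M := fun s hs =>
    csSup_le (hA.image _) (by rintro _ ⟨q, hq, rfl⟩; exact hM' s hs q hq)
  apply le_antisymm
  · refine csSup_le (hI.image _) ?_
    rintro _ ⟨s, hs, rfl⟩
    refine csSup_le (hA.image _) ?_
    rintro _ ⟨q, hq, rfl⟩
    exact le_csSup ⟨M, hM⟩
      (mem_image_of_mem (fun z : ℝ × (Fin 3 → ℝ) => |F z.1 z.2|) (mk_mem_prod hs hq))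
  · refine csSup_le ((hI.prod hA).image _) ?_
    rintro _ ⟨z, hz, rfl⟩
    exact (le_csSup (hbs z.1 hz.1) (mem_image_of_mem (fun q => |F z.1 q|) hz.2)).trans
      (le_csSup ⟨M, by rintro _ ⟨s, hs, rfl⟩; exact hrel s hs⟩ (mem_image_of_mem _ hz.1))

/-- The volume of the box between the origin and `v`. -/
def boxVolume (v : Fin 3 → unitInterval) : ℝ := ∏ j, (v j : ℝ)

@[fun_prop]
theorem continuous_boxVolume : Continuous boxVolume := by
  unfold boxVolume; fun_prop

/-- The volume function is a product of identity paths, so the integral factors and each factor is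
an ordinary integral of the kernel. -/
theorem pathIntegral_boxVolume (W ϑ x : Fin 3 → ℝ) {s : ℝ} (hs : s ∈ Icc (0 : ℝ) 1) :
    pathIntegral W boxVolume (boxCorner s) ϑ x =
      ∏ j, (boxCorner s j * ∫ u in (0 : ℝ)..1, kernelFactor (W j) (ϑ j) (x j) u) := by
  have hb : ∀ j, boxCorner s j ∈ Icc (0 : ℝ) 1 := fun j => by
    fin_cases j <;> simp [boxCorner, hs.1, hs.2]
  have hae : ∀ᵐ u ∂(Measure.pi fun _ : Fin 3 => endpointMeasure), ∀ j, u j ∈ Icc (0 : ℝ) 1 :=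
    ae_all_iff.2 fun j =>
      (Measure.quasiMeasurePreserving_eval (fun _ : Fin 3 => endpointMeasure) j).ae
        ae_mem_Icc_endpointMeasure
  have h1 : pathIntegral W boxVolume (boxCorner s) ϑ x = ∫ u : Fin 3 → ℝ,
      ∏ j, (boxCorner s j * (u j * byPartsDensity (W j) (ϑ j) (x j) (u j)))
        ∂Measure.pi fun _ => endpointMeasure := by
    refine integral_congr_ae ?_
    filter_upwards [hae] with u hu
    rw [extendPath, boxVolume, ← Finset.prod_mul_distrib]
    refine Finset.prod_congr rfl fun j _ => ?_
    have hmem : (boxCorner s * u) j ∈ Icc (0 : ℝ) 1 :=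
      ⟨mul_nonneg (hb j).1 (hu j).1, mul_le_one₀ (hb j).2 (hu j).1 (hu j).2⟩
    rw [coe_projIcc, min_eq_right hmem.2, max_eq_right hmem.1, Pi.mul_apply, mul_assoc]
  rw [h1, integral_fintype_prod_eq_prod
    (f := fun j u => boxCorner s j * (u * byPartsDensity (W j) (ϑ j) (x j) u))]
  exact Finset.prod_congr rfl fun j _ => by
    rw [integral_const_mul, integral_id_mul_byPartsDensity]

theorem pathFunctional_boxVolume_pos {W τbar : Fin 3 → ℝ} (hW : ∀ j, 0 < W j)
    (hτbar : ∀ j, 0 < τbar j) {s : ℝ} (hs : s ∈ Ioc (0 : ℝ) 1) {q : Fin 3 → ℝ} (hq : q ∈ Icc 0 1) :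
    0 < pathFunctional W τbar τbar boxVolume s q := by
  have hb : ∀ j, 0 < boxCorner s j := fun j => by
    fin_cases j <;> simp [boxCorner, hs.1]
  unfold pathFunctional
  rw [pathIntegral_boxVolume W _ _ ⟨hs.1.le, hs.2⟩]
  refine mul_pos (Real.sqrt_pos.2 (Finset.prod_pos fun j _ => hτbar j))
    (Finset.prod_pos fun j _ => mul_pos (hb j) ?_)
  exact integral_kernelFactor_pos (hW j) (mul_pos (hτbar j) (hb j)) (hq.1 j) (hq.2 j)

theorem tendsto_sSup_pathFunctional_discretize {y : (Fin 3 → unitInterval) → ℝ} (hy : Continuous y)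
    {W τbar : Fin 3 → ℝ} (hW : ∀ j, 0 < W j) (hτbar : ∀ j, 0 < τbar j)
    {K : Set (ℝ × (Fin 3 → ℝ))} (hK : K.Nonempty) (hK1 : ∀ z ∈ K, z.1 ∈ Icc (0 : ℝ) 1) :
    Tendsto (fun N : ℕ => sSup ((fun z : ℝ × (Fin 3 → ℝ) =>
        |pathFunctional W τbar τbar (discretize (fun _ => N + 1) y) z.1 z.2|) '' K)) atTop
      (𝓝 (sSup ((fun z : ℝ × (Fin 3 → ℝ) => |pathFunctional W τbar τbar y z.1 z.2|) '' K))) := by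
  set R := ∑ j, τbar j
  have hR : ∀ j, τbar j ∈ Icc 0 R := fun j =>
    ⟨(hτbar j).le, Finset.single_le_sum (f := τbar) (fun j _ => (hτbar j).le) (Finset.mem_univ j)⟩
  have hL : 0 ≤ lipBound W R := lipBound_nonneg hW ((hR 0).1.trans (hR 0).2)
  have hn : Tendsto (fun (N : ℕ) (_ : Fin 3) => N + 1) atTop atTop :=
    tendsto_atTop.2 fun m => (eventually_ge_atTop (∑ j, m j)).mono fun N hN j =>
      ((Finset.single_le_sum (fun j _ => (m j).zero_le) (Finset.mem_univ j)).trans hN).trans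
        N.le_succ
  rw [Metric.tendsto_nhds]
  intro η hη
  set e := η / (lipBound W R + 1) with he
  have he0 : 0 < e := by positivity
  have hle : lipBound W R * e < η := by
    calc lipBound W R * e < (lipBound W R + 1) * e := by gcongr; linarith
      _ = η := by rw [he]; field_simp
  have hbdd : ∀ {y : (Fin 3 → unitInterval) → ℝ}, IsTamePath y →
      BddAbove ((fun z : ℝ × (Fin 3 → ℝ) => |pathFunctional W τbar τbar y z.1 z.2|) '' K) := by
    intro y hy
    obtain ⟨M, hM⟩ := hy.bounded
    refine ⟨lipBound W R * M, ?_⟩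
    rintro _ ⟨z, hz, rfl⟩
    exact abs_pathFunctional_le hM hW hR (hK1 z hz) _
  filter_upwards [hn.eventually (eventually_abs_discretize_sub_lt hy he0)] with N hN
  rw [Real.dist_eq]
  refine (abs_sSup_sub_sSup_le (η := lipBound W R * e) hK (hbdd (isTamePath_discretize _ y))
    (hbdd (.of_continuous hy)) fun z hz => ?_).trans_lt hle
  rw [← pathFunctional_sub (isTamePath_discretize _ _) (.of_continuous hy) hW]
  exact abs_pathFunctional_le (fun t => (hN t).le) hW hR (hK1 z hz) _

theorem IsBrownianMotion.ae_continuous {Ω : Type*} [MeasurableSpace Ω] {P : Measure Ω} {q : ℕ}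
    {B : (Fin q → ℝ) → Ω → ℝ} (hB : IsBrownianMotion B P) :
    ∀ᵐ ω ∂P, Continuous fun v : Fin q → unitInterval => B (fun j => (v j : ℝ)) ω := by
  filter_upwards [hB.continuous_paths] with ω hω
  exact hω.comp_continuous (by fun_prop) fun v => ⟨fun j => (v j).2.1, fun j => (v j).2.2⟩

/-- Conditionally on the tied-down values, the supremum is a function of the independent Gaussian
corner value that equals c at finitely many points only; Fubini then gives the claim. -/
theorem IsBrownianMotion.ae_sSup_relSup_ne {Ω : Type*} [MeasurableSpace Ω] {P : Measure Ω}
    [IsProbabilityMeasure P] {B : (Fin 3 → ℝ) → Ω → ℝ} (hB : IsBrownianMotion B P)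
    {W τbar : Fin 3 → ℝ} (hW : ∀ j, 0 < W j) (hτbar : ∀ j, 0 < τbar j) {σ : ℝ} (hσ : 0 < σ)
    {A : Set (Fin 3 → ℝ)} (hA : IsCompact A) (hA' : A.Nonempty) (hA1 : A ⊆ Icc 0 1)
    {s₀ r : ℝ} (hs₀ : 0 < s₀) (hr : r ∈ Icc s₀ 1) (c : ℝ) :
    ∀ᵐ ω ∂P, sSup (relSup A (pathFunctional W τbar τbar fun v => σ * B (fun j => (v j : ℝ)) ω) ''
      Icc s₀ r) ≠ c := by
  set K : Set (ℝ × (Fin 3 → ℝ)) := Icc s₀ r ×ˢ A with hKdef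
  have hI : (Icc s₀ r).Nonempty := nonempty_Icc.2 hr.1
  have hK : K.Nonempty := hI.prod hA'
  have hKc : IsCompact K := isCompact_Icc.prod hA
  have hK0 : ∀ z ∈ K, z.1 ∈ Ioc (0 : ℝ) 1 := fun z hz =>
    ⟨hs₀.trans_le hz.1.1, hz.1.2.trans hr.2⟩
  have hK1 : ∀ z ∈ K, z.1 ∈ Icc (0 : ℝ) 1 := fun z hz => Ioc_subset_Icc_self (hK0 z hz)
  let S : ((Fin 3 → unitInterval) → ℝ) → ℝ := fun y =>
    sSup ((fun z : ℝ × (Fin 3 → ℝ) => |pathFunctional W τbar τbar y z.1 z.2|) '' K)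
  let M : ℕ → (ℕ × (Fin 3 → ℕ) → ℝ) × ℝ → ℝ := fun N p => S (stepPath (fun _ => N + 1) fun i =>
    σ * (p.1 (N, i) + p.2 * boxVolume (gridPoint (fun _ => N + 1) i)))
  have hM : ∀ N, Measurable (M N) := fun N =>
    (continuous_sSup_pathFunctional_stepPath hW τbar (fun j => (hτbar j).le) (fun _ => N + 1) hK
      hK1).measurable.comp (measurable_pi_iff.2 fun i => by fun_prop)
  -- The supremum for the full path is reached as a limit of measurable functions of countably many
  -- grid values, so this event is measurable in the pair of tied-down values and corner value.
  let E : Set ((ℕ × (Fin 3 → ℕ) → ℝ) × ℝ) := {p | Tendsto (fun N => M N p) atTop (𝓝 c)}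
  have hE : MeasurableSet E := measurableSet_tendsto (𝓝 c) hM
  -- The path whose corner value B(1,1,1) is replaced by a free parameter a while its tied-down part
  -- is kept; at a = B(1,1,1) it is σB.
  let y : Ω → ℝ → (Fin 3 → unitInterval) → ℝ := fun ω a v =>
    σ * (B (fun j => (v j : ℝ)) ω - boxVolume v * B 1 ω) + a * (σ * boxVolume v)
  have hycont : ∀ᵐ ω ∂P, ∀ a, Continuous (y ω a) := by
    filter_upwards [hB.ae_continuous] with ω hω a
    exact (continuous_const.mul (hω.sub (continuous_boxVolume.mul continuous_const))).add
      (continuous_const.mul (continuous_const.mul continuous_boxVolume))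
  have hlim : ∀ᵐ ω ∂P, ∀ a, Tendsto (fun N => M N (fun t => tiedValue B t ω, a)) atTop
      (𝓝 (S (y ω a))) := by
    filter_upwards [hycont] with ω hω a
    refine (tendsto_sSup_pathFunctional_discretize (hω a) hW hτbar hK hK1).congr fun N => ?_
    have : discretize (fun _ => N + 1) (y ω a) = stepPath (fun _ => N + 1) fun i =>
        σ * (tiedValue B (N, i) ω + a * boxVolume (gridPoint (fun _ => N + 1) i)) := by
      unfold discretize
      congr 1
      ext i
      simp only [y, tiedValue, gridValue, boxVolume]
      ring
    simp only [M, S, this]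
  have hm1 : AEMeasurable (B 1) P := hB.aemeasurable ⟨zero_le_one, le_rfl⟩
  have hmt : AEMeasurable (fun ω t => tiedValue B t ω) P := aemeasurable_pi_iff.2 fun t =>
    (hB.isGaussianProcess_gridValue.aemeasurable t).sub (hm1.const_mul _)
  have hsec : ∀ᵐ w ∂(P.map fun ω t => tiedValue B t ω), P.map (B 1) (Prod.mk w ⁻¹' E) = 0 := by
    refine (ae_map_iff hmt ?_).2 ?_
    · exact measurable_measure_prodMk_left hE (measurableSet_singleton 0)
    filter_upwards [hlim, hB.ae_continuous] with ω h1 hω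
    refine hB.measure_one_mem_eq_zero ?_
    have hc1 : Continuous fun v : Fin 3 → unitInterval =>
        σ * (B (fun j => (v j : ℝ)) ω - boxVolume v * B 1 ω) :=
      continuous_const.mul (hω.sub (continuous_boxVolume.mul continuous_const))
    have hc2 : Continuous fun v : Fin 3 → unitInterval => σ * boxVolume v := by fun_prop
    have hcont : ∀ {y : (Fin 3 → unitInterval) → ℝ}, Continuous y →
        ContinuousOn (fun z : ℝ × (Fin 3 → ℝ) => pathFunctional W τbar τbar y z.1 z.2) K :=
      fun hy => ((continuous_pathFunctional hy hW τbar).comp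
        (by fun_prop : Continuous fun z : ℝ × (Fin 3 → ℝ) => (τbar, z.1, z.2))).continuousOn
    refine (finite_setOf_sSup_abs_affine_eq hKc hK (hcont hc1) (hcont hc2) (fun z hz => ?_) c).subset
      fun a ha => ?_
    · rw [pathFunctional_const_mul]
      exact (mul_pos hσ (pathFunctional_boxVolume_pos hW hτbar (hK0 z hz) (hA1 hz.2))).ne'
    · have h2 : S (y ω a) = c := tendsto_nhds_unique (h1 a) ha
      rw [← h2]
      simp only [mem_ofPred_eq, S, y]
      have hc3 : Continuous fun v : Fin 3 → unitInterval => a * (σ * boxVolume v) :=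
        continuous_const.mul hc2
      rw [image_congr fun z _ => ?_]
      rw [← pathFunctional_const_mul a, ← pathFunctional_add (.of_continuous hc1)
        (.of_continuous hc3) hW]
  have hnull : P.map (fun ω => ((fun t => tiedValue B t ω), B 1 ω)) E = 0 := by
    rw [(indepFun_iff_map_prod_eq_prod_map_map hmt hm1).1 hB.indepFun_one_tiedValue.symm]
    have := Measure.isProbabilityMeasure_map hm1
    have := Measure.isProbabilityMeasure_map hmt
    exact (Measure.measure_prod_null hE).2 hsec
  have hout : ∀ᵐ ω ∂P, ((fun t => tiedValue B t ω), B 1 ω) ∉ E :=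
    ae_of_ae_map (hmt.prodMk hm1) (measure_eq_zero_iff_ae_notMem.1 hnull)
  filter_upwards [hout, hlim, hycont] with ω h1 h2 hω heq
  refine h1 ?_
  have h3 := h2 (B 1 ω)
  have hyB : y ω (B 1 ω) = fun v => σ * B (fun j => (v j : ℝ)) ω := by
    ext v; simp only [y]; ring
  have h4 : S (y ω (B 1 ω)) = c := by
    rw [hyB, ← heq]
    refine (sSup_image_relSup hA' hI ?_).symm
    have hc := hω (B 1 ω)
    rw [hyB] at hc
    exact (hKc.image_of_continuousOn ((continuous_pathFunctional hc hW τbar).comp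
        (by fun_prop : Continuous fun z : ℝ × (Fin 3 → ℝ) => (τbar, z.1, z.2))).abs.continuousOn).bddAbove
  rwa [h4] at h3

/-! ### Convergence of the detectors -/

theorem discretePassageTime_congr {s₀ c : ℝ} {m : ℕ} {D D' : ℝ → ℝ}
    (h : ∀ k : ℕ, k ≤ m → D ((k : ℝ) / m) = D' ((k : ℝ) / m)) :
    discretePassageTime s₀ m c D = discretePassageTime s₀ m c D' := by
  unfold discretePassageTime
  congr 2
  ext k
  exact and_congr_right fun _ => and_congr_right fun hk => by rw [h k hk]

theorem passageTime_congr {s₀ c : ℝ} {D D' : ℝ → ℝ} (h : ∀ s ∈ Icc s₀ 1, D s = D' s) :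
    passageTime s₀ c D = passageTime s₀ c D' := by
  unfold passageTime
  congr 2
  ext s
  exact and_congr_right fun hs => by rw [h s hs]

theorem SkorohodSpace.ofFun_val {q : ℕ} {f : (Fin q → unitInterval) → ℝ} (hf : Continuous f) :
    (SkorohodSpace.ofFun f).1 = f := by
  have h : SkorohodSpace.ofFun f = ⟨f, isCadlag_of_continuous hf⟩ :=
    dif_pos (isCadlag_of_continuous hf)
  rw [h]

/-- Both detectors are treated at once: they differ only in the compact set `A` of relative
positions. -/
theorem tendstoInDistribution_discretePassageTime
    {Ω : Type*} [MeasurableSpace Ω] {P : Measure Ω} [IsProbabilityMeasure P]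
    {Ω' : Type*} [MeasurableSpace Ω'] {P' : Measure Ω'} [IsProbabilityMeasure P']
    {W : Fin 3 → ℝ} (hW : ∀ j, 0 < W j)
    {τ : Fin 3 → ℕ → ℝ} (hτ : ∀ j m, 0 < τ j m)
    {τbar : Fin 3 → ℝ} (hτbar : ∀ j, 0 < τbar j)
    (hlim : ∀ j, Tendsto (fun m : ℕ => (m : ℝ) * τ j m) atTop (𝓝 (τbar j)))
    {ε : (Fin 3 → ℤ) → Ω → ℝ} (hε : ∀ i, AEMeasurable (ε i) P)
    {B : (Fin 3 → ℝ) → Ω' → ℝ} (hB : IsBrownianMotion B P') {σ : ℝ} (hσ : 0 < σ)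
    (hFCLT : TendstoInDistribution (fun n : Fin 3 → ℕ => partialSumProcess ε n) atTop
      (fun ω => SkorohodSpace.ofFun (fun v => σ * B (fun j => (v j : ℝ)) ω)) (fun _ => P) P')
    {f f₀ : (Fin 3 → ℝ) → ℝ} (hnull : NullHypothesis τbar τ f f₀)
    {s₀ : ℝ} (hs₀ : 0 < s₀) (hs₀' : s₀ < 1) (c : ℝ)
    {A : Set (Fin 3 → ℝ)} (hA : IsCompact A) (hA' : A.Nonempty) (hA1 : A ⊆ Icc 0 1)
    {norm : (ℝ → (Fin 3 → ℝ) → ℝ) → ℝ → ℝ} (hnorm : ∀ G s, 0 ≤ s →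
      norm G s = relSup A (fun s q => G s (τbar * boxCorner s * q)) s) :
    TendstoInDistribution
      (fun (n : Fin 3 → ℕ) ω => discretePassageTime s₀ (n 0) c
        (norm (detectionProcess W τ f f₀ ε n ω)) / ((n 0 : ℝ) : EReal))
      atTop (fun ω => passageTime s₀ c (norm (limitProcess W τbar σ B ω))) (fun _ => P) P' := by
  set Z : Ω' → SkorohodSpace 3 := fun ω =>
    SkorohodSpace.ofFun (fun v => σ * B (fun j => (v j : ℝ)) ω) with hZ
  have hZB : ∀ᵐ ω ∂P', (Z ω).1 = fun v => σ * B (fun j => (v j : ℝ)) ω := by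
    filter_upwards [hB.ae_continuous] with ω hω
    exact SkorohodSpace.ofFun_val (continuous_const.mul hω)
  have hZc : ∀ᵐ ω ∂P', Continuous (Z ω).1 := by
    filter_upwards [hZB, hB.ae_continuous] with ω h1 h2
    rw [h1]
    exact continuous_const.mul h2
  set θ : (Fin 3 → ℕ) → Fin 3 → ℝ := fun n j => (n j : ℝ) * τ j (n j) with hθdef
  have hcoord : ∀ j : Fin 3, Tendsto (fun n : Fin 3 → ℕ => n j) atTop atTop := fun j =>
    tendsto_atTop.2 fun b => (eventually_ge_atTop fun _ => b).mono fun n hn => hn j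
  have hθ : Tendsto θ atTop (𝓝 τbar) :=
    tendsto_pi_nhds.2 fun j => (hlim j).comp (hcoord j)
  set H : (Fin 3 → ℕ) → SkorohodSpace 3 → EReal := fun n y => discretePassageTime s₀ (n 0) c
    (relSup A (pathFunctional W τbar (θ n) (discretize n y.1))) / ((n 0 : ℝ) : EReal) with hH
  set G : SkorohodSpace 3 → EReal := fun x =>
    passageTime s₀ c (relSup A (pathFunctional W τbar τbar x.1)) with hG
  have hne : ∀ᵐ ω ∂P', ∀ r : ℚ, (r : ℝ) ∈ Icc s₀ 1 →
      sSup (relSup A (pathFunctional W τbar τbar (Z ω).1) '' Icc s₀ (r : ℝ)) ≠ c := by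
    refine ae_all_iff.2 fun r => ?_
    by_cases hr : (r : ℝ) ∈ Icc s₀ 1
    · filter_upwards [hB.ae_sSup_relSup_ne hW hτbar hσ hA hA' hA1 hs₀ hr c, hZB] with ω h1 h2 _
      rwa [h2]
    · exact Eventually.of_forall fun ω h => absurd h hr
  have hHG : ∀ᵐ ω ∂P', Tendsto (fun p : (Fin 3 → ℕ) × SkorohodSpace 3 => H p.1 p.2)
      (atTop ×ˢ 𝓝 (Z ω)) (𝓝 (G (Z ω))) := by
    filter_upwards [hZc, hne] with ω h1 h2
    exact tendsto_discretePassageTime ((hcoord 0).comp tendsto_fst)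
      (continuous_relSup h1 hW τbar τbar hA)
      (fun η hη => eventually_abs_relSup_sub_lt h1 hW hτbar hθ hA hA' hη) hs₀ hs₀' h2
  -- The limit passage time is an almost sure limit of discrete passage times of discretized limit
  -- paths, and each of these depends measurably on finitely many values of B.
  have hGm : AEMeasurable (fun ω => G (Z ω)) P' := by
    refine aemeasurable_of_tendsto_metrizable_ae (atTop : Filter (Fin 3 → ℕ))
      (f := fun n ω => H n (Z ω)) (fun n => ?_) ?_
    · refine aemeasurable_discretePassageTime_div s₀ c (n 0) fun k hk => ?_
      refine aemeasurable_relSup_discretize hW τbar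
        (fun j => mul_nonneg (n j).cast_nonneg (hτ j _).le) n hA'
        ⟨by positivity, div_le_one_of_le₀ (by exact_mod_cast hk) (Nat.cast_nonneg _)⟩ fun i => ?_
      have : AEMeasurable (fun ω => σ * B (fun j => (gridPoint n i j : ℝ)) ω) P' :=
        (hB.aemeasurable ⟨fun j => (gridPoint n i j).2.1, fun j => (gridPoint n i j).2.2⟩).const_mul σ
      refine this.congr ?_
      filter_upwards [hZB] with ω hω
      rw [hω]
    · filter_upwards [hHG] with ω hω
      have h : Tendsto (fun n : Fin 3 → ℕ => (n, Z ω)) atTop (atTop ×ˢ 𝓝 (Z ω)) :=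
        tendsto_id.prodMk tendsto_const_nhds
      exact Tendsto.comp (f := fun n => (n, Z ω))
        (g := fun p : (Fin 3 → ℕ) × SkorohodSpace 3 => H p.1 p.2) hω h
  have hYH : ∀ᶠ n : Fin 3 → ℕ in atTop, ∀ ω, discretePassageTime s₀ (n 0) c
      (norm (detectionProcess W τ f f₀ ε n ω)) / ((n 0 : ℝ) : EReal) =
      H n (partialSumProcess ε n ω) := by
    -- The identity holds as soon as all sample sizes are positive; smaller n are irrelevant for the
    -- limit.
    filter_upwards [eventually_ge_atTop 1] with n hn ω
    simp only [hH]
    congr 1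
    refine discretePassageTime_congr fun k hk => ?_
    rw [hnorm _ _ (by positivity)]
    unfold relSup partialSumProcess
    simp only [detectionProcess_eq_pathIntegral hW hnull ε hn ω hk, discretize_partialSumFun]
    rfl
  have hY : ∀ n : Fin 3 → ℕ, AEMeasurable (fun ω => discretePassageTime s₀ (n 0) c
      (norm (detectionProcess W τ f f₀ ε n ω)) / ((n 0 : ℝ) : EReal)) P := by
    refine fun n => aemeasurable_discretePassageTime_div s₀ c (n 0) fun k _ => ?_
    have h := aemeasurable_sSup_abs_detectionProcess W τ f f₀ hε n ((k : ℝ) / n 0)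
      (hA'.image fun q => τbar * boxCorner ((k : ℝ) / n 0) * q)
    simp only [image_image] at h
    refine h.congr (Eventually.of_forall fun ω => ?_)
    exact (hnorm _ _ (by positivity)).symm
  refine (tendstoInDistribution_of_tendsto_prod hFCLT hY hYH hGm hHG).congr (fun _ => .rfl) ?_
  filter_upwards [hZB, hB.continuous_paths, hB.zero_faces] with ω h1 h2 h3
  refine passageTime_congr fun s hs => ?_
  rw [hnorm _ _ (hs₀.le.trans hs.1), h1]
  unfold relSup
  simp only [limitProcess_eq_pathFunctional h2 h3 hW τbar σ (hs₀.trans_le hs.1) hs.2]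

end

theorem mainTheorem7
    {Ω : Type*} [MeasurableSpace Ω] (P : Measure Ω) [IsProbabilityMeasure P]
    {Ω' : Type*} [MeasurableSpace Ω'] (P' : Measure Ω') [IsProbabilityMeasure P']
    (W : Fin 3 → ℝ) (hW : ∀ j, 0 < W j)
    (τ : Fin 3 → ℕ → ℝ) (hτ : ∀ j m, 0 < τ j m)
    (τbar : Fin 3 → ℝ) (hτbar : ∀ j, 0 < τbar j)
    (hlim : ∀ j, Tendsto (fun m : ℕ => (m : ℝ) * τ j m) atTop (𝓝 (τbar j)))
    (ε : (Fin 3 → ℤ) → Ω → ℝ) (hε : IsWeaklyStationary ε P)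
    (B : (Fin 3 → ℝ) → Ω' → ℝ) (hB : IsBrownianMotion B P')
    (σ : ℝ) (hσ : 0 < σ)
    (hFCLT : TendstoInDistribution (fun n : Fin 3 → ℕ => partialSumProcess ε n) atTop
      (fun ω => SkorohodSpace.ofFun (fun v => σ * B (fun j => (v j : ℝ)) ω)) (fun _ => P) P')
    (f f₀ : (Fin 3 → ℝ) → ℝ) (hnull : NullHypothesis τbar τ f f₀)
    (s₀ : ℝ) (hs₀ : 0 < s₀) (hs₀' : s₀ < 1) (hlearn : LearningSample s₀ τbar f f₀)
    (cL cM : ℝ) (hcL : 0 < cL) (hcM : 0 < cM) :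
    TendstoInDistribution
        (fun (n : Fin 3 → ℕ) ω => discretePassageTime s₀ (n 0) cL
          (localSup τbar (detectionProcess W τ f f₀ ε n ω)) / ((n 0 : ℝ) : EReal))
        atTop
        (fun ω => passageTime s₀ cL (localSup τbar (limitProcess W τbar σ B ω)))
        (fun _ => P) P' ∧
      TendstoInDistribution
        (fun (n : Fin 3 → ℕ) ω => discretePassageTime s₀ (n 0) cM
          (globalSup τbar (detectionProcess W τ f f₀ ε n ω)) / ((n 0 : ℝ) : EReal))
        atTop
        (fun ω => passageTime s₀ cM (globalSup τbar (limitProcess W τbar σ B ω)))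
        (fun _ => P) P' := by
  exact ⟨tendstoInDistribution_discretePassageTime hW hτ hτbar hlim
      (fun i => (hε.memLp i).aestronglyMeasurable.aemeasurable) hB hσ hFCLT hnull hs₀ hs₀' cL
      isCompact_localBox localBox_nonempty localBox_subset
      fun G _ => localSup_eq_relSup hτbar G,
    tendstoInDistribution_discretePassageTime hW hτ hτbar hlim
      (fun i => (hε.memLp i).aestronglyMeasurable.aemeasurable) hB hσ hFCLT hnull hs₀ hs₀' cM
      isCompact_Icc globalBox_nonempty subset_rfl
      fun G _ => globalSup_eq_relSup hτbar G⟩
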